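/- Let $n, r \ge 1$. Let $W$ be the extended affine Weyl group of type $\tilde A_{r-1}$, i.e. the group of permutations $w$ of $\mathbb{Z}$ with $w(i+r)=w(i)+r$ for all $i$, with simple reflections $S=\{s_0,\dots,s_{r-1}\}$ ($S=\emptyset$ if $r=1$), the shift $\rho : i\mapsto i+1$, and the length function $l$ and Bruhat order $\le$ extended from the Coxeter group $W'$ generated by $S$ to $W=\langle\rho\rangle\ltimes W'$. Let $\mathcal{A}=\mathbb{Z}[t,t^{-1}]$, $q=t^2$, and let $\mathcal{H}$ be the extended affine Hecke algebra over $\mathcal{A}$, with $\mathcal{A}$-basis $\{T_w\}_{w\in W}$ and relations $T_wT_{w'}=T_{ww'}$ if $l(ww')=l(w)+l(w')$, and $(T_s+1)(T_s-q)=0$ for $s\in S$. Let $\{C_w\}_{w\in W}$ be its Kazhdan–Lusztig basis: $C_w$ is the unique element of the form $C_w=t^{-l(w)}\sum_{y\le w}P_{y,w}(q)T_y$, with $P_{y,w}\in\mathbb{Z}[q]$, $P_{w,w}=1$ and $\deg P_{y,w}\le\frac12(l(w)-l(y)-1)$ for $y<w$, that is fixed by the bar involution $\sum a_wT_w\mapsto\sum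 \overline{a_w}\,T_{w^{-1}}^{-1}$, $\overline{t}=t^{-1}$. Write $C_xC_y=\sum_z h_{x,y,z}C_z$ with $h_{x,y,z}\in\mathcal{A}$. Let $\Lambda(n,r)$ be the set of $\lambda=(\lambda_1,\dots,\lambda_n)\in\mathbb{N}^n$ with sum $r$. For $\lambda\in\Lambda(n,r)$ let $W_\lambda$ be the standard Young subgroup, generated by the $s_i$ with $1\le i\le r-1$ and $i$ not a partial sum $\lambda_1+\dots+\lambda_k$; let $x_\lambda=\sum_{w\in W_\lambda}T_w$, and let $w_{0,\lambda}$ be the longest element of $W_\lambda$. The affine $q$-Schur algebra is $\mathcal{S}=\mathrm{End}_{\mathcal{H}}\big(\bigoplus_{\lambda\in\Lambda(n,r)}x_\lambda\mathcal{H}\big)$ (right $\mathcal{H}$-modules). Let $\mathcal{D}_{\lambda\mu}$ be the set of minimal length representatives of the double cosets $W_\lambda\backslash W/W_\mu$; for $w\in\mathcal{D}_{\lambda\mu}$ let $w^+$ be the element of maximal length in $W_\lambda wW_\mu$, and let $\phi_{\lambda,\mu}^w\in\mathcal{S}$ be given by $\phi_{\lambda,\mu}^w(x_\nu h)=\delta_{\mu\nu}\sum_{x\in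 W_\lambda wW_\mu}T_xh$ (an element of $x_\lambda\mathcal{H}$). Let $\mathcal{B}$ be the set of triples $A=(\lambda,w,\mu)$ with $\lambda,\mu\in\Lambda(n,r)$ and $w\in\mathcal{D}_{\lambda\mu}$, and put $ro(A)=\lambda$, $co(A)=\mu$, $\sigma(A)=w^+$. Writing $C_{w^+}=\sum_{z\in\mathcal{D}_{\lambda\mu}}\alpha_{z,w}\sum_{x\in W_\lambda zW_\mu}T_x$, set $$\theta_A=t^{l(w_{0,\mu})}\sum_{z\in\mathcal{D}_{\lambda\mu}}\alpha_{z,w}\,\phi_{\lambda,\mu}^z .$$ For $\mu\in\Lambda(n,r)$ put $h_\mu=t^{-l(w_{0,\mu})}\sum_{w\in W_\mu}t^{2l(w)}\in\mathcal{A}$. **Proposition 3.2.** The elements $T_w$ $(w\in W)$ form an $\mathcal{A}$-basis of $\mathcal{H}$; the Kazhdan–Lusztig element $C_w$ exists and is unique for every $w \in W$, and the $C_w$ form an $\mathcal{A}$-basis of $\mathcal{H}$; the elements $\theta_A$ $(A\in\mathcal{B})$ form an $\mathcal{A}$-basis of $\mathcal{S}$. So the constants $h_{x,y,z}$, and the constants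 $g_{A,B,C}\in\mathcal{A}$ with $\theta_A\theta_B=\sum_{C\in\mathcal{B}}g_{A,B,C}\,\theta_C$, are well defined. For all $A,B,C\in\mathcal{B}$: 1. if $g_{A,B,C}\ne0$, then $co(A)=ro(B)$ and $(ro(A),co(B))=(ro(C),co(C))$; 2. if $co(A)=ro(B)$ and $(ro(A),co(B))=(ro(C),co(C))$, then $h_{co(A)}\ne0$ and $h_{co(A)}\cdot g_{A,B,C}=h_{\sigma(A),\sigma(B),\sigma(C)}$. Thus the structure constants of $\mathcal{S}$ are determined by those of $\mathcal{H}$. -/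

import Mathlib

/-! ### Coordinates with respect to a family -/

/-- The ring of Laurent polynomials `ℤ[t, t⁻¹]`. -/
abbrev Laur : Type := LaurentPolynomial ℤ

/-- The power `t ^ k` of the indeterminate, `k` any integer. The parameter `q` is `tpow 2`. -/
noncomputable def tpow (k : ℤ) : Laur := LaurentPolynomial.T k

/-- `b` is a basis of the `ℤ[t, t⁻¹]`-module `M`. -/
def IsBasisFamily {ι M : Type*} [AddCommGroup M] [Module Laur M] (b : ι → M) : Prop :=
  LinearIndependent Laur b ∧ Submodule.span Laur (Set.range b) = ⊤

open Classical in
/-- The coefficients of `m` in its expression as a finite linear combination of the linearly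
independent family `b` (zero if `b` is not independent or `m` is not in the span of `b`). -/
noncomputable def coords {ι M : Type*} [AddCommGroup M] [Module Laur M] (b : ι → M) (m : M) :
    ι →₀ Laur :=
  if h : LinearIndependent Laur b ∧ m ∈ Submodule.span Laur (Set.range b) then
    h.1.repr ⟨m, h.2⟩
  else 0

/-! ### The extended affine Weyl group of type `Ã_{r-1}` -/

/-- The group of all permutations `w` of `ℤ` with `w (i + r) = w i + r` for all `i`. -/
def affineWeyl (r : ℕ) : Subgroup (Equiv.Perm ℤ) where
  carrier := {w | ∀ i : ℤ, w (i + r) = w i + r}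
  one_mem' := fun _ => rfl
  mul_mem' := by
    intro a b ha hb i
    have hb' : b (i + r) = b i + r := hb i
    have ha' : a (b i + r) = a (b i) + r := ha (b i)
    simp only [Equiv.Perm.mul_apply, hb', ha']
  inv_mem' := by
    intro a ha i
    have h : a (a⁻¹ i + r) = i + r := by
      have h1 : a (a⁻¹ i + r) = a (a⁻¹ i) + r := ha (a⁻¹ i)
      simpa using h1
    have h2 : a⁻¹ (a (a⁻¹ i + r)) = a⁻¹ i + r := by simp
    rw [h] at h2
    exact h2

/-- The extended affine Weyl group `W`. -/
abbrev W (r : ℕ) : Type := affineWeyl r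

/-- The shift `ρ : i ↦ i + 1`. -/
def rho (r : ℕ) : W r :=
  ⟨Equiv.addRight (1 : ℤ), fun i => by
    simp only [Equiv.coe_addRight]
    ring⟩

/-- `s` is the simple reflection `s_i`. (For `r = 1` no element of `W` satisfies this.) -/
def IsSimpleReflection {r : ℕ} (i : ℤ) (s : W r) : Prop :=
  ∀ j : ℤ,
    (j ≡ i [ZMOD r] → (s : Equiv.Perm ℤ) j = j + 1) ∧
    (j ≡ i + 1 [ZMOD r] → (s : Equiv.Perm ℤ) j = j - 1) ∧
    (¬ j ≡ i [ZMOD r] → ¬ j ≡ i + 1 [ZMOD r] → (s : Equiv.Perm ℤ) j = j)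

/-- The set `S = {s_0, …, s_{r-1}}` of simple reflections. -/
def simpleReflections (r : ℕ) : Set (W r) :=
  {s | ∃ i : ℤ, 0 ≤ i ∧ i < r ∧ IsSimpleReflection i s}

/-- The length function: if `w = ρ ^ m * w'` with `w'` in the Coxeter group generated by `S`,
then the length of `w` is the least number of factors in an expression of `w'` as a product of
elements of `S`. -/
noncomputable def len {r : ℕ} (w : W r) : ℕ :=
  sInf {k | ∃ (m : ℤ) (L : List (W r)),
    (∀ s ∈ L, s ∈ simpleReflections r) ∧ w = rho r ^ m * L.prod ∧ L.length = k}

/-- The Bruhat order: generated by `x < x * u` for reflections `u` (conjugates of simple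
reflections) with `len x < len (x * u)`. Elements with different components in the subgroup
generated by `ρ` are incomparable. -/
def bruhatLE {r : ℕ} (y w : W r) : Prop :=
  Relation.ReflTransGen
    (fun a b : W r => len a < len b ∧
      ∃ v : W r, ∃ s ∈ simpleReflections r, b = a * (v * s * v⁻¹)) y w

/-! ### The extended affine Hecke algebra -/

/-- The defining relations of the Hecke algebra in the generators `T_w`. -/
inductive HeckeRel (r : ℕ) : FreeAlgebra Laur (W r) → FreeAlgebra Laur (W r) → Prop
  | one : HeckeRel r (FreeAlgebra.ι Laur 1) 1
  | mul (w w' : W r) (h : len (w * w') = len w + len w') :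
      HeckeRel r (FreeAlgebra.ι Laur w * FreeAlgebra.ι Laur w') (FreeAlgebra.ι Laur (w * w'))
  | quad (s : W r) (h : s ∈ simpleReflections r) :
      HeckeRel r
        ((FreeAlgebra.ι Laur s + 1) * (FreeAlgebra.ι Laur s - algebraMap Laur _ (tpow 2))) 0

/-- The extended affine Hecke algebra over `ℤ[t, t⁻¹]`, with `q = t²`. -/
def Hecke (r : ℕ) : Type := RingQuot (HeckeRel r)

noncomputable instance (r : ℕ) : Ring (Hecke r) := inferInstanceAs (Ring (RingQuot (HeckeRel r)))

noncomputable instance (r : ℕ) : Algebra Laur (Hecke r) :=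
  inferInstanceAs (Algebra Laur (RingQuot (HeckeRel r)))

/-- The standard basis element `T_w`. -/
noncomputable def heckeT {r : ℕ} (w : W r) : Hecke r :=
  RingQuot.mkAlgHom Laur (HeckeRel r) (FreeAlgebra.ι Laur w)

/-- The sum `∑ T_x` over a (finite) set `D` of elements of `W`. -/
noncomputable def heckeSum {r : ℕ} (D : Set (W r)) : Hecke r := ∑ᶠ x ∈ D, heckeT x

/-- The bar involution `∑ a_w T_w ↦ ∑ (bar a_w) (T_{w⁻¹})⁻¹`, where `bar t = t⁻¹`. -/
noncomputable def heckeBar {r : ℕ} (h : Hecke r) : Hecke r :=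
  (coords (heckeT (r := r)) h).sum
    fun w a => (LaurentPolynomial.invert a : Laur) • Ring.inverse (heckeT w⁻¹)

/-- `c` is the Kazhdan-Lusztig element of `w`: it is fixed by the bar involution, and
`c = t ^ (- len w) * ∑_{y ≤ w} P_y(q) T_y` with `P_y ∈ ℤ[q]`, `P_w = 1`, and
`deg P_y ≤ (len w - len y - 1) / 2` for `y < w`. -/
def IsKLElement {r : ℕ} (w : W r) (c : Hecke r) : Prop :=
  heckeBar c = c ∧
  ∃ P : W r → Polynomial ℤ,
    P w = 1 ∧
    (∀ y, bruhatLE y w → y ≠ w → 2 * (P y).natDegree + len y + 1 ≤ len w) ∧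
    c = ∑ᶠ y ∈ {y : W r | bruhatLE y w},
      (tpow (-(len w : ℤ)) * Polynomial.aeval (tpow 2) (P y)) • heckeT y

/-- The Kazhdan-Lusztig basis element `C_w`, the unique element with the above property. -/
noncomputable def klC {r : ℕ} (w : W r) : Hecke r := Classical.epsilon (IsKLElement w)

/-- The structure constants of the Hecke algebra: `C_x C_y = ∑ h_{x,y,z} C_z`. -/
noncomputable def klStruct {r : ℕ} (x y z : W r) : Laur :=
  coords (klC (r := r)) (klC x * klC y) z

/-! ### Compositions and Young subgroups -/

/-- The set `Λ(n, r)` of `n`-periodic sequences of natural numbers whose sum over a period is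
`r`, given by their values on a period. -/
abbrev Comp (n r : ℕ) : Type := {lam : Fin n → ℕ // ∑ i, lam i = r}

/-- The set `I(λ)` of those `s_i`, `1 ≤ i ≤ r - 1`, for which `i` is not a partial sum of `λ`. -/
def youngGenerators {n r : ℕ} (lam : Comp n r) : Set (W r) :=
  {s | ∃ i : ℕ, 1 ≤ i ∧ i + 1 ≤ r ∧
    (∀ k : ℕ, i ≠ ∑ j : Fin n, if (j : ℕ) < k then lam.1 j else 0) ∧
    IsSimpleReflection (i : ℤ) s}

/-- The standard Young subgroup `W_λ`, generated by `I(λ)`. -/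
def young {n r : ℕ} (lam : Comp n r) : Subgroup (W r) := Subgroup.closure (youngGenerators lam)

/-- The double coset `W_λ w W_μ`. -/
def dcoset {n r : ℕ} (lam mu : Comp n r) (w : W r) : Set (W r) :=
  {y | ∃ a ∈ young lam, ∃ b ∈ young mu, y = a * w * b}

/-- The set `𝒟_{λμ}` of representatives of minimal length of the double cosets `W_λ w W_μ`. -/
def minReps {n r : ℕ} (lam mu : Comp n r) : Set (W r) :=
  {w | ∀ y ∈ dcoset lam mu w, len w ≤ len y}

/-- The element `w⁺` of maximal length of `W_λ w W_μ`. -/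
noncomputable def maxRep {n r : ℕ} (lam mu : Comp n r) (w : W r) : W r :=
  Classical.epsilon fun x => x ∈ dcoset lam mu w ∧ ∀ y ∈ dcoset lam mu w, len y ≤ len x

/-- The longest element `w_{0,μ}` of `W_μ`. -/
noncomputable def longest {n r : ℕ} (mu : Comp n r) : W r :=
  Classical.epsilon fun x => x ∈ young mu ∧ ∀ y ∈ young mu, len y ≤ len x

/-- The polynomial `h_μ = t ^ (- len w_{0,μ}) * ∑_{w ∈ W_μ} t ^ (2 len w)`. -/
noncomputable def poincare {n r : ℕ} (mu : Comp n r) : Laur :=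
  tpow (-(len (longest mu) : ℤ)) * ∑ᶠ w ∈ (young mu : Set (W r)), tpow (2 * (len w : ℤ))

/-! ### The affine `q`-Schur algebra -/

/-- The element `x_λ = ∑_{w ∈ W_λ} T_w`. -/
noncomputable def xElt {n r : ℕ} (lam : Comp n r) : Hecke r := heckeSum (young lam : Set (W r))

/-- The right ideal `x_λ H` of the Hecke algebra, as a right module. -/
noncomputable def xIdeal {n r : ℕ} (lam : Comp n r) : Submodule (Hecke r)ᵐᵒᵖ (Hecke r) :=
  Submodule.span (Hecke r)ᵐᵒᵖ {xElt lam}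

/-- The right `H`-module `⨁_λ x_λ H`. -/
abbrev xSum (n r : ℕ) : Type := DirectSum (Comp n r) fun lam => xIdeal lam

/-- A shortcut for instance search. -/
noncomputable instance (n r : ℕ) : AddCommGroup (xSum n r) := inferInstance

/-- The affine `q`-Schur algebra, the algebra of endomorphisms of the right `H`-module
`⨁_λ x_λ H`, with composition as multiplication. -/
abbrev Schur (n r : ℕ) : Type := Module.End (Hecke r)ᵐᵒᵖ (xSum n r)

/-- `f` is the endomorphism `φ_{λ,μ}^w`: it sends `x_ν h` (in the summand of index `ν`) to
`δ_{μν} ∑_{x ∈ W_λ w W_μ} T_x h` (in the summand of index `λ`). -/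
def IsStdElement {n r : ℕ} (lam mu : Comp n r) (w : W r) (f : Schur n r) : Prop :=
  ∀ (nu : Comp n r) (h : Hecke r) (v : xIdeal nu), (v : Hecke r) = xElt nu * h →
    ∀ kap : Comp n r,
      ((f (DirectSum.of (fun lam : Comp n r => xIdeal lam) nu v)) kap : Hecke r) =
        if nu = mu ∧ kap = lam then heckeSum (dcoset lam mu w) * h else 0

/-- The standard basis element `φ_{λ,μ}^w`. -/
noncomputable def stdPhi {n r : ℕ} (lam mu : Comp n r) (w : W r) : Schur n r :=
  Classical.epsilon (IsStdElement lam mu w)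

/-- The set `𝓑` of triples `(λ, w, μ)` with `w ∈ 𝒟_{λμ}`. Under the bijection of `𝓑` with
the `n`-periodic matrices of size `r`, the components `λ` and `μ` are the row sums and the
column sums. -/
structure Triple (n r : ℕ) where
  /-- the component `λ` -/
  ro : Comp n r
  /-- the component `w` -/
  w : W r
  /-- the component `μ` -/
  co : Comp n r
  /-- `w` has minimal length in its double coset -/
  mem : w ∈ minReps ro co

/-- `σ(A) = w_A⁺`. -/
noncomputable def Triple.sigma {n r : ℕ} (A : Triple n r) : W r := maxRep A.ro A.co A.w

/-- The coefficients `α_{z,w}` in `C_{w⁺} = ∑_{z ∈ 𝒟_{λμ}} α_{z,w} T_{W_λ z W_μ}`, for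
`A = (λ, w, μ)`. -/
noncomputable def alphaCoeff {n r : ℕ} (A : Triple n r) : minReps A.ro A.co →₀ Laur :=
  coords (fun z : minReps A.ro A.co => heckeSum (dcoset A.ro A.co (z : W r))) (klC A.sigma)

/-- The element `θ_A = t ^ (len w_{0,μ}) ∑_{z ∈ 𝒟_{λμ}} α_{z,w} φ_{λ,μ}^z`, for
`A = (λ, w, μ)`. -/
noncomputable def theta {n r : ℕ} (A : Triple n r) : Schur n r :=
  tpow (len (longest A.co) : ℤ) •
    (alphaCoeff A).sum fun z a => a • stdPhi A.ro A.co (z : W r)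

/-- The structure constants of the affine `q`-Schur algebra:
`θ_A θ_B = ∑_C g_{A,B,C} θ_C`. -/
noncomputable def schurStruct {n r : ℕ} (A B C : Triple n r) : Laur :=
  coords (theta (n := n) (r := r)) (theta A * theta B) C

/-! Write `x_μ` for the sum of the `T_w` over `W_μ`. A homomorphism from `x_μ H` to `x_λ H` is
determined by the image `D` of `x_μ`. Such a `D` satisfies `T_s D = q D` for the generators `s` of
`W_λ` and `D T_s = q D` for those of `W_μ`. Conversely every such `D` occurs: it has the form `d
x_μ`, and left multiplication by `d` is the homomorphism. So the Schur algebra consists of matrices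
of two-sided invariant elements, and `θ_A` has the single nonzero entry `t ^ l(w_{0,μ}) C_{σ(A)}`,
where `μ = co(A)` (`evalX_theta`).

The elements `C_x`, with `x` longest in its double coset, form a basis of the invariant elements
(`mem_span_klC_of_isInv`). They are invariant because `T_s C_x = q C_x` whenever `s x < x`. They
span because the longest `w` among the remaining terms of an invariant combination would itself be
longest in its double coset. Hence the `θ_A` form a basis.

For the structure constants, let `μ = co(A) = ro(B)` and write `C_{σ(A)} = d' x_μ` and `C_{σ(B)} =
x_μ d`. Since `x_μ x_μ = t ^ l(w_{0,μ}) h_μ x_μ`, the product in `H` is `t ^ l(w_{0,μ}) h_μ d' x_μ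
d`. Composition in the Schur algebra applies `θ_A` to `x_μ d` and gives `d' x_μ d`, up to the
normalizing powers of `t`. The two products thus differ by the factor `h_μ`
(`poincare_mul_schurStruct`), which is nonzero because at `t = 1` it becomes the order of `W_μ`.

The foundations are built from permutations of the integers. Length is identified with the number of
inversions (`len_eq_invNum`), which yields the exchange property, the lifting property of the Bruhat
order and the theory of coset representatives. The `T_w` are independent because commuting left and
right operators on a free module give a regular representation (`regRep`). Kazhdan-Lusztig elements
come from the usual induction, `exists_isKLElement_of_descent`, and their uniqueness from the
triangularity of the bar involution. -/

namespace AffineWeyl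

variable {r : ℕ}

/-! ### Periodic permutations -/

lemma apply_add (w : W r) (j : ℤ) : w.1 (j + r) = w.1 j + r := w.2 j

lemma apply_add_mul (w : W r) (j m : ℤ) : w.1 (j + r * m) = w.1 j + r * m := by
  induction m using Int.induction_on with
  | zero => simp
  | succ m ih =>
    have := apply_add w (j + r * m)
    rw [show j + (r : ℤ) * (m + 1) = j + r * m + r by ring, this, ih]; ring
  | pred m ih =>
    have := apply_add w (j + r * (-m - 1))
    rw [show j + (r : ℤ) * (-m - 1) + r = j + r * (-m) by ring, ih] at this
    linarith

lemma mul_apply (v w : W r) (j : ℤ) : (v * w).1 j = v.1 (w.1 j) := rfl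

lemma one_apply (j : ℤ) : (1 : W r).1 j = j := rfl

lemma inv_apply_self (w : W r) (j : ℤ) : (w⁻¹).1 (w.1 j) = j := by
  rw [← mul_apply, inv_mul_cancel]; rfl

lemma apply_inv_self (w : W r) (j : ℤ) : w.1 ((w⁻¹).1 j) = j := by
  rw [← mul_apply, mul_inv_cancel]; rfl

lemma ext_apply {v w : W r} (h : ∀ j, v.1 j = w.1 j) : v = w := Subtype.ext (Equiv.ext h)

lemma rho_apply (j : ℤ) : (rho r).1 j = j + 1 := rfl

lemma rho_pow_apply (m j : ℤ) : (rho r ^ m).1 j = j + m := by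
  induction m using Int.induction_on generalizing j with
  | zero => simp
  | succ m ih => rw [zpow_add_one, mul_apply, rho_apply, ih]; ring
  | pred m ih =>
    rw [zpow_sub_one, mul_apply, ih]
    have : (rho r)⁻¹.1 j = j - 1 := by
      rw [← inv_apply_self (rho r) (j - 1), rho_apply]; simp
    rw [this]; ring

lemma apply_modEq {w : W r} {i j : ℤ} : w.1 i ≡ w.1 j [ZMOD r] ↔ i ≡ j [ZMOD r] := by
  have key : ∀ (w : W r) {i j : ℤ}, i ≡ j [ZMOD r] → w.1 i ≡ w.1 j [ZMOD r] := by
    intro w i j h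
    obtain ⟨m, hm⟩ := h.dvd
    rw [show j = i + r * m by linarith, apply_add_mul]
    exact (Int.modEq_iff_dvd).2 ⟨m, by ring⟩
  refine ⟨fun h => ?_, key w⟩
  simpa [inv_apply_self] using key w⁻¹ h

lemma eq_of_modEq {w : W r} {i j : ℤ} (h : i ≡ j [ZMOD r]) : w.1 j - w.1 i = j - i := by
  obtain ⟨m, hm⟩ := h.dvd
  rw [show j = i + r * m by linarith, apply_add_mul]; ring

/-- `u` exchanges `a` and `b`, with all their translates by multiples of `r`, and fixes the
other integers. -/
def IsTransposition (a b : ℤ) (u : W r) : Prop :=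
  ¬ a ≡ b [ZMOD r] ∧ u.1 a = b ∧ u.1 b = a ∧
    ∀ j, ¬ j ≡ a [ZMOD r] → ¬ j ≡ b [ZMOD r] → u.1 j = j

lemma IsTransposition.symm {a b : ℤ} {u : W r} (h : IsTransposition a b u) :
    IsTransposition b a u :=
  ⟨fun h' => h.1 h'.symm, h.2.2.1, h.2.1, fun j h1 h2 => h.2.2.2 j h2 h1⟩

lemma IsTransposition.apply_left {a b : ℤ} {u : W r} (h : IsTransposition a b u) {j : ℤ}
    (hj : j ≡ a [ZMOD r]) : u.1 j = j + (b - a) := by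
  have := eq_of_modEq (w := u) hj
  rw [h.2.1] at this; linarith

lemma IsTransposition.apply_right {a b : ℤ} {u : W r} (h : IsTransposition a b u) {j : ℤ}
    (hj : j ≡ b [ZMOD r]) : u.1 j = j - (b - a) := by
  rw [h.symm.apply_left hj]; ring

lemma IsTransposition.mul_self {a b : ℤ} {u : W r} (h : IsTransposition a b u) : u * u = 1 := by
  refine ext_apply fun j => ?_
  rw [mul_apply, one_apply]
  by_cases ha : j ≡ a [ZMOD r]
  · have : u.1 j ≡ b [ZMOD r] := by rw [← h.2.1]; exact apply_modEq.2 ha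
    rw [h.apply_right this, h.apply_left ha]; ring
  by_cases hb : j ≡ b [ZMOD r]
  · have : u.1 j ≡ a [ZMOD r] := by rw [← h.2.2.1]; exact apply_modEq.2 hb
    rw [h.apply_left this, h.apply_right hb]; ring
  rw [h.2.2.2 j ha hb, h.2.2.2 j ha hb]

lemma IsTransposition.inv_eq {a b : ℤ} {u : W r} (h : IsTransposition a b u) : u⁻¹ = u :=
  inv_eq_of_mul_eq_one_left h.mul_self

lemma IsTransposition.unique {a b : ℤ} {u v : W r} (h : IsTransposition a b u)
    (h' : IsTransposition a b v) : u = v := by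
  refine ext_apply fun j => ?_
  by_cases ha : j ≡ a [ZMOD r]
  · rw [h.apply_left ha, h'.apply_left ha]
  by_cases hb : j ≡ b [ZMOD r]
  · rw [h.apply_right hb, h'.apply_right hb]
  rw [h.2.2.2 j ha hb, h'.2.2.2 j ha hb]

lemma IsTransposition.conj {a b : ℤ} {u : W r} (h : IsTransposition a b u) (v : W r) :
    IsTransposition (v.1 a) (v.1 b) (v * u * v⁻¹) := by
  refine ⟨fun h' => h.1 (apply_modEq.1 h'), ?_, ?_, fun j ha hb => ?_⟩
  · simp only [mul_apply, inv_apply_self, h.2.1]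
  · simp only [mul_apply, inv_apply_self, h.2.2.1]
  · have h1 : u.1 ((v⁻¹).1 j) = (v⁻¹).1 j := by
      apply h.2.2.2
      · intro h'; apply ha; rw [← apply_inv_self v j]; exact apply_modEq.2 h'
      · intro h'; apply hb; rw [← apply_inv_self v j]; exact apply_modEq.2 h'
    simp only [mul_apply, h1, apply_inv_self]

lemma isTransposition_of_isSimpleReflection {k : ℤ} {s : W r} (h : IsSimpleReflection k s) :
    IsTransposition k (k + 1) s := by
  refine ⟨fun h' => ?_, (h k).1 rfl, ?_, fun j => (h j).2.2⟩
  · have h1 := (h k).1 rfl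
    have h2 := (h k).2.1 h'
    linarith
  · rw [(h (k + 1)).2.1 rfl]; ring

lemma isSimpleReflection_of_isTransposition {k : ℤ} {s : W r}
    (h : IsTransposition k (k + 1) s) : IsSimpleReflection k s := by
  refine fun j => ⟨fun hj => ?_, fun hj => ?_, h.2.2.2 j⟩
  · rw [h.apply_left hj]; ring
  · rw [h.apply_right hj]; ring

lemma IsTransposition.congr {a b a' b' : ℤ} {u : W r} (h : IsTransposition a b u)
    (ha : a' ≡ a [ZMOD r]) (hab : b' - a' = b - a) : IsTransposition a' b' u := by
  have hb : b' ≡ b [ZMOD r] := by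
    have := ha.add (Int.ModEq.refl (n := (r : ℤ)) (b - a))
    rwa [show a' + (b - a) = b' by linarith, show a + (b - a) = b by ring] at this
  refine ⟨fun h' => h.1 (ha.symm.trans (h'.trans hb)), ?_, ?_, fun j h1 h2 => ?_⟩
  · rw [h.apply_left ha]; linarith
  · rw [h.apply_right hb]; linarith
  · exact h.2.2.2 j (fun h' => h1 (h'.trans ha.symm)) (fun h' => h2 (h'.trans hb.symm))

/-- `s` is the simple reflection that exchanges `k` and `k + 1`, for any integer `k`. -/
abbrev IsSimple (k : ℤ) (s : W r) : Prop := IsTransposition k (k + 1) s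

lemma mem_simpleReflections [NeZero r] {s : W r} :
    s ∈ simpleReflections r ↔ ∃ k : ℤ, IsSimple k s := by
  constructor
  · rintro ⟨i, -, -, h⟩
    exact ⟨i, isTransposition_of_isSimpleReflection h⟩
  · rintro ⟨k, h⟩
    have hr : (0 : ℤ) < r := by exact_mod_cast Nat.pos_of_ne_zero (NeZero.ne r)
    refine ⟨k % r, Int.emod_nonneg _ hr.ne', Int.emod_lt_of_pos _ hr, ?_⟩
    exact isSimpleReflection_of_isTransposition (h.congr (Int.mod_modEq k r) (by ring))

lemma exists_isSimple (hr : 2 ≤ r) (k : ℤ) : ∃ s : W r, IsSimple k s := by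
  have hne : ∀ j : ℤ, ¬ j ≡ j + 1 [ZMOD r] := fun j h => by
    have := h.dvd
    rw [add_sub_cancel_left] at this
    have := Int.le_of_dvd one_pos this
    omega
  have hper : ∀ i j : ℤ, i + r ≡ j [ZMOD r] ↔ i ≡ j [ZMOD r] := fun i j => by
    have h : i + r ≡ i [ZMOD r] := Int.add_modEq_right
    exact ⟨fun h' => h.symm.trans h', fun h' => h.trans h'⟩
  let f : ℤ → ℤ := fun j => if j ≡ k [ZMOD r] then j + 1 else
    if j ≡ k + 1 [ZMOD r] then j - 1 else j
  have hf : Function.Involutive f := by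
    intro j
    simp only [f]
    by_cases h1 : j ≡ k [ZMOD r]
    · have h2 : j + 1 ≡ k + 1 [ZMOD r] := h1.add_right 1
      have h3 : ¬ j + 1 ≡ k [ZMOD r] := fun h => hne k (h.symm.trans h2)
      rw [if_pos h1, if_neg h3, if_pos h2]; ring
    · by_cases h2 : j ≡ k + 1 [ZMOD r]
      · have h3 : j - 1 ≡ k [ZMOD r] := by simpa using h2.sub_right 1
        rw [if_neg h1, if_pos h2, if_pos h3]; ring
      · rw [if_neg h1, if_neg h2, if_neg h1, if_neg h2]
  refine ⟨⟨hf.toPerm, fun i => ?_⟩, hne k, ?_, ?_, fun j h1 h2 => ?_⟩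
  · simp only [Function.Involutive.coe_toPerm, f, hper]
    split_ifs <;> ring
  · simp [f]
  · have h3 : ¬ k + 1 ≡ k [ZMOD r] := fun h => hne k h.symm
    simp [f, h3]
  · simp [f, h1, h2]

/-- A simple reflection moves every integer by at most one, so it can only reverse two adjacent
integers that it exchanges. This is the source of all exchange arguments below. -/
lemma IsSimple.lt_or {k : ℤ} {s : W r} (h : IsSimple k s) {p q : ℤ} (hpq : p < q) :
    s.1 p < s.1 q ∨ (p ≡ k [ZMOD r] ∧ q = p + 1) := by
  have hle : ∀ j, s.1 j ≤ j + 1 ∧ j - 1 ≤ s.1 j ∧ (¬ j ≡ k [ZMOD r] → s.1 j ≤ j) := by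
    intro j
    by_cases ha : j ≡ k [ZMOD r]
    · rw [h.apply_left ha]; exact ⟨by linarith, by linarith, fun h => absurd ha h⟩
    by_cases hb : j ≡ k + 1 [ZMOD r]
    · rw [h.apply_right hb]; exact ⟨by linarith, by linarith, fun _ => by linarith⟩
    rw [h.2.2.2 j ha hb]; exact ⟨by linarith, by linarith, fun _ => le_rfl⟩
  have hne : s.1 p ≠ s.1 q := fun h' => hpq.ne (s.1.injective h')
  have h1 := hle p
  have h2 := hle q
  by_cases hp : p ≡ k [ZMOD r]
  · by_cases hq : q = p + 1
    · exact Or.inr ⟨hp, hq⟩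
    · left; omega
  · have := h1.2.2 hp
    left; omega

/-! ### Inversions -/

/-- The number of `j > i` with `w j < w i`. -/
noncomputable def invFrom (w : W r) (i : ℤ) : ℕ := Set.ncard {j | i < j ∧ w.1 j < w.1 i}

/-- The displacement `w j - j` depends only on the residue of `j`, so it takes finitely many values.
-/
lemma exists_bound [NeZero r] (w : W r) : ∃ B : ℤ, ∀ j, |w.1 j - j| ≤ B := by
  have hr : (0 : ℤ) < r := by exact_mod_cast Nat.pos_of_ne_zero (NeZero.ne r)
  refine ⟨∑ i ∈ Finset.range r, |w.1 i - i|, fun j => ?_⟩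
  have h1 := eq_of_modEq (w := w) (Int.mod_modEq j r)
  have h2 := Int.emod_nonneg j hr.ne'
  have h3 := Int.emod_lt_of_pos j hr
  obtain ⟨m, hm⟩ := Int.eq_ofNat_of_zero_le h2
  rw [hm] at h1 h3
  rw [show w.1 j - j = w.1 m - m by linarith]
  exact Finset.single_le_sum (f := fun i : ℕ => |w.1 i - i|) (fun _ _ => abs_nonneg _)
    (Finset.mem_range.2 (by omega))

lemma finite_invFrom [NeZero r] (w : W r) (i : ℤ) : {j | i < j ∧ w.1 j < w.1 i}.Finite := by
  obtain ⟨B, hB⟩ := exists_bound w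
  refine (Set.finite_Icc i (w.1 i + B)).subset fun j hj => ?_
  have := (abs_le.1 (hB j)).1
  exact ⟨hj.1.le, by linarith [hj.2]⟩

lemma invFrom_congr (w : W r) {i i' : ℤ} (h : i ≡ i' [ZMOD r]) :
    invFrom w i = invFrom w i' := by
  have h' : ∀ j, w.1 (j + (i' - i)) = w.1 j + (i' - i) := fun j => by
    obtain ⟨m, hm⟩ := h.dvd
    rw [hm, apply_add_mul]
  have hi := h' i
  rw [add_sub_cancel] at hi
  unfold invFrom
  rw [← Set.ncard_image_of_injective _ (add_left_injective (i' - i))]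
  congr 1
  ext j
  simp only [Set.mem_image, Set.mem_ofPred_eq]
  constructor
  · rintro ⟨j, ⟨h1, h2⟩, rfl⟩
    rw [h', hi]; constructor <;> linarith
  · rintro ⟨h1, h2⟩
    have := h' (j - (i' - i))
    rw [sub_add_cancel] at this
    exact ⟨j - (i' - i), ⟨by linarith, by linarith⟩, by ring⟩

/-- The map `s` matches the inversions of `w * s` starting at `i` with those of `w` starting at `s
i`. The only one left over is the pair `(i, i + 1)` when `s` exchanges its two members. -/
lemma invFrom_mul_isSimple [NeZero r] {k : ℤ} {s : W r} (h : IsSimple k s) {w : W r}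
    (hw : w.1 k < w.1 (k + 1)) (i : ℤ) [Decidable (i ≡ k [ZMOD r])] :
    invFrom (w * s) i = invFrom w (s.1 i) + if i ≡ k [ZMOD r] then 1 else 0 := by
  have hss : ∀ j, s.1 (s.1 j) = j := fun j => by rw [← mul_apply, h.mul_self, one_apply]
  have himg : {j | i < j ∧ w.1 (s.1 j) < w.1 (s.1 i)} \ (if i ≡ k [ZMOD r] then {i + 1} else ∅)
      = s.1 '' {j | s.1 i < j ∧ w.1 j < w.1 (s.1 i)} := by
    ext j
    simp only [Set.mem_image, Set.mem_ofPred_eq, Set.mem_sdiff]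
    constructor
    · rintro ⟨⟨h1, h2⟩, h3⟩
      refine ⟨s.1 j, ⟨?_, h2⟩, hss j⟩
      refine (h.lt_or h1).resolve_right fun h4 => h3 ?_
      simp [h4.1, h4.2]
    · rintro ⟨j, ⟨h1, h2⟩, rfl⟩
      rw [hss]
      have hne : i ≡ k [ZMOD r] → s.1 j ≠ i + 1 := by
        intro hi hj
        have h3 : s.1 i = i + 1 := by rw [h.apply_left hi]; ring
        rw [h3, ← hj] at h1
        have : j = i := by rw [← hss j, hj, ← h3, hss]
        omega
      refine ⟨⟨?_, h2⟩, ?_⟩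
      · have h3 := h.lt_or h1
        rw [hss] at h3
        refine h3.resolve_right fun h4 => ?_
        rw [h4.2] at h2
        have h5 := eq_of_modEq (w := w) h4.1
        have h6 := eq_of_modEq (w := w) (h4.1.add_right 1)
        linarith
      · split_ifs with hi
        · simpa using hne hi
        · simp
  have hcard : invFrom w (s.1 i) = Set.ncard (({j | i < j ∧ w.1 (s.1 j) < w.1 (s.1 i)} : Set ℤ) \
      (if i ≡ k [ZMOD r] then {i + 1} else ∅)) := by
    rw [himg, Set.ncard_image_of_injective _ s.1.injective]; rfl
  rw [hcard]
  have hfin := finite_invFrom (w * s) i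
  simp only [mul_apply] at hfin
  unfold invFrom
  simp only [mul_apply]
  split_ifs with hi
  · rw [Set.ncard_sdiff_singleton_add_one _ hfin]
    refine ⟨by linarith, ?_⟩
    have h1 : s.1 i = i + 1 := by rw [h.apply_left hi]; ring
    have h2 : s.1 (i + 1) = i := by rw [← h1, hss]
    rw [h2, h1]
    have h5 := eq_of_modEq (w := w) hi
    have h6 := eq_of_modEq (w := w) (hi.add_right 1)
    linarith
  · simp

/-! ### Residues modulo `r` and the total number of inversions. -/

lemma intCast_modEq_iff {i j : ℤ} : (i : ZMod r) = j ↔ i ≡ j [ZMOD r] :=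
  ZMod.intCast_eq_intCast_iff i j r

/-- The permutation of the residues modulo `r` induced by `w`. -/
def resPerm (w : W r) : Equiv.Perm (ZMod r) where
  toFun a := (w.1 a.cast : ℤ)
  invFun a := ((w⁻¹).1 a.cast : ℤ)
  left_inv a := by
    have h : (((w.1 a.cast : ℤ) : ZMod r).cast : ℤ) ≡ w.1 a.cast [ZMOD r] :=
      intCast_modEq_iff.1 (by simp)
    have h2 := (apply_modEq (w := w⁻¹)).2 h
    rw [inv_apply_self] at h2
    simpa using intCast_modEq_iff.2 h2
  right_inv a := by
    have h : ((((w⁻¹).1 a.cast : ℤ) : ZMod r).cast : ℤ) ≡ (w⁻¹).1 a.cast [ZMOD r] :=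
      intCast_modEq_iff.1 (by simp)
    have h2 := (apply_modEq (w := w)).2 h
    rw [apply_inv_self] at h2
    simpa using intCast_modEq_iff.2 h2

/-- The number of inversions of `w`, up to translation. -/
noncomputable def invNum [NeZero r] (w : W r) : ℕ := ∑ a : ZMod r, invFrom w a.cast

/-- Summing over residues, `s` only permutes the main terms, and the extra inversion occurs for the
single residue of `k`. -/
lemma invNum_mul_isSimple [NeZero r] {k : ℤ} {s : W r} (h : IsSimple k s) {w : W r}
    (hw : w.1 k < w.1 (k + 1)) : invNum (w * s) = invNum w + 1 := by
  classical
  unfold invNum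
  simp only [invFrom_mul_isSimple h hw, Finset.sum_add_distrib]
  congr 1
  · rw [← Equiv.sum_comp (resPerm s) fun a => invFrom w a.cast]
    refine Finset.sum_congr rfl fun a _ => invFrom_congr w ?_
    exact intCast_modEq_iff.1 (by simp [resPerm])
  · rw [Finset.sum_eq_single (k : ZMod r)]
    · rw [if_pos]; exact intCast_modEq_iff.1 (by simp)
    · intro a _ ha
      rw [if_neg]
      intro h'
      exact ha (by simpa using intCast_modEq_iff.2 h')
    · simp

lemma mul_mul_self {k : ℤ} {s : W r} (h : IsSimple k s) (w : W r) : w * s * s = w := by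
  rw [mul_assoc, h.mul_self, mul_one]

lemma invNum_mul_isSimple' [NeZero r] {k : ℤ} {s : W r} (h : IsSimple k s) {w : W r}
    (hw : w.1 (k + 1) < w.1 k) : invNum (w * s) + 1 = invNum w := by
  have := invNum_mul_isSimple h (w := w * s) (by simpa [mul_apply, h.2.1, h.2.2.1] using hw)
  rw [mul_mul_self h] at this
  exact this.symm

lemma apply_lt_or_gt (w : W r) (k : ℤ) : w.1 k < w.1 (k + 1) ∨ w.1 (k + 1) < w.1 k :=
  lt_or_gt_of_ne fun h => by simpa using w.1.injective h

lemma invNum_rho_pow_mul [NeZero r] (m : ℤ) (w : W r) : invNum (rho r ^ m * w) = invNum w := by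
  unfold invNum invFrom
  simp only [mul_apply, rho_pow_apply, add_lt_add_iff_right]

/-- An increasing bijection of the integers leaves no gaps, so it is a shift. -/
lemma eq_rho_pow_of_forall_lt {w : W r} (h : ∀ k, w.1 k < w.1 (k + 1)) :
    w = rho r ^ (w.1 0) := by
  have hm : StrictMono w.1 := strictMono_int_of_lt_succ h
  have hs : ∀ k, w.1 (k + 1) = w.1 k + 1 := by
    intro k
    have h1 : (w⁻¹).1 (w.1 k + 1) = k + 1 := by
      have ha : k < (w⁻¹).1 (w.1 k + 1) := by
        apply hm.lt_iff_lt.1; rw [apply_inv_self]; linarith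
      have hb : (w⁻¹).1 (w.1 k + 1) < k + 1 + 1 := by
        apply hm.lt_iff_lt.1; rw [apply_inv_self]; linarith [h k, h (k + 1)]
      omega
    rw [← h1, apply_inv_self]
  refine ext_apply fun j => ?_
  rw [rho_pow_apply]
  induction j using Int.induction_on with
  | zero => simp
  | succ j ih => rw [hs, ih]; ring
  | pred j ih =>
    have := hs (-j - 1)
    rw [sub_add_cancel, ih] at this
    linarith

lemma eq_rho_pow_of_invNum_eq_zero [NeZero r] {w : W r} (h : invNum w = 0) :
    w = rho r ^ (w.1 0) := by
  refine eq_rho_pow_of_forall_lt fun k => ?_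
  refine (apply_lt_or_gt w k).resolve_right fun hk => ?_
  have h0 : invFrom w k = 0 := by
    have := (Finset.sum_eq_zero_iff.1 h) (k : ZMod r) (Finset.mem_univ _)
    rw [← this]
    exact invFrom_congr w (intCast_modEq_iff.1 (by simp))
  have := (Set.ncard_eq_zero (finite_invFrom w k)).1 h0
  have hmem : k + 1 ∈ ({j | k < j ∧ w.1 j < w.1 k} : Set ℤ) := ⟨by linarith, hk⟩
  rw [this] at hmem
  exact hmem

lemma two_le_of_desc {w : W r} [NeZero r] {k : ℤ} (hk : w.1 (k + 1) < w.1 k) : 2 ≤ r := by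
  by_contra h
  have h0 := NeZero.ne r
  obtain rfl : r = 1 := by omega
  have := apply_add w k
  norm_num at this
  linarith

lemma invNum_one [NeZero r] : invNum (1 : W r) = 0 := by
  unfold invNum invFrom
  refine Finset.sum_eq_zero fun a _ => ?_
  have : {j : ℤ | a.cast < j ∧ (1 : W r).1 j < (1 : W r).1 a.cast} = ∅ := by
    ext j; simp only [one_apply, Set.mem_ofPred_eq, Set.mem_empty_iff_false, iff_false]; omega
  rw [this, Set.ncard_empty]

lemma exists_word [NeZero r] (w : W r) : ∃ (m : ℤ) (L : List (W r)),
    (∀ s ∈ L, s ∈ simpleReflections r) ∧ w = rho r ^ m * L.prod ∧ L.length = invNum w := by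
  induction hn : invNum w generalizing w with
  | zero => exact ⟨w.1 0, [], by simp, by simpa using eq_rho_pow_of_invNum_eq_zero hn, rfl⟩
  | succ n ih =>
    have : ∃ k, w.1 (k + 1) < w.1 k := by
      by_contra! hc
      have h1 := eq_rho_pow_of_forall_lt
        (fun k => (apply_lt_or_gt w k).resolve_right (not_lt.2 (hc k)))
      have h2 : invNum w = invNum (1 : W r) := by
        rw [h1, ← invNum_rho_pow_mul (w.1 0) 1, mul_one]
      have h3 := invNum_one (r := r)
      omega
    obtain ⟨k, hk⟩ := this
    obtain ⟨s, hs⟩ := exists_isSimple (two_le_of_desc hk) k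
    have h1 := invNum_mul_isSimple' hs hk
    obtain ⟨m, L, hL, hw, hlen⟩ := ih (w * s) (by omega)
    refine ⟨m, L ++ [s], ?_, ?_, by simp [hlen]⟩
    · intro t ht
      rcases List.mem_append.1 ht with ht | ht
      · exact hL t ht
      · rw [List.mem_singleton.1 ht]; exact mem_simpleReflections.2 ⟨k, hs⟩
    · rw [List.prod_append, ← mul_assoc, ← hw, List.prod_singleton, mul_mul_self hs]

lemma invNum_mul_le [NeZero r] {s : W r} (hs : s ∈ simpleReflections r) (w : W r) :
    invNum (w * s) ≤ invNum w + 1 := by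
  obtain ⟨k, hk⟩ := mem_simpleReflections.1 hs
  rcases apply_lt_or_gt w k with h | h
  · exact (invNum_mul_isSimple hk h).le
  · have := invNum_mul_isSimple' hk h; omega

/-- Removing descents one at a time gives a word with `invNum w` letters. No word is shorter, since
each simple factor adds at most one inversion and shifts add none. -/
lemma len_eq_invNum [NeZero r] (w : W r) : len w = invNum w := by
  unfold len
  apply le_antisymm
  · exact Nat.sInf_le (exists_word w)
  · obtain ⟨m, L, hL, hw, hlen⟩ := Nat.sInf_mem (s := {k | ∃ (m : ℤ) (L : List (W r)),
      (∀ s ∈ L, s ∈ simpleReflections r) ∧ w = rho r ^ m * L.prod ∧ L.length = k})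
      ⟨_, exists_word w⟩
    rw [← hlen, hw, invNum_rho_pow_mul]
    clear hlen hw
    induction L using List.reverseRecOn with
    | nil => simp [invNum_one]
    | append_singleton L s ih =>
      rw [List.prod_append, List.prod_singleton, List.length_append, List.length_singleton]
      have h1 := invNum_mul_le (hL s (by simp)) L.prod
      have h2 := ih (fun t ht => hL t (by simp [ht]))
      omega

/-! ### Lengths -/

lemma len_mul_of_lt [NeZero r] {k : ℤ} {s : W r} (h : IsSimple k s) {w : W r}
    (hw : w.1 k < w.1 (k + 1)) : len (w * s) = len w + 1 := by
  rw [len_eq_invNum, len_eq_invNum, invNum_mul_isSimple h hw]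

lemma len_mul_of_gt [NeZero r] {k : ℤ} {s : W r} (h : IsSimple k s) {w : W r}
    (hw : w.1 (k + 1) < w.1 k) : len (w * s) + 1 = len w := by
  rw [len_eq_invNum, len_eq_invNum, invNum_mul_isSimple' h hw]

lemma len_lt_mul_iff [NeZero r] {k : ℤ} {s : W r} (h : IsSimple k s) {w : W r} :
    len w < len (w * s) ↔ w.1 k < w.1 (k + 1) := by
  rcases apply_lt_or_gt w k with h' | h'
  · simp [len_mul_of_lt h h', h']
  · have := len_mul_of_gt h h'
    constructor <;> intro <;> omega

lemma len_rho_pow_mul [NeZero r] (m : ℤ) (w : W r) : len (rho r ^ m * w) = len w := by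
  rw [len_eq_invNum, len_eq_invNum, invNum_rho_pow_mul]

@[simp]
lemma len_one [NeZero r] : len (1 : W r) = 0 := by rw [len_eq_invNum, invNum_one]

lemma eq_rho_pow_of_len_eq_zero [NeZero r] {w : W r} (h : len w = 0) : w = rho r ^ (w.1 0) :=
  eq_rho_pow_of_invNum_eq_zero (by rw [← len_eq_invNum, h])

lemma IsTransposition.conj_rho {k : ℤ} {s : W r} (h : IsSimple k s) (m : ℤ) :
    IsSimple (k + m) (rho r ^ m * s * (rho r ^ m)⁻¹) := by
  have := h.conj (rho r ^ m)
  rwa [rho_pow_apply, rho_pow_apply, add_right_comm] at this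

/-- Inversions visibly ignore a shift on the left. On the right the reason is that conjugation by
`ρ` permutes the simple reflections, so a shift can be moved past a descent. -/
lemma len_mul_rho_pow [NeZero r] (w : W r) (m : ℤ) : len (w * rho r ^ m) = len w := by
  have key : ∀ (m : ℤ) (w : W r), len (w * rho r ^ m) ≤ len w := by
    intro m w
    induction hn : len w generalizing w with
    | zero =>
      rw [eq_rho_pow_of_len_eq_zero hn, len_rho_pow_mul, ← mul_one (rho r ^ m), len_rho_pow_mul,
        len_one]
    | succ n ih =>
      have : ∃ k, w.1 (k + 1) < w.1 k := by
        by_contra! hc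
        have h1 := eq_rho_pow_of_forall_lt
          (fun k => (apply_lt_or_gt w k).resolve_right (not_lt.2 (hc k)))
        rw [h1, ← mul_one (rho r ^ _), len_rho_pow_mul, len_one] at hn
        omega
      obtain ⟨k, hk⟩ := this
      obtain ⟨s, hs⟩ := exists_isSimple (two_le_of_desc hk) k
      have h1 := len_mul_of_gt hs hk
      have h2 := ih (w * s) (by omega)
      have h3 := IsTransposition.conj_rho hs (-m)
      have h4 := invNum_mul_le (mem_simpleReflections.2 ⟨_, h3⟩) (w * s * rho r ^ m)
      rw [← len_eq_invNum, ← len_eq_invNum] at h4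
      have h5 : w * s * rho r ^ m * (rho r ^ (-m) * s * (rho r ^ (-m))⁻¹) = w * rho r ^ m := by
        rw [zpow_neg, inv_inv]
        calc _ = w * s * s * rho r ^ m := by group
          _ = _ := by rw [mul_mul_self hs]
      rw [h5] at h4
      omega
  refine le_antisymm (key m w) ?_
  have := key (-m) (w * rho r ^ m)
  rwa [mul_assoc, ← zpow_add, add_neg_cancel, zpow_zero, mul_one] at this

lemma len_mul_of_len_eq_zero [NeZero r] {v : W r} (hv : len v = 0) (w : W r) :
    len (v * w) = len w := by rw [eq_rho_pow_of_len_eq_zero hv, len_rho_pow_mul]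

lemma len_mul_of_len_eq_zero' [NeZero r] {v : W r} (hv : len v = 0) (w : W r) :
    len (w * v) = len w := by rw [eq_rho_pow_of_len_eq_zero hv, len_mul_rho_pow]

lemma exists_right_descent [NeZero r] {w : W r} (h : len w ≠ 0) :
    ∃ s ∈ simpleReflections r, len (w * s) + 1 = len w := by
  have : ∃ k, w.1 (k + 1) < w.1 k := by
    by_contra! hc
    have h1 := eq_rho_pow_of_forall_lt
      (fun k => (apply_lt_or_gt w k).resolve_right (not_lt.2 (hc k)))
    rw [h1, ← mul_one (rho r ^ _), len_rho_pow_mul, len_one] at h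
    exact h rfl
  obtain ⟨k, hk⟩ := this
  obtain ⟨s, hs⟩ := exists_isSimple (two_le_of_desc hk) k
  exact ⟨s, mem_simpleReflections.2 ⟨k, hs⟩, len_mul_of_gt hs hk⟩

lemma simple_mul_self [NeZero r] {s : W r} (hs : s ∈ simpleReflections r) : s * s = 1 := by
  obtain ⟨k, hk⟩ := mem_simpleReflections.1 hs
  exact hk.mul_self

lemma simple_inv [NeZero r] {s : W r} (hs : s ∈ simpleReflections r) : s⁻¹ = s :=
  inv_eq_of_mul_eq_one_left (simple_mul_self hs)

lemma simple_mul_cancel_left [NeZero r] {s : W r} (hs : s ∈ simpleReflections r) (w : W r) :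
    s * (s * w) = w := by rw [← mul_assoc, simple_mul_self hs, one_mul]

lemma simple_mul_cancel_right [NeZero r] {s : W r} (hs : s ∈ simpleReflections r) (w : W r) :
    w * s * s = w := by rw [mul_assoc, simple_mul_self hs, mul_one]

lemma len_mul_simple [NeZero r] {s : W r} (hs : s ∈ simpleReflections r) (w : W r) :
    len (w * s) = len w + 1 ∨ len (w * s) + 1 = len w := by
  obtain ⟨k, hk⟩ := mem_simpleReflections.1 hs
  exact (apply_lt_or_gt w k).imp (len_mul_of_lt hk) (len_mul_of_gt hk)

lemma len_mul_le [NeZero r] (v w : W r) : len (v * w) ≤ len v + len w := by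
  induction hn : len w generalizing w with
  | zero => rw [len_mul_of_len_eq_zero' hn]; omega
  | succ n ih =>
    obtain ⟨s, hs, h⟩ := exists_right_descent (w := w) (by omega)
    have h1 := ih (w * s) (by omega)
    have h2 := len_mul_simple hs (v * (w * s))
    rw [mul_assoc, simple_mul_cancel_right hs] at h2
    omega

lemma len_simple [NeZero r] {s : W r} (hs : s ∈ simpleReflections r) : len s = 1 := by
  have := len_mul_simple hs 1
  rw [one_mul, len_one] at this
  omega

@[simp]
lemma len_inv [NeZero r] (w : W r) : len w⁻¹ = len w := by
  have key : ∀ w : W r, len w⁻¹ ≤ len w := by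
    intro w
    induction hn : len w generalizing w with
    | zero =>
      rw [eq_rho_pow_of_len_eq_zero hn, ← zpow_neg, ← mul_one (rho r ^ _), len_rho_pow_mul,
        len_one]
    | succ n ih =>
      obtain ⟨s, hs, h⟩ := exists_right_descent (w := w) (by omega)
      have h1 := ih (w * s) (by omega)
      have h2 := len_mul_le s (w * s)⁻¹
      rw [len_simple hs, mul_inv_rev, simple_inv hs, simple_mul_cancel_left hs] at h2
      rw [mul_inv_rev, simple_inv hs] at h1
      omega
  refine le_antisymm (key w) ?_
  simpa using key w⁻¹

lemma len_simple_mul_eq [NeZero r] {s : W r} (hs : s ∈ simpleReflections r) (w : W r) :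
    len (s * w) = len (w⁻¹ * s) := by
  rw [← len_inv, mul_inv_rev, simple_inv hs]

lemma len_simple_mul [NeZero r] {s : W r} (hs : s ∈ simpleReflections r) (w : W r) :
    len (s * w) = len w + 1 ∨ len (s * w) + 1 = len w := by
  rw [len_simple_mul_eq hs, ← len_inv w]
  exact len_mul_simple hs w⁻¹

lemma exists_left_descent [NeZero r] {w : W r} (h : len w ≠ 0) :
    ∃ s ∈ simpleReflections r, len (s * w) + 1 = len w := by
  obtain ⟨s, hs, h'⟩ := exists_right_descent (w := w⁻¹) (by rwa [len_inv])
  rw [len_inv, ← len_simple_mul_eq hs] at h'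
  exact ⟨s, hs, h'⟩

lemma len_lt_simple_mul_iff [NeZero r] {k : ℤ} {s : W r} (h : IsSimple k s) {w : W r} :
    len w < len (s * w) ↔ (w⁻¹).1 k < (w⁻¹).1 (k + 1) := by
  rw [len_simple_mul_eq (mem_simpleReflections.2 ⟨k, h⟩), ← len_lt_mul_iff h, len_inv]

/-- Whether `s` is a left ascent depends on the order of the positions of `i` and `i + 1`. If `t`
reverses these positions, it must exchange them, and then `t` is conjugate to `s` under `w`. -/
lemma exchange [NeZero r] {s t : W r} (hs : s ∈ simpleReflections r)
    (ht : t ∈ simpleReflections r) {w : W r} (h1 : len w < len (s * w))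
    (h2 : len (s * (w * t)) < len (w * t)) : s * w = w * t := by
  obtain ⟨i, hi⟩ := mem_simpleReflections.1 hs
  obtain ⟨k, hk⟩ := mem_simpleReflections.1 ht
  rw [len_lt_simple_mul_iff hi] at h1
  have h3 := not_lt.2 h2.le
  rw [len_lt_simple_mul_iff hi, mul_inv_rev, hk.inv_eq, mul_apply, mul_apply] at h3
  obtain ⟨h4, h5⟩ := (hk.lt_or h1).resolve_left h3
  have h6 : IsSimple (w⁻¹.1 i) t := hk.congr h4 (by ring)
  have h7 := h6.conj w
  rw [← h5, apply_inv_self, apply_inv_self] at h7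
  rw [hi.unique h7, inv_mul_cancel_right]

/-! ### Reflections and the Bruhat order -/

/-- `u` is conjugate to a simple reflection. -/
def IsReflection (u : W r) : Prop := ∃ v : W r, ∃ s ∈ simpleReflections r, u = v * s * v⁻¹

lemma isSimple_isReflection {s : W r} (hs : s ∈ simpleReflections r) : IsReflection s :=
  ⟨1, s, hs, by simp⟩

lemma IsReflection.conj {u : W r} (h : IsReflection u) (x : W r) :
    IsReflection (x * u * x⁻¹) := by
  obtain ⟨v, s, hs, rfl⟩ := h
  exact ⟨x * v, s, hs, by group⟩

lemma IsReflection.exists_isTransposition [NeZero r] {u : W r} (h : IsReflection u) :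
    ∃ a b : ℤ, a < b ∧ IsTransposition a b u := by
  obtain ⟨v, s, hs, rfl⟩ := h
  obtain ⟨k, hk⟩ := mem_simpleReflections.1 hs
  rcases apply_lt_or_gt v k with h | h
  · exact ⟨_, _, h, hk.conj v⟩
  · exact ⟨_, _, h, (hk.conj v).symm⟩

lemma IsReflection.mul_self [NeZero r] {u : W r} (h : IsReflection u) : u * u = 1 := by
  obtain ⟨a, b, -, h⟩ := h.exists_isTransposition
  exact h.mul_self

/-- The induction is on `b - a`: conjugation by the simple reflection `s` at `a` brings the two
points closer. The parity statement is carried along so that the lengths of `x` and `x * u` cannot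
coincide. -/
lemma len_mul_transposition [NeZero r] {a b : ℤ} (hab : a < b) {u : W r}
    (hu : IsTransposition a b u) (x : W r) :
    len (x * u) % 2 ≠ len x % 2 ∧ (x.1 a < x.1 b → len x < len (x * u)) := by
  induction hn : (b - a).toNat using Nat.strong_induction_on generalizing a b u x with
  | _ n ih =>
  by_cases hb : b = a + 1
  · subst hb
    have h1 := len_mul_simple (mem_simpleReflections.2 ⟨a, hu⟩) x
    exact ⟨by omega, (len_lt_mul_iff hu).2⟩
  have hr : 2 ≤ r := by
    by_contra h
    have h0 := NeZero.ne r
    obtain rfl : r = 1 := by omega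
    exact hu.1 (by simpa using Int.modEq_one)
  obtain ⟨s, hs⟩ := exists_isSimple hr a
  have hsm := mem_simpleReflections.2 ⟨a, hs⟩
  have hu' : IsTransposition (s.1 a) (s.1 b) (s * u * s) := by
    have := hu.conj s
    rwa [hs.inv_eq] at this
  have hlt : s.1 a < s.1 b := (hs.lt_or hab).resolve_right fun h => hb h.2
  have hsb : s.1 b ≤ b := by
    by_cases h1 : b ≡ a + 1 [ZMOD r]
    · rw [hs.apply_right h1]; linarith
    · rw [hs.2.2.2 b (fun h => hu.1 h.symm) h1]
  have hsa : s.1 a = a + 1 := hs.2.1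
  have hx1 : x * s * (s * u * s) = x * u * s := by
    calc _ = x * (s * s) * u * s := by group
      _ = _ := by rw [hs.mul_self, mul_one]
  have hss : ∀ j, s.1 (s.1 j) = j := fun j => by rw [← mul_apply, hs.mul_self, one_apply]
  obtain ⟨ih1, ih2⟩ := ih _ (by omega) hlt hu' (x * s) rfl
  rw [hx1] at ih1 ih2
  simp only [mul_apply, hss] at ih2
  have l1 := len_mul_simple hsm x
  have l2 := len_mul_simple hsm (x * u)
  refine ⟨by omega, fun hx => ?_⟩
  have ih2 := ih2 hx
  by_contra hcon
  -- The inequality for `x * s` and the parity leave one bad case: `s` shortens `x` and lengthens `x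
  -- * u`. Reading both descents on values gives `x b < x a`.
  have c1 : ¬ len x < len (x * s) := by omega
  have c2 : len (x * u) < len (x * u * s) := by omega
  rw [len_lt_mul_iff hs] at c1 c2
  rw [mul_apply, mul_apply, hu.2.1] at c2
  by_cases h1 : b ≡ a + 1 [ZMOD r]
  · have h2 := eq_of_modEq (w := u) h1
    rw [hu.2.2.1] at h2
    have h3 : u.1 (a + 1) = a + (a + 1 - b) := by linarith
    have h4 : x.1 (u.1 (a + 1)) = x.1 a + (a + 1 - b) := by
      obtain ⟨m, hm⟩ := h1.dvd
      rw [h3, hm, apply_add_mul]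
    have : a + 1 ≤ b := hab
    rw [h4] at c2
    linarith
  · have h2 : u.1 (a + 1) = a + 1 := hu.2.2.2 _ (fun h => hs.1 h.symm) (fun h => h1 h.symm)
    rw [h2] at c2
    linarith

lemma len_lt_mul_transposition_iff [NeZero r] {a b : ℤ} (hab : a < b) {u : W r}
    (hu : IsTransposition a b u) (x : W r) : len x < len (x * u) ↔ x.1 a < x.1 b := by
  refine ⟨fun h => ?_, (len_mul_transposition hab hu x).2⟩
  by_contra hc
  have hlt : x.1 b < x.1 a := lt_of_le_of_ne (not_lt.1 hc) fun h' =>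
    hab.ne' (x.1.injective h')
  have h1 := (len_mul_transposition hab hu (x * u)).2
    (by simpa [mul_apply, hu.2.1, hu.2.2.1] using hlt)
  rw [mul_assoc, hu.mul_self, mul_one] at h1
  omega

/-- Left multiplication by `s` keeps the order of the values `x a` and `x b`, unless it exchanges
them, and then `s = x u x⁻¹`. -/
lemma simple_mul_eq_or_lt [NeZero r] {s u x : W r} (hs : s ∈ simpleReflections r)
    (hu : IsReflection u) (h : len x < len (x * u)) :
    s * x = x * u ∨ len (s * x) < len (s * x * u) := by
  obtain ⟨a, b, hab, hu⟩ := hu.exists_isTransposition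
  obtain ⟨k, hk⟩ := mem_simpleReflections.1 hs
  rw [len_lt_mul_transposition_iff hab hu] at h ⊢
  rw [or_comm]
  refine (hk.lt_or h).imp id fun h' => ?_
  have h1 : IsSimple (x.1 a) s := hk.congr h'.1 (by ring)
  have h2 := hu.conj x
  rw [h'.2] at h2
  rw [h1.unique h2, inv_mul_cancel_right]

lemma bruhatLE_refl (w : W r) : bruhatLE w w := Relation.ReflTransGen.refl

lemma bruhatLE_mul_reflection {x u : W r} (hu : IsReflection u) (h : len x < len (x * u)) :
    bruhatLE x (x * u) := by
  obtain ⟨v, s, hs, hu⟩ := hu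
  exact Relation.ReflTransGen.single ⟨h, v, s, hs, by rw [hu]⟩

lemma _root_.bruhatLE.eq_or_len_lt {x y : W r} (h : bruhatLE x y) : x = y ∨ len x < len y := by
  induction h with
  | refl => exact Or.inl rfl
  | tail _ h ih =>
    right
    rcases ih with rfl | ih
    · exact h.1
    · exact ih.trans h.1

lemma _root_.bruhatLE.len_le {x y : W r} (h : bruhatLE x y) : len x ≤ len y := by
  rcases bruhatLE.eq_or_len_lt h with rfl | h
  · exact le_rfl
  · exact h.le

lemma bruhatLE_simple_mul [NeZero r] {s w : W r} (hs : s ∈ simpleReflections r)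
    (h : len w < len (s * w)) : bruhatLE w (s * w) := by
  have h1 : s * w = w * (w⁻¹ * s * w⁻¹⁻¹) := by group
  rw [h1] at h ⊢
  exact bruhatLE_mul_reflection ((isSimple_isReflection hs).conj _) h

/-- The lifting property: `s` is carried up along a chain of reflections, and it is absorbed by the
chain as soon as it coincides with one of its steps. -/
lemma _root_.bruhatLE.simple_mul_or [NeZero r] {s y w : W r} (hs : s ∈ simpleReflections r)
    (h : bruhatLE y w) : bruhatLE (s * y) w ∨ bruhatLE (s * y) (s * w) := by
  induction h with
  | refl => exact Or.inr (bruhatLE_refl _)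
  | @tail x z _ h ih =>
    obtain ⟨hlt, v, t, ht, rfl⟩ := h
    have hu : IsReflection (v * t * v⁻¹) := ⟨v, t, ht, rfl⟩
    rcases ih with ih | ih
    · exact Or.inl (ih.trans (bruhatLE_mul_reflection hu hlt))
    · rcases simple_mul_eq_or_lt hs hu hlt with h | h
      · left; rwa [← h]
      · right
        rw [← mul_assoc]
        exact ih.trans (bruhatLE_mul_reflection hu h)

lemma _root_.bruhatLE.le_simple_mul_or [NeZero r] {s y w : W r} (hs : s ∈ simpleReflections r)
    (h : bruhatLE y w) : bruhatLE y (s * w) ∨ bruhatLE (s * y) (s * w) := by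
  induction h using Relation.ReflTransGen.head_induction_on with
  | refl => exact Or.inr (bruhatLE_refl _)
  | @head x z h _ ih =>
    obtain ⟨hlt, v, t, ht, rfl⟩ := h
    have hu : IsReflection (v * t * v⁻¹) := ⟨v, t, ht, rfl⟩
    rcases ih with ih | ih
    · exact Or.inl ((bruhatLE_mul_reflection hu hlt).trans ih)
    · rcases simple_mul_eq_or_lt hs hu hlt with h | h
      · left
        rwa [← h, simple_mul_cancel_left hs] at ih
      · right
        rw [← mul_assoc] at ih
        exact (bruhatLE_mul_reflection hu h).trans ih

lemma _root_.bruhatLE.simple_mul_simple_mul [NeZero r] {s y w : W r} (hs : s ∈ simpleReflections r)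
    (hw : len w < len (s * w)) (h : bruhatLE y w) : bruhatLE (s * y) (s * w) :=
  (bruhatLE.simple_mul_or hs h).elim (fun h => Relation.ReflTransGen.trans h (bruhatLE_simple_mul hs hw)) id

lemma _root_.bruhatLE.inv [NeZero r] {y w : W r} (h : bruhatLE y w) : bruhatLE y⁻¹ w⁻¹ := by
  induction h with
  | refl => exact bruhatLE_refl _
  | @tail x z _ h ih =>
    obtain ⟨hlt, v, t, ht, rfl⟩ := h
    have hu : IsReflection (v * t * v⁻¹) := ⟨v, t, ht, rfl⟩
    have h1 : (x * (v * t * v⁻¹))⁻¹ = x⁻¹ * (x * (v * t * v⁻¹) * x⁻¹) := by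
      rw [mul_inv_rev, inv_eq_of_mul_eq_one_left hu.mul_self]; group
    rw [h1]
    refine ih.trans (bruhatLE_mul_reflection (hu.conj x) ?_)
    rwa [← h1, len_inv, len_inv]

/-- For a left descent `s` of `w`, the lower interval of `w` lies in that of `s * w` together with
its translate by `s`. -/
lemma finite_bruhatLE [NeZero r] (w : W r) : {y : W r | bruhatLE y w}.Finite := by
  induction hn : len w generalizing w with
  | zero =>
    refine (Set.finite_singleton w).subset fun y hy => ?_
    exact (bruhatLE.eq_or_len_lt hy).resolve_right (by omega)
  | succ n ih =>
    obtain ⟨s, hs, h⟩ := exists_left_descent (w := w) (by omega)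
    have hf := ih (s * w) (by omega)
    refine (hf.union (hf.image (s * ·))).subset fun y hy => ?_
    rcases bruhatLE.le_simple_mul_or hs hy with h | h
    · exact Or.inl h
    · exact Or.inr ⟨s * y, h, simple_mul_cancel_left hs y⟩

end AffineWeyl

/-! ### The Hecke algebra, its Kazhdan-Lusztig basis and the affine Schur algebra. -/

namespace AffineHecke

open AffineWeyl

variable {r : ℕ}

/-! ### Algebra homomorphisms from the Hecke algebra -/

/-- The quotient map from the free algebra to the Hecke algebra. -/
noncomputable def mkHecke (r : ℕ) : FreeAlgebra Laur (W r) →ₐ[Laur] Hecke r :=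
  RingQuot.mkAlgHom Laur (HeckeRel r)

lemma mkHecke_ι (w : W r) : mkHecke r (FreeAlgebra.ι Laur w) = heckeT w := rfl

lemma mkHecke_surjective : Function.Surjective (mkHecke r) :=
  RingQuot.mkAlgHom_surjective Laur (HeckeRel r)

lemma mkHecke_eq {a b : FreeAlgebra Laur (W r)} (h : HeckeRel r a b) :
    mkHecke r a = mkHecke r b := RingQuot.mkAlgHom_rel Laur h

/-- An algebra homomorphism from the Hecke algebra is given by elements that satisfy the
defining relations. -/
noncomputable def liftHecke {A : Type*} [Ring A] [Algebra Laur A] (F : W r → A)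
    (h1 : F 1 = 1) (hmul : ∀ w w', len (w * w') = len w + len w' → F w * F w' = F (w * w'))
    (hquad : ∀ s ∈ simpleReflections r, (F s + 1) * (F s - algebraMap Laur A (tpow 2)) = 0) :
    Hecke r →ₐ[Laur] A :=
  RingQuot.liftAlgHom Laur ⟨FreeAlgebra.lift Laur F, by
    intro a b h
    cases h with
    | one => simpa using h1
    | mul w w' h => simpa using hmul w w' h
    | quad s h =>
      rw [map_mul, map_add, map_sub, map_zero, AlgHom.commutes]
      simpa using hquad s h⟩

lemma liftHecke_heckeT {A : Type*} [Ring A] [Algebra Laur A] (F : W r → A)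
    (h1 : F 1 = 1) (hmul : ∀ w w', len (w * w') = len w + len w' → F w * F w' = F (w * w'))
    (hquad : ∀ s ∈ simpleReflections r, (F s + 1) * (F s - algebraMap Laur A (tpow 2)) = 0)
    (w : W r) : liftHecke F h1 hmul hquad (heckeT w) = F w := by
  unfold liftHecke heckeT
  exact (RingQuot.liftAlgHom_mkAlgHom_apply Laur _ _ _).trans (by simp)

lemma heckeT_one : (heckeT 1 : Hecke r) = 1 := by
  rw [← mkHecke_ι, mkHecke_eq HeckeRel.one, map_one]

lemma heckeT_mul {w w' : W r} (h : len (w * w') = len w + len w') :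
    (heckeT w * heckeT w' : Hecke r) = heckeT (w * w') := by
  simp only [← mkHecke_ι, ← map_mul]
  exact mkHecke_eq (HeckeRel.mul w w' h)

lemma heckeT_quad {s : W r} (hs : s ∈ simpleReflections r) :
    (heckeT s * heckeT s : Hecke r) = (tpow 2 - 1 : Laur) • heckeT s + (tpow 2 : Laur) • 1 := by
  have h := mkHecke_eq (HeckeRel.quad s hs)
  rw [map_mul, map_add, map_sub, map_zero, map_one, AlgHom.commutes, mkHecke_ι, add_mul,
    mul_sub, one_mul, Algebra.algebraMap_eq_smul_one, mul_smul_comm, mul_one] at h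
  rw [sub_smul, one_smul]
  have := sub_eq_zero.1 (show heckeT s * heckeT s -
    ((tpow 2 : Laur) • heckeT s - heckeT s + (tpow 2 : Laur) • (1 : Hecke r)) = 0 by
      rw [← h]; abel)
  exact this

lemma heckeT_simple_mul [NeZero r] {s w : W r} (hs : s ∈ simpleReflections r)
    (h : len w < len (s * w)) : (heckeT s * heckeT w : Hecke r) = heckeT (s * w) :=
  heckeT_mul (by have := len_simple_mul hs w; rw [len_simple hs]; omega)

lemma heckeT_simple_mul' [NeZero r] {s w : W r} (hs : s ∈ simpleReflections r)
    (h : len (s * w) < len w) : (heckeT s * heckeT w : Hecke r) =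
      (tpow 2 - 1 : Laur) • heckeT w + (tpow 2 : Laur) • heckeT (s * w) := by
  have h1 := heckeT_simple_mul (w := s * w) hs (by rwa [simple_mul_cancel_left hs])
  rw [simple_mul_cancel_left hs] at h1
  conv_lhs => rw [← h1]
  rw [← mul_assoc, heckeT_quad hs, add_mul, smul_mul_assoc, smul_mul_assoc, one_mul, h1]

/-! ### The regular representation -/

/-- The free module on which the Hecke algebra acts. -/
abbrev FreeMod (r : ℕ) : Type := W r →₀ Laur

/-- A basis vector. -/
noncomputable abbrev vec (w : W r) : FreeMod r := Finsupp.single w 1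

/-- Left multiplication by `T_s`. -/
noncomputable def opL (s : W r) : Module.End Laur (FreeMod r) :=
  Finsupp.linearCombination Laur fun w => if len w < len (s * w) then vec (s * w) else
    (tpow 2 - 1 : Laur) • vec w + (tpow 2 : Laur) • vec (s * w)

/-- Right multiplication by `T_s`. -/
noncomputable def opR (s : W r) : Module.End Laur (FreeMod r) :=
  Finsupp.linearCombination Laur fun w => if len w < len (w * s) then vec (w * s) else
    (tpow 2 - 1 : Laur) • vec w + (tpow 2 : Laur) • vec (w * s)

/-- Left translation. -/
noncomputable def shiftL (v : W r) : Module.End Laur (FreeMod r) :=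
  Finsupp.linearCombination Laur fun w => vec (v * w)

/-- Right translation. -/
noncomputable def shiftR (v : W r) : Module.End Laur (FreeMod r) :=
  Finsupp.linearCombination Laur fun w => vec (w * v)

lemma opL_vec (s w : W r) : opL s (vec w) = if len w < len (s * w) then vec (s * w) else
    (tpow 2 - 1 : Laur) • vec w + (tpow 2 : Laur) • vec (s * w) := by
  simp [opL, Finsupp.linearCombination_single]

lemma opR_vec (s w : W r) : opR s (vec w) = if len w < len (w * s) then vec (w * s) else
    (tpow 2 - 1 : Laur) • vec w + (tpow 2 : Laur) • vec (w * s) := by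
  simp [opR, Finsupp.linearCombination_single]

lemma shiftL_vec (v w : W r) : shiftL v (vec w) = vec (v * w) := by
  simp [shiftL, Finsupp.linearCombination_single]

lemma shiftR_vec (v w : W r) : shiftR v (vec w) = vec (w * v) := by
  simp [shiftR, Finsupp.linearCombination_single]

lemma end_ext {f g : Module.End Laur (FreeMod r)} (h : ∀ w, f (vec w) = g (vec w)) : f = g :=
  Finsupp.lhom_ext' fun w => LinearMap.ext_ring (h w)

/-- If `s w = w t`, the two operators act in the same way on the span of `w` and `w t`. Otherwise
`exchange` shows that right multiplication by `t` does not change whether `s` is a left ascent, nor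
conversely, and the cases match term by term. -/
lemma opL_commute_opR [NeZero r] {s t : W r} (hs : s ∈ simpleReflections r)
    (ht : t ∈ simpleReflections r) : Commute (opL s) (opR t) := by
  refine end_ext fun w => ?_
  have hassoc : s * w * t = s * (w * t) := mul_assoc _ _ _
  simp only [Module.End.mul_apply]
  have l1 := len_simple_mul hs w
  have l2 := len_mul_simple ht w
  have l3 := len_simple_mul hs (w * t)
  have l4 := len_mul_simple ht (s * w)
  rw [hassoc] at l4
  by_cases he : s * w = w * t
  · have e1 : s * (w * t) = w := by rw [← he, simple_mul_cancel_left hs]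
    have e2 : w * t * t = w := simple_mul_cancel_right ht w
    rw [opL_vec, opR_vec, he]
    by_cases h : len w < len (w * t)
    · have h' : ¬ len (w * t) < len w := by omega
      rw [if_pos h, opL_vec, opR_vec, e1, e2, if_neg h']
    · have h' : len (w * t) < len w := by omega
      rw [if_neg h, map_add, map_add, map_smul, map_smul, map_smul, map_smul,
        opL_vec, opR_vec, opL_vec, opR_vec, e1, e2, he, if_neg h, if_pos h']
  · have x1 : len w < len (s * w) ↔ len (w * t) < len (s * (w * t)) := by
      constructor
      · intro h; by_contra h'
        exact he (exchange hs ht h (by omega))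
      · intro h; by_contra h'
        have h2 := exchange (w := w * t) hs ht h
          (by rw [simple_mul_cancel_right ht]; omega)
        rw [simple_mul_cancel_right ht] at h2
        exact he ((congrArg (s * ·) h2).symm.trans (simple_mul_cancel_left hs _))
    have x2 : len w < len (w * t) ↔ len (s * w) < len (s * (w * t)) := by omega
    rw [opL_vec, opR_vec]
    by_cases ha : len w < len (s * w) <;> by_cases hb : len w < len (w * t)
    · rw [if_pos ha, if_pos hb, opL_vec, opR_vec, if_pos (x1.1 ha), hassoc, if_pos (x2.1 hb)]
    · rw [if_pos ha, if_neg hb, map_add, map_smul, map_smul, opR_vec, opL_vec, opL_vec,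
        if_pos (x1.1 ha), hassoc, if_neg (fun h => hb (x2.2 h)), if_pos ha]
    · rw [if_neg ha, if_pos hb, map_add, map_smul, map_smul, opR_vec, opL_vec, opR_vec,
        if_neg (fun h => ha (x1.2 h)), hassoc, if_pos (x2.1 hb), if_pos hb]
    · rw [if_neg ha, if_neg hb, map_add, map_smul, map_smul, map_add, map_smul, map_smul,
        opR_vec, opL_vec, opR_vec, opL_vec, hassoc, if_neg (fun h => ha (x1.2 h)), if_neg ha,
        if_neg hb, if_neg (fun h => hb (x2.2 h))]
      simp only [smul_add, smul_smul]
      rw [mul_comm (tpow 2 - 1) (tpow 2)]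
      abel

/-- `f` commutes with right multiplications. -/
def IsRightLinear (f : Module.End Laur (FreeMod r)) : Prop :=
  (∀ t ∈ simpleReflections r, Commute f (opR t)) ∧ ∀ v, len v = 0 → Commute f (shiftR v)

lemma IsRightLinear.mul {f g : Module.End Laur (FreeMod r)} (hf : IsRightLinear f)
    (hg : IsRightLinear g) : IsRightLinear (f * g) :=
  ⟨fun t ht => (hf.1 t ht).mul_left (hg.1 t ht), fun v hv => (hf.2 v hv).mul_left (hg.2 v hv)⟩

lemma IsRightLinear.add {f g : Module.End Laur (FreeMod r)} (hf : IsRightLinear f)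
    (hg : IsRightLinear g) : IsRightLinear (f + g) :=
  ⟨fun t ht => (hf.1 t ht).add_left (hg.1 t ht), fun v hv => (hf.2 v hv).add_left (hg.2 v hv)⟩

lemma isRightLinear_algebraMap (a : Laur) :
    IsRightLinear (algebraMap Laur (Module.End Laur (FreeMod r)) a) :=
  ⟨fun _ _ => Algebra.commutes _ _, fun _ _ => Algebra.commutes _ _⟩

lemma isRightLinear_one : IsRightLinear (1 : Module.End Laur (FreeMod r)) :=
  ⟨fun _ _ => Commute.one_left _, fun _ _ => Commute.one_left _⟩

lemma isRightLinear_opL [NeZero r] {s : W r} (hs : s ∈ simpleReflections r) :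
    IsRightLinear (opL s) := by
  refine ⟨fun t ht => opL_commute_opR hs ht, fun v hv => end_ext fun w => ?_⟩
  simp only [Module.End.mul_apply, shiftR_vec, opL_vec]
  rw [← mul_assoc, len_mul_of_len_eq_zero' hv, len_mul_of_len_eq_zero' hv]
  split_ifs
  · rw [shiftR_vec]
  · rw [map_add, map_smul, map_smul, shiftR_vec, shiftR_vec]

lemma isRightLinear_shiftL [NeZero r] {v : W r} (hv : len v = 0) :
    IsRightLinear (shiftL v) := by
  refine ⟨fun t _ => end_ext fun w => ?_, fun v' _ => end_ext fun w => ?_⟩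
  · simp only [Module.End.mul_apply, shiftL_vec, opR_vec]
    rw [mul_assoc, len_mul_of_len_eq_zero hv, len_mul_of_len_eq_zero hv]
    split_ifs
    · rw [shiftL_vec]
    · rw [map_add, map_smul, map_smul, shiftL_vec, shiftL_vec]
  · simp only [Module.End.mul_apply, shiftL_vec, shiftR_vec, mul_assoc]

/-- The right operators reach every basis vector from `vec 1`, so operators commuting with them are
determined by one value. Identities between left operators thus reduce to a check at `vec 1`,
without any braid relations. -/
lemma IsRightLinear.ext [NeZero r] {f g : Module.End Laur (FreeMod r)} (hf : IsRightLinear f)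
    (hg : IsRightLinear g) (h : f (vec 1) = g (vec 1)) : f = g := by
  refine end_ext fun w => ?_
  induction hn : len w generalizing w with
  | zero =>
    have : vec w = shiftR w (vec 1) := by rw [shiftR_vec, one_mul]
    rw [this, ← Module.End.mul_apply, ← Module.End.mul_apply, hf.2 w hn, hg.2 w hn,
      Module.End.mul_apply, Module.End.mul_apply, h]
  | succ n ih =>
    obtain ⟨s, hs, h'⟩ := exists_right_descent (w := w) (by omega)
    have : vec w = opR s (vec (w * s)) := by
      rw [opR_vec, simple_mul_cancel_right hs, if_pos (by omega)]
    rw [this, ← Module.End.mul_apply, ← Module.End.mul_apply, hf.1 s hs, hg.1 s hs,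
      Module.End.mul_apply, Module.End.mul_apply, ih _ (by omega)]

lemma exists_isRightLinear [NeZero r] (w : W r) :
    ∃ f : Module.End Laur (FreeMod r), IsRightLinear f ∧ f (vec 1) = vec w := by
  induction hn : len w generalizing w with
  | zero => exact ⟨shiftL w, isRightLinear_shiftL hn, by rw [shiftL_vec, mul_one]⟩
  | succ n ih =>
    obtain ⟨s, hs, h⟩ := exists_left_descent (w := w) (by omega)
    obtain ⟨f, hf, hf'⟩ := ih (s * w) (by omega)
    refine ⟨opL s * f, (isRightLinear_opL hs).mul hf, ?_⟩
    rw [Module.End.mul_apply, hf', opL_vec, simple_mul_cancel_left hs, if_pos (by omega)]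

/-- Left multiplication by `T_w`. -/
noncomputable def opT [NeZero r] (w : W r) : Module.End Laur (FreeMod r) :=
  (exists_isRightLinear w).choose

lemma isRightLinear_opT [NeZero r] (w : W r) : IsRightLinear (opT w) :=
  (exists_isRightLinear w).choose_spec.1

lemma opT_vec_one [NeZero r] (w : W r) : opT w (vec 1) = vec w :=
  (exists_isRightLinear w).choose_spec.2

lemma opT_vec [NeZero r] {w x : W r} (h : len (w * x) = len w + len x) :
    opT w (vec x) = vec (w * x) := by
  induction hn : len x generalizing x with
  | zero =>
    have : vec x = shiftR x (vec 1) := by rw [shiftR_vec, one_mul]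
    rw [this, ← Module.End.mul_apply, (isRightLinear_opT w).2 x hn, Module.End.mul_apply,
      opT_vec_one, shiftR_vec]
  | succ n ih =>
    obtain ⟨s, hs, h'⟩ := exists_right_descent (w := x) (by omega)
    have h1 : vec x = opR s (vec (x * s)) := by
      rw [opR_vec, simple_mul_cancel_right hs, if_pos (by omega)]
    have h2 := len_mul_simple hs (w * (x * s))
    have h3 := len_mul_le w (x * s)
    rw [mul_assoc, simple_mul_cancel_right hs] at h2
    rw [h1, ← Module.End.mul_apply, (isRightLinear_opT w).1 s hs, Module.End.mul_apply,
      ih (by omega) (by omega), opR_vec, mul_assoc, simple_mul_cancel_right hs,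
      if_pos (by omega)]

lemma opT_simple [NeZero r] {s : W r} (hs : s ∈ simpleReflections r) : opT s = opL s := by
  refine (isRightLinear_opT s).ext (isRightLinear_opL hs) ?_
  rw [opT_vec_one, opL_vec, mul_one, if_pos (by rw [len_one, len_simple hs]; exact one_pos)]

/-- The regular representation of the Hecke algebra. -/
noncomputable def regRep (r : ℕ) [NeZero r] : Hecke r →ₐ[Laur] Module.End Laur (FreeMod r) :=
  liftHecke opT
    -- Each defining relation is an identity of right-linear operators and is verified at `vec 1`.
    ((isRightLinear_opT 1).ext isRightLinear_one (by rw [opT_vec_one]; rfl))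
    (fun w w' h => ((isRightLinear_opT w).mul (isRightLinear_opT w')).ext
      (isRightLinear_opT _) (by rw [Module.End.mul_apply, opT_vec_one, opT_vec_one, opT_vec h]))
    (fun s hs => by
      have h0 : IsRightLinear (0 : Module.End Laur (FreeMod r)) := by
        simpa using isRightLinear_algebraMap (r := r) 0
      have h1 : IsRightLinear (opT s - algebraMap Laur _ (tpow 2)) := by
        have := (isRightLinear_opT s).add (isRightLinear_algebraMap (r := r) (-tpow 2))
        rwa [map_neg, ← sub_eq_add_neg] at this
      refine (((isRightLinear_opT s).add isRightLinear_one).mul h1).ext h0 ?_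
      rw [Module.End.mul_apply, LinearMap.sub_apply, opT_vec_one, Module.algebraMap_end_apply,
        map_sub, map_smul, LinearMap.add_apply, LinearMap.add_apply, opT_vec_one,
        Module.End.one_apply, Module.End.one_apply, opT_simple hs, opL_vec, simple_mul_self hs,
        if_neg (by rw [len_one]; omega), LinearMap.zero_apply, sub_smul, one_smul, smul_add]
      abel)

lemma regRep_heckeT [NeZero r] (w : W r) : regRep r (heckeT w) (vec 1) = vec w := by
  rw [regRep, liftHecke_heckeT, opT_vec_one]

/-- Acting on `vec 1` sends the `T_w` to the basis vectors of a free module. -/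
lemma linearIndependent_heckeT [NeZero r] : LinearIndependent Laur (heckeT (r := r)) := by
  let ev : Hecke r →ₗ[Laur] FreeMod r :=
    (LinearMap.applyₗ (vec 1)).comp (regRep r).toLinearMap
  refine LinearIndependent.of_comp ev ?_
  have : ⇑ev ∘ heckeT = fun w : W r => Finsupp.single w (1 : Laur) :=
    funext fun w => regRep_heckeT w
  rw [this]
  exact Finsupp.linearIndependent_single_one Laur (W r)

lemma heckeT_mul_mem_span [NeZero r] (w : W r) {x : Hecke r}
    (hx : x ∈ Submodule.span Laur (Set.range (heckeT (r := r)))) :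
    heckeT w * x ∈ Submodule.span Laur (Set.range (heckeT (r := r))) := by
  have hT : ∀ y : W r, heckeT y ∈ Submodule.span Laur (Set.range (heckeT (r := r))) :=
    fun y => Submodule.subset_span ⟨y, rfl⟩
  induction hn : len w generalizing w x with
  | zero =>
    induction hx using Submodule.span_induction with
    | mem x hx =>
      obtain ⟨y, rfl⟩ := hx
      rw [heckeT_mul (by rw [len_mul_of_len_eq_zero hn]; omega)]
      exact hT _
    | zero => simp
    | add x y _ _ hx hy => rw [mul_add]; exact add_mem hx hy
    | smul a x _ hx => rw [mul_smul_comm]; exact Submodule.smul_mem _ _ hx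
  | succ n ih =>
    obtain ⟨s, hs, h⟩ := exists_left_descent (w := w) (by omega)
    have h1 := heckeT_simple_mul (w := s * w) hs (by rw [simple_mul_cancel_left hs]; omega)
    rw [simple_mul_cancel_left hs] at h1
    have h2 := ih (s * w) hx (by omega)
    rw [← h1, mul_assoc]
    generalize heckeT (s * w) * x = z at h2
    induction h2 using Submodule.span_induction with
    | mem x hx =>
      obtain ⟨y, rfl⟩ := hx
      rcases len_simple_mul hs y with hy | hy
      · rw [heckeT_simple_mul hs (by omega)]
        exact hT _
      · rw [heckeT_simple_mul' hs (by omega)]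
        exact add_mem (Submodule.smul_mem _ _ (hT _)) (Submodule.smul_mem _ _ (hT _))
    | zero => simp
    | add x y _ _ hx hy => rw [mul_add]; exact add_mem hx hy
    | smul a x _ hx => rw [mul_smul_comm]; exact Submodule.smul_mem _ _ hx

/-- The span is stable under left multiplication by the generators and contains `1`. -/
lemma span_heckeT [NeZero r] : Submodule.span Laur (Set.range (heckeT (r := r))) = ⊤ := by
  have key : ∀ a : FreeAlgebra Laur (W r), ∀ x ∈ Submodule.span Laur (Set.range (heckeT (r := r))),
      mkHecke r a * x ∈ Submodule.span Laur (Set.range (heckeT (r := r))) := by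
    intro a
    induction a using FreeAlgebra.induction with
    | grade0 c =>
      intro x hx
      rw [AlgHom.commutes, ← Algebra.smul_def]
      exact Submodule.smul_mem _ _ hx
    | grade1 w => intro x hx; exact heckeT_mul_mem_span w hx
    | mul a b ha hb => intro x hx; rw [map_mul, mul_assoc]; exact ha _ (hb _ hx)
    | add a b ha hb => intro x hx; rw [map_add, add_mul]; exact add_mem (ha _ hx) (hb _ hx)
  refine eq_top_iff.2 fun h _ => ?_
  obtain ⟨a, rfl⟩ := mkHecke_surjective h
  rw [← mul_one (mkHecke r a)]
  exact key a 1 (Submodule.subset_span ⟨1, heckeT_one⟩)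

/-! ### Coefficients with respect to the standard basis. -/

lemma isBasisFamily_heckeT [NeZero r] : IsBasisFamily (heckeT (r := r)) :=
  ⟨linearIndependent_heckeT, span_heckeT⟩

/-- The standard basis of the Hecke algebra. -/
noncomputable def basisT (r : ℕ) [NeZero r] : Module.Basis (W r) Laur (Hecke r) :=
  Module.Basis.mk linearIndependent_heckeT span_heckeT.ge

lemma basisT_apply [NeZero r] (w : W r) : basisT r w = heckeT w := Module.Basis.mk_apply _ _ w

/-- The coefficient of `T_w` in `h`. -/
noncomputable def coeff [NeZero r] (w : W r) : Hecke r →ₗ[Laur] Laur := (basisT r).coord w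

open Classical in
lemma coeff_heckeT [NeZero r] (w y : W r) :
    coeff w (heckeT y) = if y = w then (1 : Laur) else 0 := by
  rw [← basisT_apply, coeff, Module.Basis.coord_apply, Module.Basis.repr_self,
    Finsupp.single_apply]

lemma hecke_ext [NeZero r] {h h' : Hecke r} (H : ∀ w, coeff w h = coeff w h') : h = h' :=
  (basisT r).ext_elem H

lemma finite_coeff_ne_zero [NeZero r] (h : Hecke r) : {w | coeff w h ≠ 0}.Finite :=
  ((basisT r).repr h).hasFiniteSupport

lemma hecke_induction [NeZero r] {p : Hecke r → Prop} (h : Hecke r) (zero : p 0)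
    (add : ∀ x y, p x → p y → p (x + y)) (single : ∀ (a : Laur) w, p (a • heckeT w)) : p h := by
  rw [← (basisT r).linearCombination_repr h, Finsupp.linearCombination_apply, Finsupp.sum]
  refine Finset.sum_induction _ p add zero fun w _ => ?_
  rw [basisT_apply]
  exact single _ _

lemma coords_eq_repr {ι M : Type*} [AddCommGroup M] [Module Laur M] (b : Module.Basis ι Laur M)
    (m : M) : coords b m = b.repr m := by
  have h : LinearIndependent Laur b ∧ m ∈ Submodule.span Laur (Set.range b) :=
    ⟨b.linearIndependent, by rw [b.span_eq]; trivial⟩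
  rw [coords, dif_pos h]
  apply b.repr.symm.injective
  rw [LinearEquiv.symm_apply_apply, Module.Basis.repr_symm_apply]
  exact h.1.linearCombination_repr ⟨m, h.2⟩

/-- The coefficient of `T_y` in `T_s h`. -/
lemma coeff_simple_mul [NeZero r] {s : W r} (hs : s ∈ simpleReflections r) (y : W r)
    (h : Hecke r) : coeff y (heckeT s * h) =
      if len y < len (s * y) then (tpow 2 : Laur) * coeff (s * y) h
      else coeff (s * y) h + (tpow 2 - 1 : Laur) * coeff y h := by
  classical
  induction h using hecke_induction with
  | zero => simp
  | add x x' hx hx' =>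
    rw [mul_add, map_add, hx, hx', map_add, map_add]
    split_ifs <;> ring
  | single a w =>
    have e1 : w = s * y ↔ s * w = y :=
      ⟨fun h => by rw [h, simple_mul_cancel_left hs], fun h => by
        rw [← h, simple_mul_cancel_left hs]⟩
    rw [mul_smul_comm, map_smul, map_smul, map_smul, coeff_heckeT, coeff_heckeT]
    have hne : s * y ≠ y := fun h => by
      have := len_simple_mul hs y
      rw [h] at this; omega
    rcases len_simple_mul hs w with hw | hw
    · rw [heckeT_simple_mul hs (by omega), coeff_heckeT]
      by_cases h1 : s * w = y
      · have h2 := e1.2 h1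
        rw [if_pos h1, if_pos h2, ← h1, simple_mul_cancel_left hs, if_neg (by omega),
          if_neg (by rw [← h1] at hne; rw [simple_mul_cancel_left hs] at hne; exact hne)]
        simp
      · rw [if_neg h1, if_neg (fun h => h1 (e1.1 h))]
        by_cases h2 : w = y
        · rw [if_pos h2, ← h2, if_pos (by omega)]; simp
        · rw [if_neg h2]; simp
    · rw [heckeT_simple_mul' hs (by omega), map_add, map_smul, map_smul, coeff_heckeT,
        coeff_heckeT]
      by_cases h1 : s * w = y
      · have h2 := e1.2 h1
        have h3 : w ≠ y := by rintro rfl; exact hne h1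
        rw [if_pos h1, if_pos h2, if_neg h3, ← h1, simple_mul_cancel_left hs, if_pos (by omega)]
        simp [mul_comm]
      · rw [if_neg h1, if_neg (fun h => h1 (e1.1 h))]
        by_cases h2 : w = y
        · rw [if_pos h2, ← h2, if_neg (by omega)]; simp [mul_comm]
        · rw [if_neg h2]; simp

lemma tpow_two_ne_zero : (tpow 2 : Laur) ≠ 0 := by
  unfold tpow LaurentPolynomial.T
  rw [Ne, AddMonoidAlgebra.single_eq_zero]
  exact one_ne_zero

/-- This turns the eigenvalue condition into plain invariance of coefficients, which extends at once
from generators to a whole Young subgroup. -/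
lemma simple_mul_eq_smul_iff [NeZero r] {s : W r} (hs : s ∈ simpleReflections r) {h : Hecke r} :
    heckeT s * h = (tpow 2 : Laur) • h ↔ ∀ y, coeff (s * y) h = coeff y h := by
  constructor
  · intro H
    have key : ∀ y, len y < len (s * y) → coeff (s * y) h = coeff y h := fun y hy => by
      have h1 := coeff_simple_mul hs y h
      rw [H, map_smul, if_pos hy, smul_eq_mul] at h1
      exact (mul_left_cancel₀ tpow_two_ne_zero h1).symm
    intro y
    rcases len_simple_mul hs y with hy | hy
    · exact key y (by omega)
    · have := key (s * y) (by rw [simple_mul_cancel_left hs]; omega)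
      rw [simple_mul_cancel_left hs] at this
      exact this.symm
  · intro H
    refine hecke_ext fun y => ?_
    rw [coeff_simple_mul hs, map_smul, H, smul_eq_mul]
    split_ifs <;> ring

/-! ### The anti-automorphism -/

/-- The anti-automorphism `T_w ↦ T_{w⁻¹}`, as a homomorphism to the opposite algebra. -/
noncomputable def antiHom (r : ℕ) [NeZero r] : Hecke r →ₐ[Laur] (Hecke r)ᵐᵒᵖ :=
  liftHecke (fun w => MulOpposite.op (heckeT w⁻¹))
    (by rw [inv_one, heckeT_one, MulOpposite.op_one])
    (fun w w' h => by
      rw [← MulOpposite.op_mul, heckeT_mul, mul_inv_rev]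
      rw [← mul_inv_rev, len_inv, len_inv, len_inv, h, add_comm])
    (fun s hs => by
      rw [simple_inv hs, MulOpposite.algebraMap_apply, ← MulOpposite.op_one,
        ← MulOpposite.op_add, ← MulOpposite.op_sub, ← MulOpposite.op_mul, sub_mul, mul_add,
        heckeT_quad hs, mul_one, Algebra.algebraMap_eq_smul_one, smul_mul_assoc, one_mul, smul_add,
        sub_smul, one_smul]
      rw [← MulOpposite.op_zero]
      congr 1
      abel)

/-- The anti-automorphism `T_w ↦ T_{w⁻¹}`. -/
noncomputable def anti [NeZero r] (h : Hecke r) : Hecke r := (antiHom r h).unop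

lemma anti_heckeT [NeZero r] (w : W r) : anti (heckeT w : Hecke r) = heckeT w⁻¹ := by
  rw [anti, antiHom, liftHecke_heckeT, MulOpposite.unop_op]

lemma anti_add [NeZero r] (x y : Hecke r) : anti (x + y) = anti x + anti y := by simp [anti]

lemma anti_smul [NeZero r] (a : Laur) (x : Hecke r) : anti (a • x) = a • anti x := by simp [anti]

lemma anti_mul [NeZero r] (x y : Hecke r) : anti (x * y) = anti y * anti x := by simp [anti]

lemma anti_zero [NeZero r] : anti (0 : Hecke r) = 0 := by simp [anti]

lemma anti_one [NeZero r] : anti (1 : Hecke r) = 1 := by simp [anti]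

lemma anti_anti [NeZero r] (x : Hecke r) : anti (anti x) = x := by
  induction x using hecke_induction with
  | zero => rw [anti_zero, anti_zero]
  | add x y hx hy => rw [anti_add, anti_add, hx, hy]
  | single a w => rw [anti_smul, anti_smul, anti_heckeT, anti_heckeT, inv_inv]

lemma coeff_anti [NeZero r] (w : W r) (x : Hecke r) : coeff w (anti x) = coeff w⁻¹ x := by
  classical
  induction x using hecke_induction with
  | zero => rw [anti_zero, map_zero, map_zero]
  | add x y hx hy => rw [anti_add, map_add, map_add, hx, hy]
  | single a y =>
    rw [anti_smul, map_smul, map_smul, anti_heckeT, coeff_heckeT, coeff_heckeT]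
    simp only [inv_eq_iff_eq_inv]

lemma anti_injective [NeZero r] : Function.Injective (anti : Hecke r → Hecke r) :=
  Function.LeftInverse.injective anti_anti

lemma mul_simple_eq_smul_iff_anti [NeZero r] {s : W r} (hs : s ∈ simpleReflections r)
    {h : Hecke r} : h * heckeT s = (tpow 2 : Laur) • h ↔
      heckeT s * anti h = (tpow 2 : Laur) • anti h := by
  rw [← anti_injective.eq_iff, anti_mul, anti_smul, anti_heckeT, simple_inv hs]

lemma mul_simple_eq_smul_iff [NeZero r] {s : W r} (hs : s ∈ simpleReflections r) {h : Hecke r} :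
    h * heckeT s = (tpow 2 : Laur) • h ↔ ∀ y, coeff (y * s) h = coeff y h := by
  rw [mul_simple_eq_smul_iff_anti hs, simple_mul_eq_smul_iff hs]
  simp only [coeff_anti, mul_inv_rev, simple_inv hs]
  exact ⟨fun H y => by simpa using H y⁻¹, fun H y => H y⁻¹⟩

/-! ### Powers of `t` -/

lemma tpow_add (a b : ℤ) : tpow (a + b) = tpow a * tpow b := LaurentPolynomial.T_add a b

lemma tpow_zero : tpow 0 = 1 := LaurentPolynomial.T_zero

lemma invert_tpow (a : ℤ) : LaurentPolynomial.invert (tpow a) = tpow (-a) :=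
  LaurentPolynomial.invert_T a

lemma tpow_mul_neg (a : ℤ) : tpow a * tpow (-a) = 1 := by
  rw [← tpow_add, add_neg_cancel, tpow_zero]

lemma isUnit_tpow (a : ℤ) : IsUnit (tpow a) := IsUnit.of_mul_eq_one _ (tpow_mul_neg a)

lemma tpow_ne_zero (a : ℤ) : tpow a ≠ 0 := (isUnit_tpow a).ne_zero

lemma coeff_tpow_mul (k m : ℤ) (p : Laur) : (tpow k * p).coeff m = p.coeff (m - k) := by
  have := AddMonoidAlgebra.coeff_single_mul_apply (R := ℤ) p 1 k m
  rw [tpow, LaurentPolynomial.T, this, one_mul, neg_add_eq_sub]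

/-- All exponents of `p` are smaller than `k`. -/
def DegLT (p : Laur) (k : ℤ) : Prop := ∀ m, k ≤ m → p.coeff m = 0

lemma DegLT.add {p p' : Laur} {k : ℤ} (h : DegLT p k) (h' : DegLT p' k) : DegLT (p + p') k :=
  fun m hm => by
    rw [AddMonoidAlgebra.coeff_add, Finsupp.add_apply, h m hm, h' m hm, add_zero]

lemma DegLT.neg {p : Laur} {k : ℤ} (h : DegLT p k) : DegLT (-p) k :=
  fun m hm => by
    rw [AddMonoidAlgebra.coeff_neg, Finsupp.neg_apply, h m hm, neg_zero]

lemma DegLT.sub {p p' : Laur} {k : ℤ} (h : DegLT p k) (h' : DegLT p' k) : DegLT (p - p') k := by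
  rw [sub_eq_add_neg]; exact h.add h'.neg

lemma degLT_zero (k : ℤ) : DegLT 0 k := fun _ _ => by simp

lemma tpow_pow (a : ℤ) (n : ℕ) : tpow a ^ n = tpow (n * a) := LaurentPolynomial.T_pow a n

/-- The exponents that occur are `2 i - l` with `i ≤ deg P`. With `a` the length of `y`, this is the
Kazhdan-Lusztig degree bound in terms of `t`. -/
lemma degLT_tpow_mul_aeval {P : Polynomial ℤ} {a l : ℕ} (h : 2 * P.natDegree + a + 1 ≤ l) :
    DegLT (tpow (-(l : ℤ)) * Polynomial.aeval (tpow 2) P) (-(a : ℤ)) := by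
  intro m hm
  rw [coeff_tpow_mul, Polynomial.aeval_eq_sum_range, AddMonoidAlgebra.coeff_sum,
    Finsupp.finsetSum_apply]
  refine Finset.sum_eq_zero fun i hi => ?_
  rw [tpow_pow, AddMonoidAlgebra.coeff_smul, Finsupp.smul_apply, tpow, LaurentPolynomial.T_apply,
    if_neg, smul_zero]
  have := Finset.mem_range.1 hi
  omega

/-- A Laurent polynomial with exponents less than `-a` that is invariant under
`t ↦ t⁻¹`, up to the normalization `t ^ (-2 a)`, vanishes. -/
lemma eq_zero_of_invert_mul {p : Laur} {a : ℤ} (h : DegLT p (-a))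
    (h' : LaurentPolynomial.invert p * tpow (-2 * a) = p) : p = 0 := by
  refine LaurentPolynomial.ext fun m => ?_
  by_cases hm : -a ≤ m
  · rw [h m hm]; rfl
  · rw [← h', mul_comm, coeff_tpow_mul, LaurentPolynomial.invert_apply, h _ (by omega)]; rfl

/-! ### The bar involution -/

lemma isUnit_heckeT_simple [NeZero r] {s : W r} (hs : s ∈ simpleReflections r) :
    IsUnit (heckeT s : Hecke r) ∧ Ring.inverse (heckeT s : Hecke r) =
      tpow (-2) • heckeT s + (tpow (-2) - 1) • 1 := by
  have h2 : tpow (-2) * tpow 2 = 1 := tpow_mul_neg (-2)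
  have h1 : (heckeT s : Hecke r) * (tpow (-2) • heckeT s + (tpow (-2) - 1) • 1) = 1 := by
    rw [mul_add, mul_smul_comm, mul_smul_comm, heckeT_quad hs, mul_one, smul_add, smul_smul,
      smul_smul, mul_sub, h2, one_smul, mul_one, add_right_comm, ← add_smul]
    simp
  have h1' : (tpow (-2) • heckeT s + (tpow (-2) - 1) • 1) * (heckeT s : Hecke r) = 1 := by
    rw [add_mul, smul_mul_assoc, smul_mul_assoc, heckeT_quad hs, one_mul, smul_add, smul_smul,
      smul_smul, mul_sub, h2, one_smul, mul_one, add_right_comm, ← add_smul]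
    simp
  exact ⟨⟨⟨_, _, h1, h1'⟩, rfl⟩, Ring.inverse_unit ⟨_, _, h1, h1'⟩⟩

lemma isUnit_heckeT [NeZero r] (w : W r) : IsUnit (heckeT w : Hecke r) := by
  induction hn : len w generalizing w with
  | zero =>
    have hn' : len w⁻¹ = 0 := by rw [len_inv, hn]
    refine ⟨⟨heckeT w, heckeT w⁻¹, ?_, ?_⟩, rfl⟩
    · rw [heckeT_mul (by simp [hn]), mul_inv_cancel, heckeT_one]
    · rw [heckeT_mul (by simp [hn]), inv_mul_cancel, heckeT_one]
  | succ n ih =>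
    obtain ⟨s, hs, h⟩ := exists_left_descent (w := w) (by omega)
    have h1 := heckeT_simple_mul (w := s * w) hs (by rw [simple_mul_cancel_left hs]; omega)
    rw [simple_mul_cancel_left hs] at h1
    rw [← h1]
    exact (isUnit_heckeT_simple hs).1.mul (ih _ (by omega))

lemma heckeBar_eq [NeZero r] (h : Hecke r) : heckeBar h = ((basisT r).repr h).sum fun w a =>
    (LaurentPolynomial.invert a : Laur) • Ring.inverse (heckeT w⁻¹) := by
  have : heckeT (r := r) = basisT r := funext fun w => (basisT_apply w).symm
  rw [heckeBar]
  congr 1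
  conv_lhs => rw [this]
  exact coords_eq_repr _ _

lemma heckeBar_zero [NeZero r] : heckeBar (0 : Hecke r) = 0 := by
  rw [heckeBar_eq, map_zero, Finsupp.sum_zero_index]

lemma heckeBar_add [NeZero r] (x y : Hecke r) :
    heckeBar (x + y) = heckeBar x + heckeBar y := by
  rw [heckeBar_eq, heckeBar_eq, heckeBar_eq, map_add]
  exact Finsupp.sum_add_index' (fun _ => by rw [map_zero, zero_smul])
    (fun _ _ _ => by rw [map_add, add_smul])

lemma heckeBar_smul [NeZero r] (a : Laur) (x : Hecke r) :
    heckeBar (a • x) = (LaurentPolynomial.invert a : Laur) • heckeBar x := by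
  rw [heckeBar_eq, heckeBar_eq, map_smul, Finsupp.sum_smul_index' (fun _ => by
    rw [map_zero, zero_smul]), Finsupp.smul_sum]
  exact Finsupp.sum_congr fun w _ => by rw [smul_eq_mul, map_mul, mul_smul]

lemma heckeBar_heckeT [NeZero r] (w : W r) :
    heckeBar (heckeT w : Hecke r) = Ring.inverse (heckeT w⁻¹) := by
  rw [heckeBar_eq, ← basisT_apply, Module.Basis.repr_self,
    Finsupp.sum_single_index (by rw [map_zero, zero_smul]), map_one, one_smul]

lemma heckeBar_neg [NeZero r] (x : Hecke r) : heckeBar (-x) = -heckeBar x := by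
  have := heckeBar_smul (-1) x
  rwa [map_neg, map_one, neg_one_smul, neg_one_smul] at this

lemma heckeBar_sub [NeZero r] (x y : Hecke r) :
    heckeBar (x - y) = heckeBar x - heckeBar y := by
  rw [sub_eq_add_neg, heckeBar_add, heckeBar_neg, sub_eq_add_neg]

lemma heckeBar_sum [NeZero r] {ι : Type*} (s : Finset ι) (f : ι → Hecke r) :
    heckeBar (∑ i ∈ s, f i) = ∑ i ∈ s, heckeBar (f i) := by
  classical
  induction s using Finset.induction_on with
  | empty => simp [heckeBar_zero]
  | insert a s ha ih => rw [Finset.sum_insert ha, Finset.sum_insert ha, heckeBar_add, ih]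

lemma heckeBar_heckeT_simple_mul [NeZero r] {s w : W r} (hs : s ∈ simpleReflections r)
    (h : len w < len (s * w)) : heckeBar (heckeT (s * w) : Hecke r) =
      Ring.inverse (heckeT s) * heckeBar (heckeT w) := by
  have h1 : (heckeT w⁻¹ * heckeT s : Hecke r) = heckeT (s * w)⁻¹ := by
    rw [heckeT_mul, mul_inv_rev, simple_inv hs]
    have := len_simple_mul hs w
    rw [← len_simple_mul_eq hs, len_inv, len_simple hs]; omega
  rw [heckeBar_heckeT, heckeBar_heckeT, ← h1, Ring.inverse_mul (Or.inl (isUnit_heckeT _))]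

/-- Multiplicativity of the bar map is needed only for a left factor `T_s`. For a descent it amounts
to the quadratic relation of the inverse of `T_s`, which is `key`. -/
lemma heckeBar_simple_mul [NeZero r] {s : W r} (hs : s ∈ simpleReflections r) (x : Hecke r) :
    heckeBar (heckeT s * x) = Ring.inverse (heckeT s) * heckeBar x := by
  induction x using hecke_induction with
  | zero => simp [heckeBar_zero]
  | add x y hx hy => rw [mul_add, heckeBar_add, heckeBar_add, mul_add, hx, hy]
  | single a w =>
    rw [mul_smul_comm, heckeBar_smul, heckeBar_smul, mul_smul_comm]
    congr 1
    rcases len_simple_mul hs w with h | h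
    · rw [heckeT_simple_mul hs (by omega), heckeBar_heckeT_simple_mul hs (by omega)]
    · have h1 := heckeBar_heckeT_simple_mul (w := s * w) hs
        (by rw [simple_mul_cancel_left hs]; omega)
      rw [simple_mul_cancel_left hs] at h1
      have hu := (isUnit_heckeT_simple hs).1
      have key : (tpow (-2) - 1) • Ring.inverse (heckeT s : Hecke r) + tpow (-2) • 1 =
          Ring.inverse (heckeT s) * Ring.inverse (heckeT s) := by
        apply hu.mul_left_cancel
        rw [← mul_assoc, Ring.mul_inverse_cancel _ hu, one_mul, mul_add, mul_smul_comm,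
          Ring.mul_inverse_cancel _ hu, mul_smul_comm, mul_one, (isUnit_heckeT_simple hs).2,
          add_comm]
      rw [heckeT_simple_mul' hs (by omega), heckeBar_add, heckeBar_smul, heckeBar_smul, h1,
        map_sub, invert_tpow, map_one, ← mul_assoc, ← key, add_mul, smul_mul_assoc,
        smul_mul_assoc, one_mul]

/-- Left multiplication by `C_s = t⁻¹ (T_s + 1)`. -/
noncomputable def mulC (s : W r) (x : Hecke r) : Hecke r := tpow (-1) • (heckeT s * x + x)

/-- The factor `t⁻¹ (T_s + 1)` is bar-invariant, since the inverse of `T_s` is `q⁻¹ T_s + q⁻¹ - 1`.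
-/
lemma heckeBar_mulC [NeZero r] {s : W r} (hs : s ∈ simpleReflections r) {x : Hecke r}
    (hx : heckeBar x = x) : heckeBar (mulC s x) = mulC s x := by
  rw [mulC, heckeBar_smul, heckeBar_add, heckeBar_simple_mul hs, hx, invert_tpow,
    (isUnit_heckeT_simple hs).2, add_mul, smul_mul_assoc, smul_mul_assoc, one_mul, sub_smul,
    one_smul, add_assoc, sub_add_cancel, ← smul_add, smul_smul, ← tpow_add]
  norm_num

lemma simple_mul_mulC [NeZero r] {s : W r} (hs : s ∈ simpleReflections r) (x : Hecke r) :
    heckeT s * mulC s x = (tpow 2 : Laur) • mulC s x := by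
  rw [mulC, mul_smul_comm, smul_comm]
  congr 1
  rw [mul_add, ← mul_assoc, heckeT_quad hs, add_mul, smul_mul_assoc, smul_mul_assoc, one_mul,
    sub_smul, one_smul, smul_add]
  abel

lemma heckeT_of_len_eq_zero_bar [NeZero r] {w : W r} (h : len w = 0) :
    heckeBar (heckeT w : Hecke r) = heckeT w := by
  have h1 : (heckeT w * heckeT w⁻¹ : Hecke r) = 1 := by
    rw [heckeT_mul (by simp [h]), mul_inv_cancel, heckeT_one]
  rw [heckeBar_heckeT]
  have hu := isUnit_heckeT w⁻¹
  apply hu.mul_right_cancel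
  rw [Ring.inverse_mul_cancel _ hu, h1]

/-- Along a reduced word, each factor contributes `q⁻¹ T_s` plus a scalar. Only the product of the
terms `q⁻¹ T_s` reaches the length of `w`. -/
lemma coeff_heckeBar_heckeT [NeZero r] (w : W r) :
    coeff w (heckeBar (heckeT w)) = tpow (-2 * (len w : ℤ)) ∧
      ∀ y, y ≠ w → len w ≤ len y → coeff y (heckeBar (heckeT w)) = 0 := by
  classical
  induction hn : len w generalizing w with
  | zero =>
    rw [heckeT_of_len_eq_zero_bar hn]
    refine ⟨?_, fun y hy _ => ?_⟩
    · rw [coeff_heckeT, if_pos rfl, Nat.cast_zero, mul_zero, tpow_zero]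
    · rw [coeff_heckeT, if_neg hy.symm]
  | succ n ih =>
    obtain ⟨s, hs, h⟩ := exists_left_descent (w := w) (by omega)
    have h1 := heckeBar_heckeT_simple_mul (w := s * w) hs
      (by rw [simple_mul_cancel_left hs]; omega)
    rw [simple_mul_cancel_left hs, (isUnit_heckeT_simple hs).2, add_mul, smul_mul_assoc,
      smul_mul_assoc, one_mul] at h1
    obtain ⟨ih1, ih2⟩ := ih (s * w) (by omega)
    rw [h1]
    have hsw : s * w ≠ w := fun h' => by rw [h'] at h; omega
    refine ⟨?_, fun y hy hlen => ?_⟩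
    · rw [map_add, map_smul, map_smul, ih2 w hsw.symm (by omega), smul_zero, add_zero,
        coeff_simple_mul hs, if_neg (by omega), ih1, ih2 w hsw.symm (by omega), mul_zero, add_zero,
        smul_eq_mul, ← tpow_add]
      congr 1
      push_cast; ring
    · have hy1 : y ≠ s * w := fun h' => by rw [h'] at hlen; omega
      have hy2 : s * y ≠ s * w := fun h' => hy (mul_left_cancel h')
      rw [map_add, map_smul, map_smul, ih2 y hy1 (by omega), smul_zero, add_zero,
        coeff_simple_mul hs, ih2 y hy1 (by omega), mul_zero, add_zero]
      have := len_simple_mul hs y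
      rw [ih2 _ hy2 (by omega), mul_zero, ite_self, smul_zero]

lemma coeff_heckeBar [NeZero r] {x : Hecke r} {w : W r}
    (h : ∀ y, len w < len y → coeff y x = 0) : coeff w (heckeBar x) =
      LaurentPolynomial.invert (coeff w x) * tpow (-2 * (len w : ℤ)) := by
  have hsum : coeff w (heckeBar x) = ∑ y ∈ ((basisT r).repr x).support,
      LaurentPolynomial.invert (coeff y x) * coeff w (heckeBar (heckeT y)) := by
    rw [heckeBar_eq, Finsupp.sum, map_sum]
    refine Finset.sum_congr rfl fun y _ => ?_
    rw [map_smul, heckeBar_heckeT]; rfl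
  rw [hsum, Finset.sum_eq_single w]
  · rw [(coeff_heckeBar_heckeT w).1]
  · intro y _ hy
    by_cases hlen : len w < len y
    · rw [h y hlen, map_zero, zero_mul]
    · rw [(coeff_heckeBar_heckeT y).2 w hy.symm (by omega), mul_zero]
  · intro hw
    have : coeff w x = 0 := Finsupp.notMem_support_iff.1 hw
    rw [this, map_zero, zero_mul]

lemma exists_max_len_coeff_ne_zero [NeZero r] {x : Hecke r} (hx : x ≠ 0) :
    ∃ w, coeff w x ≠ 0 ∧ ∀ y, len w < len y → coeff y x = 0 := by
  have hne : ({w | coeff w x ≠ 0} : Set (W r)).Nonempty := by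
    by_contra h
    rw [Set.not_nonempty_iff_eq_empty] at h
    refine hx (hecke_ext fun w => ?_)
    rw [map_zero]
    by_contra h'
    have : w ∈ ({w | coeff w x ≠ 0} : Set (W r)) := h'
    rw [h] at this
    exact this
  obtain ⟨w, hw, hmax⟩ := Set.exists_max_image _ len (finite_coeff_ne_zero x) hne
  refine ⟨w, hw, fun y hy => ?_⟩
  by_contra h
  exact absurd (hmax y h) (by omega)

/-- The coefficient `p` at a `w` of maximal length `l` satisfies `p = t ^ (-2 l) p(t⁻¹)`, a symmetry
about exponent `-l`, while all its exponents are below `-l`. -/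
lemma eq_zero_of_heckeBar_eq [NeZero r] {x : Hecke r} (hx : heckeBar x = x)
    (h : ∀ y, DegLT (coeff y x) (-(len y : ℤ))) : x = 0 := by
  by_contra hne
  obtain ⟨w, hw, hmax⟩ := exists_max_len_coeff_ne_zero hne
  have htop := coeff_heckeBar hmax
  rw [hx] at htop
  exact hw (eq_zero_of_invert_mul (h w) htop.symm)

/-! ### Kazhdan-Lusztig elements -/

open Classical in
lemma coeff_finsum_mem [NeZero r] {D : Set (W r)} (hD : D.Finite) (a : W r → Laur) (y : W r) :
    coeff y (∑ᶠ x ∈ D, a x • (heckeT x : Hecke r)) = if y ∈ D then a y else 0 := by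
  rw [finsum_mem_eq_finite_toFinset_sum _ hD, map_sum]
  simp only [map_smul, coeff_heckeT, smul_eq_mul, mul_ite, mul_one, mul_zero,
    Finset.sum_ite_eq', Set.Finite.mem_toFinset]

/-- A description of Kazhdan-Lusztig elements by coefficients. -/
lemma isKLElement_iff [NeZero r] {w : W r} {c : Hecke r} : IsKLElement w c ↔
    heckeBar c = c ∧ ∃ P : W r → Polynomial ℤ, P w = 1 ∧ (∀ y, ¬ bruhatLE y w → P y = 0) ∧
      (∀ y, bruhatLE y w → y ≠ w → 2 * (P y).natDegree + len y + 1 ≤ len w) ∧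
      ∀ y, coeff y c = tpow (-(len w : ℤ)) * Polynomial.aeval (tpow 2) (P y) := by
  classical
  refine and_congr_right fun _ => ⟨?_, ?_⟩
  · rintro ⟨P, h1, h2, rfl⟩
    refine ⟨fun y => if bruhatLE y w then P y else 0, ?_, fun y hy => if_neg hy,
      fun y hy => ?_, fun y => ?_⟩
    · simp only [bruhatLE_refl, if_true, h1]
    · simp only [hy, if_true]; exact h2 y hy
    · rw [coeff_finsum_mem (finite_bruhatLE w)]
      simp only [Set.mem_ofPred_eq]
      split_ifs
      · rfl
      · simp
  · rintro ⟨P, h1, h2, h3, h4⟩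
    refine ⟨P, h1, h3, hecke_ext fun y => ?_⟩
    rw [coeff_finsum_mem (finite_bruhatLE w), h4]
    simp only [Set.mem_ofPred_eq]
    split_ifs with h
    · rfl
    · rw [h2 y h]; simp

lemma _root_.IsKLElement.coeff_self [NeZero r] {w : W r} {c : Hecke r} (h : IsKLElement w c) :
    coeff w c = tpow (-(len w : ℤ)) := by
  obtain ⟨-, P, h1, -, -, h4⟩ := isKLElement_iff.1 h
  rw [h4, h1, map_one, mul_one]

lemma _root_.IsKLElement.le_of_coeff_ne_zero [NeZero r] {w : W r} {c : Hecke r} (h : IsKLElement w c) {y : W r}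
    (hy : coeff y c ≠ 0) : bruhatLE y w := by
  obtain ⟨-, P, -, h2, -, h4⟩ := isKLElement_iff.1 h
  by_contra hc
  rw [h4, h2 y hc] at hy
  simp at hy

/-- In the difference of two candidates the `T_w` terms cancel, and all other coefficients have
small degree. -/
lemma _root_.IsKLElement.unique [NeZero r] {w : W r} {c c' : Hecke r} (h : IsKLElement w c)
    (h' : IsKLElement w c') : c = c' := by
  refine sub_eq_zero.1 (eq_zero_of_heckeBar_eq ?_ fun y => ?_)
  · rw [heckeBar_sub, h.1, h'.1]
  · rw [map_sub]
    by_cases hy : y = w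
    · rw [hy, h.coeff_self, h'.coeff_self, sub_self]; exact degLT_zero _
    have key : ∀ {c}, IsKLElement w c → DegLT (coeff y c) (-(len y : ℤ)) := by
      intro c h
      obtain ⟨-, P, -, h2, h3, h4⟩ := isKLElement_iff.1 h
      rw [h4]
      by_cases hy' : bruhatLE y w
      · exact degLT_tpow_mul_aeval (h3 y hy' hy)
      · rw [h2 y hy']; simpa using degLT_zero _
    exact (key h).sub (key h')

lemma isKLElement_of_len_eq_zero [NeZero r] {w : W r} (h : len w = 0) :
    IsKLElement w (heckeT w : Hecke r) := by
  classical
  have hw : ∀ y, bruhatLE y w → y = w := fun y hy =>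
    (bruhatLE.eq_or_len_lt hy).resolve_right (by omega)
  refine isKLElement_iff.2 ⟨heckeT_of_len_eq_zero_bar h, fun y => if y = w then 1 else 0,
    if_pos rfl, fun y hy => if_neg ?_, fun y hy hne => absurd (hw y hy) hne, fun y => ?_⟩
  · rintro rfl; exact hy (bruhatLE_refl _)
  · rw [coeff_heckeT, h, Nat.cast_zero, neg_zero, tpow_zero, one_mul]
    simp only [eq_comm (a := w)]
    split_ifs <;> simp

lemma coeff_mulC [NeZero r] {s : W r} (hs : s ∈ simpleReflections r) (y : W r) (x : Hecke r) :
    coeff y (mulC s x) = tpow (-1) *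
      if len y < len (s * y) then coeff y x + tpow 2 * coeff (s * y) x
      else coeff (s * y) x + tpow 2 * coeff y x := by
  rw [mulC, map_smul, map_add, coeff_simple_mul hs, smul_eq_mul]
  split_ifs <;> ring

/-- The step of the construction of Kazhdan-Lusztig elements: the coefficients of `C_s C_v`. -/
lemma exists_poly_mulC [NeZero r] {s v : W r} (hs : s ∈ simpleReflections r)
    (hsv : len v < len (s * v)) {c : Hecke r} (hc : IsKLElement v c) :
    ∃ Q : W r → Polynomial ℤ, Q (s * v) = 1 ∧ (∀ y, ¬ bruhatLE y (s * v) → Q y = 0) ∧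
      (∀ y, bruhatLE y (s * v) → 2 * (Q y).natDegree + len y ≤ len (s * v)) ∧
      (∀ y, bruhatLE y (s * v) → len y < len (s * y) →
        2 * (Q y).natDegree + len y + 1 ≤ len (s * v)) ∧
      ∀ y, coeff y (mulC s c) =
        tpow (-(len (s * v) : ℤ)) * Polynomial.aeval (tpow 2) (Q y) := by
  obtain ⟨-, P, h1, h2, h3, h4⟩ := isKLElement_iff.1 hc
  have hl := len_simple_mul hs v
  have hss := simple_mul_cancel_left hs
  have hvs : ¬ bruhatLE (s * v) v := fun h => absurd (bruhatLE.len_le h) (by omega)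
  have hP : ∀ y, P y = 0 ∨ (y = v ∧ P y = 1) ∨
      (2 * (P y).natDegree + len y + 1 ≤ len v) := by
    intro y
    by_cases hy : bruhatLE y v
    · by_cases hyv : y = v
      · exact Or.inr (Or.inl ⟨hyv, hyv ▸ h1⟩)
      · exact Or.inr (Or.inr (h3 y hy hyv))
    · exact Or.inl (h2 y hy)
  have hX : ∀ p : Polynomial ℤ, (Polynomial.X * p).natDegree ≤ 1 + p.natDegree := fun p =>
    Polynomial.natDegree_mul_le.trans (by rw [Polynomial.natDegree_X])
  have hadd : ∀ p p' : Polynomial ℤ, ∀ d : ℕ, p.natDegree ≤ d → p'.natDegree ≤ d →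
    (p + p').natDegree ≤ d := fun p p' d h h' => Polynomial.natDegree_add_le_of_degree_le h h'
  -- Here the strict bound survives. The term `P v = 1` fits exactly at `y = v`, and the factor `X`
  -- could only meet it if `y = s * v`, which is excluded.
  have up : ∀ y, bruhatLE y (s * v) → len y < len (s * y) →
      2 * (P y + Polynomial.X * P (s * y)).natDegree + len y + 1 ≤ len (s * v) := by
    intro y hy hys
    have hly := len_simple_mul hs y
    have hy0 := bruhatLE.eq_or_len_lt hy
    have hne : y ≠ s * v := by rintro rfl; rw [hss] at hys; omega
    have hb : (P y + Polynomial.X * P (s * y)).natDegree ≤ (len (s * v) - len y - 1) / 2 := by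
      refine hadd _ _ _ ?_ ?_
      · rcases hP y with h | ⟨-, h⟩ | h
        · rw [h]; simp
        · rw [h]; simp
        · omega
      · rcases hP (s * y) with h | ⟨h, -⟩ | h
        · rw [h]; simp
        · exact absurd (by rw [← h, hss]) hne
        · have := hX (P (s * y)); omega
    have := hy0.resolve_left hne
    omega
  -- Here the factor `X` may raise the degree to exactly half the difference of the lengths. These
  -- are the terms to be corrected afterwards.
  have down : ∀ y, bruhatLE y (s * v) → ¬ len y < len (s * y) →
      2 * (P (s * y) + Polynomial.X * P y).natDegree + len y ≤ len (s * v) := by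
    intro y hy hys
    have hly := len_simple_mul hs y
    have hy0 := bruhatLE.len_le hy
    have hne : y ≠ v := by rintro rfl; omega
    have hb : (P (s * y) + Polynomial.X * P y).natDegree ≤ (len (s * v) - len y) / 2 := by
      refine hadd _ _ _ ?_ ?_
      · rcases hP (s * y) with h | ⟨-, h⟩ | h
        · rw [h]; simp
        · rw [h]; simp
        · omega
      · rcases hP y with h | ⟨h, -⟩ | h
        · rw [h]; simp
        · exact absurd h hne
        · have := hX (P y); omega
    omega
  refine ⟨fun y => if len y < len (s * y) then P y + Polynomial.X * P (s * y)
    else P (s * y) + Polynomial.X * P y, ?_, fun y hy => ?_, fun y hy => ?_, fun y hy hys => ?_,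
    fun y => ?_⟩
  · simp only [hss]
    rw [if_neg (by omega), h1, h2 _ hvs, mul_zero, add_zero]
  · have hy1 : ¬ bruhatLE y v := fun h => hy
      (Relation.ReflTransGen.trans h (bruhatLE_simple_mul hs hsv))
    have hy2 : ¬ bruhatLE (s * y) v := fun h => hy (by
      have := bruhatLE.simple_mul_simple_mul hs hsv h
      rwa [hss] at this)
    simp only [h2 _ hy1, h2 _ hy2, mul_zero, add_zero, ite_self]
  · dsimp only
    split_ifs with h
    · have := up y hy h; omega
    · exact down y hy h
  · dsimp only
    rw [if_pos hys]; exact up y hy hys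
  · dsimp only
    rw [coeff_mulC hs, h4, h4]
    have e : tpow (-(len (s * v) : ℤ)) = tpow (-1) * tpow (-(len v : ℤ)) := by
      rw [← tpow_add]; congr 1; omega
    rw [e]
    split_ifs <;> simp only [map_add, map_mul, Polynomial.aeval_X] <;> ring

/-- The element is `C_s C_{s w}` minus integer multiples of the `C_y` for which the degree bound
fails. Such `y` have `s` as a left descent, so by induction every term is an eigenvector of `T_s`,
and so is the result. -/
lemma exists_isKLElement_of_descent [NeZero r] {s w : W r} (hs : s ∈ simpleReflections r)
    (hw : len (s * w) < len w)
    (ih : ∀ y : W r, len y < len w → (∃ c, IsKLElement y c) ∧ ∀ u ∈ simpleReflections r,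
      len (u * y) < len y → ∀ c, IsKLElement y c → heckeT u * c = (tpow 2 : Laur) • c) :
    ∃ c, IsKLElement w c ∧ heckeT s * c = (tpow 2 : Laur) • c := by
  classical
  have hss := simple_mul_cancel_left hs
  obtain ⟨c₀, hc₀⟩ := (ih (s * w) hw).1
  obtain ⟨Q, q1, q2, q3, q4, q5⟩ := exists_poly_mulC hs (by rwa [hss]) hc₀
  rw [hss] at q1 q2 q3 q4 q5
  have hlt : ∀ y, bruhatLE y w → y ≠ w → len y < len w := fun y hy hne =>
    (bruhatLE.eq_or_len_lt hy).resolve_left hne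
  -- The elements to subtract
  have hex : ∀ y, ∃ c : Hecke r, ∃ P : W r → Polynomial ℤ, bruhatLE y w → y ≠ w →
      IsKLElement y c ∧ P y = 1 ∧ (∀ z, ¬ bruhatLE z y → P z = 0) ∧
      (∀ z, bruhatLE z y → z ≠ y → 2 * (P z).natDegree + len z + 1 ≤ len y) ∧
      ∀ z, coeff z c = tpow (-(len y : ℤ)) * Polynomial.aeval (tpow 2) (P z) := by
    intro y
    by_cases h : bruhatLE y w ∧ y ≠ w
    · obtain ⟨c, hc⟩ := (ih y (hlt y h.1 h.2)).1
      obtain ⟨-, P, hP⟩ := isKLElement_iff.1 hc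
      exact ⟨c, P, fun _ _ => ⟨hc, hP⟩⟩
    · exact ⟨0, 0, fun h1 h2 => absurd ⟨h1, h2⟩ h⟩
  choose c P hcP using hex
  have hfin : {y | bruhatLE y w ∧ y ≠ w}.Finite := (finite_bruhatLE w).subset fun y hy => hy.1
  set Y := hfin.toFinset with hY
  have hmem : ∀ y, y ∈ Y ↔ bruhatLE y w ∧ y ≠ w := fun y => by
    rw [hY, Set.Finite.mem_toFinset]; rfl
  -- The coefficient of `Q y` in the only forbidden degree; it exists only when the lengths have the
  -- same parity.
  let a : W r → ℤ := fun y => if (len w - len y) % 2 = 0 then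
    (Q y).coeff ((len w - len y) / 2) else 0
  -- If `s` lengthens `y`, the strict bound `q4` makes the forbidden coefficient zero.
  have ha : ∀ y ∈ Y, a y ≠ 0 → len (s * y) < len y := by
    intro y hy hay
    rw [hmem] at hy
    by_contra hc
    have hly := len_simple_mul hs y
    have h1 := q4 y hy.1 (by omega)
    have h2 := hlt y hy.1 hy.2
    apply hay
    simp only [a]
    split_ifs with h
    · exact Polynomial.coeff_eq_zero_of_natDegree_lt (by omega)
    · rfl
  refine ⟨mulC s c₀ - ∑ y ∈ Y, (a y : Laur) • c y, isKLElement_iff.2 ⟨?_,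
    -- The power of `X` converts the normalization `t ^ (-len y)` into `t ^ (-len w)`. For odd
    -- difference the rounding is harmless because `a y = 0`.
    fun z => Q z - ∑ y ∈ Y, Polynomial.C (a y) * (Polynomial.X ^ ((len w - len y) / 2) * P y z),
    ?_, fun z hz => ?_, fun z hz hzw => ?_, fun z => ?_⟩, ?_⟩
  · rw [heckeBar_sub, heckeBar_mulC hs hc₀.1, heckeBar_sum]
    congr 1
    refine Finset.sum_congr rfl fun y hy => ?_
    rw [hmem] at hy
    rw [heckeBar_smul, (hcP y hy.1 hy.2).1.1, map_intCast]
  · dsimp only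
    rw [q1, Finset.sum_eq_zero, sub_zero]
    intro y hy
    rw [hmem] at hy
    have h1 := hlt y hy.1 hy.2
    rw [(hcP y hy.1 hy.2).2.2.1 w (fun h => absurd (bruhatLE.len_le h) (by omega)), mul_zero,
      mul_zero]
  · dsimp only
    rw [q2 z hz, Finset.sum_eq_zero, sub_zero]
    intro y hy
    rw [hmem] at hy
    rw [(hcP y hy.1 hy.2).2.2.1 z (fun h => hz (Relation.ReflTransGen.trans h hy.1)), mul_zero,
      mul_zero]
  · dsimp only
    have hzY : z ∈ Y := (hmem z).2 ⟨hz, hzw⟩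
    have hlz := hlt z hz hzw
    have hlt' : ∀ p : Polynomial ℤ, p.natDegree ≤ (len w - len z - 1) / 2 →
        2 * p.natDegree + len z + 1 ≤ len w := fun p hp => by omega
    apply hlt'
    -- The term of index `z`, where `P z z = 1`, removes the forbidden coefficient of `Q z`. All
    -- other terms obey the strict bound because of the bound for `P y z`.
    rw [← Finset.add_sum_erase Y _ hzY, ← sub_sub]
    refine (Polynomial.natDegree_sub_le _ _).trans (max_le ?_ ?_)
    · rw [(hcP z hz hzw).2.1, mul_one]
      have hq := q3 z hz
      rw [Polynomial.natDegree_le_iff_coeff_eq_zero]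
      intro N hN
      rw [Polynomial.coeff_sub, Polynomial.coeff_C_mul, Polynomial.coeff_X_pow]
      by_cases hN' : N = (len w - len z) / 2
      · have hpar : (len w - len z) % 2 = 0 := by omega
        rw [if_pos hN', mul_one, hN']
        simp only [a, if_pos hpar, sub_self]
      · rw [if_neg hN', mul_zero, sub_zero]
        exact Polynomial.coeff_eq_zero_of_natDegree_lt (by omega)
    · refine Polynomial.natDegree_sum_le_of_forall_le _ _ fun y hy => ?_
      obtain ⟨hyz, hy⟩ := Finset.mem_erase.1 hy
      rw [hmem] at hy
      obtain ⟨-, -, p2, p3, -⟩ := hcP y hy.1 hy.2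
      by_cases hzy : bruhatLE z y
      · have h1 := p3 z hzy hyz.symm
        have h2 := hlt y hy.1 hy.2
        have h3 := Polynomial.natDegree_C_mul_le (a y)
          (Polynomial.X ^ ((len w - len y) / 2) * P y z)
        have h4 := Polynomial.natDegree_mul_le
          (p := (Polynomial.X : Polynomial ℤ) ^ ((len w - len y) / 2)) (q := P y z)
        rw [Polynomial.natDegree_X_pow] at h4
        omega
      · rw [p2 z hzy, mul_zero, mul_zero, Polynomial.natDegree_zero]
        exact Nat.zero_le _
  · rw [map_sub, q5, map_sum, map_sub, map_sum, mul_sub, Finset.mul_sum]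
    congr 1
    refine Finset.sum_congr rfl fun y hy => ?_
    rw [hmem] at hy
    rw [map_smul, (hcP y hy.1 hy.2).2.2.2.2 z, smul_eq_mul, map_mul, map_mul, map_pow,
      Polynomial.aeval_X, Polynomial.aeval_C, eq_intCast, tpow_pow]
    by_cases hpar : (len w - len y) % 2 = 0
    · have h2 := hlt y hy.1 hy.2
      have e : tpow (-(len y : ℤ)) = tpow (-(len w : ℤ)) *
          tpow (((len w - len y) / 2 : ℕ) * 2) := by
        rw [← tpow_add]; congr 1; omega
      rw [e]; ring
    · simp only [a, if_neg hpar, Int.cast_zero, zero_mul, mul_zero]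
  · rw [mul_sub, simple_mul_mulC hs, smul_sub, Finset.mul_sum, Finset.smul_sum]
    congr 1
    refine Finset.sum_congr rfl fun y hy => ?_
    have hy' := (hmem y).1 hy
    by_cases hay : a y = 0
    · rw [hay, Int.cast_zero, zero_smul, mul_zero, smul_zero]
    · rw [mul_smul_comm, (ih y (hlt y hy'.1 hy'.2)).2 s hs (ha y hy hay) _
        (hcP y hy'.1 hy'.2).1, smul_comm]

/-- The two claims are proved in one induction, because the construction subtracts shorter
eigenvectors. Uniqueness transfers the eigenvalue property from the element built with a given
descent to any other candidate. -/
lemma exists_isKLElement_and_mul [NeZero r] (w : W r) :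
    (∃ c, IsKLElement w c) ∧ ∀ s ∈ simpleReflections r, len (s * w) < len w →
      ∀ c, IsKLElement w c → heckeT s * c = (tpow 2 : Laur) • c := by
  induction hn : len w using Nat.strong_induction_on generalizing w with
  | _ n ih =>
  have key : ∀ s ∈ simpleReflections r, len (s * w) < len w →
      ∃ c, IsKLElement w c ∧ heckeT s * c = (tpow 2 : Laur) • c := fun s hs hsw =>
    exists_isKLElement_of_descent hs hsw fun y hy => ih _ (hn ▸ hy) y rfl
  refine ⟨?_, fun s hs hsw c hc => ?_⟩
  · by_cases h0 : len w = 0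
    · exact ⟨_, isKLElement_of_len_eq_zero h0⟩
    · obtain ⟨s, hs, h⟩ := exists_left_descent h0
      obtain ⟨c, hc, -⟩ := key s hs (by omega)
      exact ⟨c, hc⟩
  · obtain ⟨c', hc', h⟩ := key s hs (hn ▸ hsw)
    rw [hc.unique hc', h]

lemma existsUnique_isKLElement [NeZero r] (w : W r) : ∃! c : Hecke r, IsKLElement w c := by
  obtain ⟨c, hc⟩ := (exists_isKLElement_and_mul w).1
  exact ⟨c, hc, fun _ h => h.unique hc⟩

lemma isKLElement_klC [NeZero r] (w : W r) : IsKLElement w (klC w) :=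
  Classical.epsilon_spec (exists_isKLElement_and_mul w).1

lemma simple_mul_klC [NeZero r] {s w : W r} (hs : s ∈ simpleReflections r)
    (h : len (s * w) < len w) : heckeT s * klC w = (tpow 2 : Laur) • klC w :=
  (exists_isKLElement_and_mul w).2 s hs h _ (isKLElement_klC w)

lemma heckeBar_anti [NeZero r] (x : Hecke r) : heckeBar (anti x) = anti (heckeBar x) := by
  have hinv : ∀ w : W r, Ring.inverse (heckeT w) = anti (Ring.inverse (heckeT w⁻¹)) := by
    intro w
    have hu := isUnit_heckeT w
    apply hu.mul_left_cancel
    rw [Ring.mul_inverse_cancel _ hu]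
    have : heckeT w = anti (heckeT w⁻¹ : Hecke r) := by rw [anti_heckeT, inv_inv]
    rw [this, ← anti_mul, Ring.inverse_mul_cancel _ (isUnit_heckeT _), anti_one]
  induction x using hecke_induction with
  | zero => rw [anti_zero, heckeBar_zero, anti_zero]
  | add x y hx hy => rw [anti_add, heckeBar_add, heckeBar_add, anti_add, hx, hy]
  | single a w =>
    rw [anti_smul, heckeBar_smul, heckeBar_smul, anti_smul, anti_heckeT, heckeBar_heckeT,
      heckeBar_heckeT, inv_inv, hinv w]

/-- The anti-automorphism commutes with the bar map, and inversion preserves length and Bruhat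
order, so uniqueness applies. This transports every statement about left descents to the right. -/
lemma anti_klC [NeZero r] (w : W r) : anti (klC w : Hecke r) = klC w⁻¹ := by
  refine _root_.IsKLElement.unique (w := w⁻¹) ?_ (isKLElement_klC _)
  obtain ⟨h0, P, h1, h2, h3, h4⟩ := isKLElement_iff.1 (isKLElement_klC w)
  refine isKLElement_iff.2 ⟨by rw [heckeBar_anti, h0], fun y => P y⁻¹, by simpa using h1,
    fun y hy => h2 _ fun h => hy (by simpa using bruhatLE.inv h), fun y hy hne => ?_, fun y => ?_⟩
  · have := h3 y⁻¹ (by simpa using bruhatLE.inv hy) (fun h => hne (by rw [← h, inv_inv]))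
    simpa using this
  · rw [coeff_anti, h4, len_inv]

lemma klC_mul_simple [NeZero r] {s w : W r} (hs : s ∈ simpleReflections r)
    (h : len (w * s) < len w) : klC w * heckeT s = (tpow 2 : Laur) • klC w := by
  rw [mul_simple_eq_smul_iff_anti hs, anti_klC]
  refine simple_mul_klC hs ?_
  rwa [len_simple_mul_eq hs, inv_inv, len_inv]

/-! ### The Kazhdan-Lusztig basis -/

lemma coeff_klC_self [NeZero r] (w : W r) : coeff w (klC w) = tpow (-(len w : ℤ)) :=
  (isKLElement_klC w).coeff_self

lemma coeff_klC_eq_zero [NeZero r] {w y : W r} (hne : y ≠ w) (h : len w ≤ len y) :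
    coeff y (klC w) = 0 := by
  by_contra hc
  have := bruhatLE.eq_or_len_lt ((isKLElement_klC w).le_of_coeff_ne_zero hc)
  rcases this with h' | h'
  · exact hne h'
  · omega

/-- The coefficient, in a combination of Kazhdan-Lusztig elements, of `T_w` for `w` of maximal
length. -/
lemma coeff_linearCombination_klC [NeZero r] (f : W r →₀ Laur) (w : W r)
    (h : ∀ y, len w < len y → f y = 0) :
    coeff w (Finsupp.linearCombination Laur klC f) = f w * tpow (-(len w : ℤ)) := by
  rw [Finsupp.linearCombination_apply, Finsupp.sum, map_sum, Finset.sum_eq_single w]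
  · rw [map_smul, coeff_klC_self, smul_eq_mul]
  · intro y _ hy
    by_cases hlt : len w < len y
    · rw [h y hlt, zero_smul, map_zero]
    · rw [map_smul, coeff_klC_eq_zero hy.symm (by omega), smul_zero]
  · intro hw
    rw [Finsupp.notMem_support_iff.1 hw, zero_smul, map_zero]

lemma exists_max_len_ne_zero {f : W r →₀ Laur} (hf : f ≠ 0) :
    ∃ w, f w ≠ 0 ∧ ∀ y, len w < len y → f y = 0 := by
  obtain ⟨w, hw, hmax⟩ := Finset.exists_max_image f.support len (Finsupp.support_nonempty_iff.2 hf)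
  refine ⟨w, Finsupp.mem_support_iff.1 hw, fun y hy => ?_⟩
  by_contra h
  exact absurd (hmax y (Finsupp.mem_support_iff.2 h)) (by omega)

lemma linearIndependent_klC [NeZero r] : LinearIndependent Laur (klC (r := r)) := by
  rw [linearIndependent_iff]
  intro f hf
  by_contra hne
  obtain ⟨w, hw, hmax⟩ := exists_max_len_ne_zero hne
  have h := coeff_linearCombination_klC f w hmax
  rw [hf, map_zero] at h
  exact mul_ne_zero hw (tpow_ne_zero _) h.symm

/-- The expansion of `C_w` is triangular for length, and its diagonal entry is a unit. -/
lemma span_klC [NeZero r] : Submodule.span Laur (Set.range (klC (r := r))) = ⊤ := by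
  have key : ∀ w : W r, heckeT w ∈ Submodule.span Laur (Set.range (klC (r := r))) := by
    intro w
    induction hn : len w using Nat.strong_induction_on generalizing w with
    | _ n ih =>
    have h1 : klC w - tpow (-(len w : ℤ)) • heckeT w ∈
        Submodule.span Laur (Set.range (klC (r := r))) := by
      have h2 : klC w - tpow (-(len w : ℤ)) • heckeT w ∈
          Submodule.span Laur (heckeT '' {y : W r | len y < len w}) := by
        classical
        have : ⇑(basisT r) = heckeT := funext basisT_apply
        rw [← this, Module.Basis.mem_span_image]
        intro y hy
        have hy' : coeff y (klC w - tpow (-(len w : ℤ)) • heckeT w) ≠ 0 := by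
          rw [← basisT_apply]; exact Finsupp.mem_support_iff.1 hy
        rw [map_sub, map_smul, coeff_heckeT] at hy'
        by_contra hc
        have hc' : len w ≤ len y := not_lt.1 hc
        by_cases hyw : y = w
        · rw [hyw, coeff_klC_self] at hy'
          simp at hy'
        · rw [if_neg (Ne.symm hyw), coeff_klC_eq_zero hyw hc'] at hy'
          simp at hy'
      refine Submodule.span_le.2 ?_ h2
      rintro _ ⟨y, hy, rfl⟩
      exact ih _ (hn ▸ hy) y rfl
    have h3 := Submodule.sub_mem _ (Submodule.subset_span (Set.mem_range_self w)) h1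
    rw [sub_sub_cancel] at h3
    have h4 := Submodule.smul_mem _ (tpow (len w : ℤ)) h3
    rwa [smul_smul, tpow_mul_neg, one_smul] at h4
  rw [eq_top_iff, ← span_heckeT, Submodule.span_le]
  rintro _ ⟨w, rfl⟩
  exact key w

lemma isBasisFamily_klC [NeZero r] : IsBasisFamily (klC (r := r)) :=
  ⟨linearIndependent_klC, span_klC⟩

variable {n : ℕ}

/-! ### Young subgroups -/

lemma youngGenerators_subset (lam : Comp n r) :
    youngGenerators lam ⊆ simpleReflections r := by
  rintro s ⟨i, h1, h2, -, hs⟩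
  exact ⟨i, by omega, by omega, hs⟩

lemma mem_young_of_mem {lam : Comp n r} {s : W r} (hs : s ∈ youngGenerators lam) :
    s ∈ young lam := Subgroup.subset_closure hs

/-- The generators omit `s_0`, so they permute the window from `1` to `r`. Hence `W_λ` is finite and
contains no nontrivial shift. -/
lemma apply_mem_Icc_iff {lam : Comp n r} {w : W r} (hw : w ∈ young lam) (j : ℤ) :
    w.1 j ∈ Set.Icc (1 : ℤ) r ↔ j ∈ Set.Icc (1 : ℤ) r := by
  induction hw using Subgroup.closure_induction generalizing j with
  | mem s hs =>
    have key : ∀ j, j ∈ Set.Icc (1 : ℤ) r → s.1 j ∈ Set.Icc (1 : ℤ) r := by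
      obtain ⟨i, h1, h2, -, hs⟩ := hs
      have hs := isTransposition_of_isSimpleReflection hs
      intro j ⟨hj1, hj2⟩
      have hsmall : ∀ k : ℤ, 1 ≤ k → k ≤ r → j ≡ k [ZMOD r] → j = k := by
        intro k hk1 hk2 h
        obtain ⟨m, hm⟩ := h.dvd
        have hm1 : m < 1 := by
          by_contra hc
          have : (r : ℤ) * 1 ≤ r * m := mul_le_mul_of_nonneg_left (by omega) (by omega)
          omega
        have hm2 : -1 < m := by
          by_contra hc
          have : (r : ℤ) * m ≤ r * (-1) := mul_le_mul_of_nonneg_left (by omega) (by omega)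
          omega
        have : m = 0 := by omega
        rw [this, mul_zero] at hm
        omega
      by_cases ha : j ≡ i [ZMOD r]
      · rw [hsmall i (by omega) (by omega) ha, hs.2.1]
        constructor <;> omega
      by_cases hb : j ≡ i + 1 [ZMOD r]
      · rw [hsmall (i + 1) (by omega) (by omega) hb, hs.2.2.1]
        constructor <;> omega
      · rw [hs.2.2.2 j ha hb]; exact ⟨hj1, hj2⟩
    refine ⟨fun h => ?_, key j⟩
    have hss : s * s = 1 := by
      obtain ⟨i, -, -, -, hs⟩ := hs
      exact (isTransposition_of_isSimpleReflection hs).mul_self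
    have := key _ h
    rwa [← mul_apply, hss, one_apply] at this
  | one => rfl
  | mul x y _ _ hx hy => rw [mul_apply, hx, hy]
  | inv x _ hx => rw [← hx, apply_inv_self]

lemma eq_of_apply_eq_on_Icc [NeZero r] {v w : W r}
    (h : ∀ j ∈ Set.Icc (1 : ℤ) r, v.1 j = w.1 j) : v = w := by
  have hr : (0 : ℤ) < r := by exact_mod_cast Nat.pos_of_ne_zero (NeZero.ne r)
  refine ext_apply fun j => ?_
  have h1 := Int.emod_nonneg (j - 1) hr.ne'
  have h2 := Int.emod_lt_of_pos (j - 1) hr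
  have h3 := Int.emod_add_mul_ediv (j - 1) r
  have h4 : j = ((j - 1) % r + 1) + r * ((j - 1) / r) := by linarith
  rw [h4, apply_add_mul, apply_add_mul, h _ ⟨by omega, by omega⟩]

lemma finite_young [NeZero r] (lam : Comp n r) : (young lam : Set (W r)).Finite := by
  let f : young lam → (Set.Icc (1 : ℤ) r → Set.Icc (1 : ℤ) r) :=
    fun w j => ⟨w.1.1 j, (apply_mem_Icc_iff w.2 j).2 j.2⟩
  have hf : Function.Injective f := fun v w h => by
    refine Subtype.ext (eq_of_apply_eq_on_Icc fun j hj => ?_)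
    exact congrArg Subtype.val (congrFun h ⟨j, hj⟩)
  exact Set.finite_coe_iff.1 (Finite.of_injective f hf)

lemma eq_one_of_len_eq_zero [NeZero r] {lam : Comp n r} {w : W r} (hw : w ∈ young lam)
    (h : len w = 0) : w = 1 := by
  have hr : (0 : ℤ) < r := by exact_mod_cast Nat.pos_of_ne_zero (NeZero.ne r)
  have h1 := eq_rho_pow_of_len_eq_zero h
  have h2 : ∀ j, w.1 j = j + w.1 0 := fun j => by conv_lhs => rw [h1, rho_pow_apply]
  have h3 := (apply_mem_Icc_iff hw 1).2 ⟨le_rfl, by omega⟩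
  have h4 := (apply_mem_Icc_iff hw r).2 ⟨by omega, le_rfl⟩
  rw [h2] at h3 h4
  have : w.1 0 = 0 := by
    have := h3.1; have := h4.2; omega
  rw [h1, this, zpow_zero]

/-- `i` and `j` are in the same block: all simple reflections between them are in the Young
subgroup. -/
def SameBlock (lam : Comp n r) (i j : ℤ) : Prop :=
  ∀ k, min i j ≤ k → k < max i j → ∃ s ∈ youngGenerators lam, IsSimple k s

lemma SameBlock.symm {lam : Comp n r} {i j : ℤ} (h : SameBlock lam i j) : SameBlock lam j i := by
  intro k h1 h2
  exact h k (by omega) (by omega)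

lemma SameBlock.trans {lam : Comp n r} {i j l : ℤ} (h : SameBlock lam i j)
    (h' : SameBlock lam j l) : SameBlock lam i l := by
  intro k h1 h2
  by_cases hk : min i j ≤ k ∧ k < max i j
  · exact h k hk.1 hk.2
  · exact h' k (by omega) (by omega)

lemma SameBlock.refl (lam : Comp n r) (i : ℤ) : SameBlock lam i i := by
  intro k h1 h2; omega

lemma SameBlock.of_simple {lam : Comp n r} {k : ℤ} {s : W r} (hs : s ∈ youngGenerators lam)
    (hk : IsSimple k s) : SameBlock lam k (k + 1) := by
  intro l h1 h2
  obtain rfl : l = k := by omega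
  exact ⟨s, hs, hk⟩

lemma sameBlock_apply {lam : Comp n r} {b : W r} (hb : b ∈ young lam) (j : ℤ) :
    SameBlock lam (b.1 j) j := by
  induction hb using Subgroup.closure_induction generalizing j with
  | mem s hs =>
    obtain ⟨i, -, -, -, hi⟩ := id hs
    have hi := isTransposition_of_isSimpleReflection hi
    by_cases ha : j ≡ i [ZMOD r]
    · have h1 : s.1 j = j + 1 := by rw [hi.apply_left ha]; ring
      rw [h1]
      exact (SameBlock.of_simple hs (hi.congr ha (by ring))).symm
    by_cases hb : j ≡ i + 1 [ZMOD r]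
    · have h1 : s.1 j = j - 1 := by rw [hi.apply_right hb]; ring
      have h2 : j - 1 ≡ i [ZMOD r] := by simpa using hb.sub_right 1
      rw [h1]
      simpa using SameBlock.of_simple (k := j - 1) hs (hi.congr h2 (by ring))
    · rw [hi.2.2.2 j ha hb]; exact SameBlock.refl _ _
  | one => exact SameBlock.refl _ _
  | mul x y _ _ hx hy => exact (hx _).trans (hy j)
  | inv x _ hx => simpa [apply_inv_self] using (hx ((x⁻¹).1 j)).symm

/-- A missing generator at some `k` between `p` and `q` is a barrier that elements of `W_λ` cannot
cross. -/
lemma lt_of_not_sameBlock {lam : Comp n r} {p q p' q' : ℤ} (hpq : p < q)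
    (h : ¬ SameBlock lam p q) (hp : SameBlock lam p' p) (hq : SameBlock lam q' q) : p' < q' := by
  unfold SameBlock at h
  push Not at h
  obtain ⟨k, h1, h2, h3⟩ := h
  by_contra hc
  rcases le_or_gt p' k with h4 | h4
  · obtain ⟨s, hs, hk⟩ := hq k (by omega) (by omega)
    exact h3 s hs hk
  · obtain ⟨s, hs, hk⟩ := hp k (by omega) (by omega)
    exact h3 s hs hk

lemma lt_of_sameBlock [NeZero r] {lam : Comp n r} {x : W r}
    (hx : ∀ t ∈ youngGenerators lam, len x < len (x * t)) {i j : ℤ} (hij : i < j)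
    (h : SameBlock lam i j) : x.1 i < x.1 j := by
  have key : ∀ m : ℕ, ∀ j : ℤ, j = i + 1 + m → SameBlock lam i j → x.1 i < x.1 j := by
    intro m
    induction m with
    | zero =>
      intro j hj h
      obtain rfl : j = i + 1 := by rw [hj]; simp
      obtain ⟨s, hs, hk⟩ := h i (by omega) (by omega)
      exact (len_lt_mul_iff hk).1 (hx s hs)
    | succ m ih =>
      intro j hj h
      push_cast at hj
      have h1 := ih (j - 1) (by omega) (fun k h1 h2 => h k (by omega) (by omega))
      obtain ⟨s, hs, hk⟩ := h (j - 1) (by omega) (by omega)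
      have h2 := (len_lt_mul_iff hk).1 (hx s hs)
      rw [sub_add_cancel] at h2
      exact h1.trans h2
  exact key (j - i - 1).toNat j (by omega) h

/-- An element of `W_λ` preserves the order between different blocks, so every descent lies inside a
block. -/
lemma exists_young_right_descent [NeZero r] {lam : Comp n r} {b : W r} (hb : b ∈ young lam)
    (h : len b ≠ 0) : ∃ t ∈ youngGenerators lam, len (b * t) + 1 = len b := by
  obtain ⟨s, hs, hlen⟩ := exists_right_descent h
  obtain ⟨k, hk⟩ := mem_simpleReflections.1 hs
  refine ⟨s, ?_, hlen⟩
  have h1 : ¬ b.1 k < b.1 (k + 1) := by rw [← len_lt_mul_iff hk]; omega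
  have h2 : SameBlock lam k (k + 1) := by
    by_contra hc
    exact h1 (lt_of_not_sameBlock (by omega) hc (sameBlock_apply hb _) (sameBlock_apply hb _))
  obtain ⟨t, ht, htk⟩ := h2 k (by omega) (by omega)
  rwa [hk.unique htk]

/-- `x` is minimal in `x W_μ`. -/
def IsRightMin (mu : Comp n r) (x : W r) : Prop := ∀ t ∈ youngGenerators mu, len x < len (x * t)

/-- Minimality makes `x` increasing on each block, and `b` stays inside blocks. So an ascent of an
element of `W_μ` remains an ascent after multiplication by `x`. -/
lemma IsRightMin.len_mul [NeZero r] {mu : Comp n r} {x : W r} (hx : IsRightMin mu x) {b : W r}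
    (hb : b ∈ young mu) : len (x * b) = len x + len b := by
  induction hn : len b generalizing b with
  | zero => rw [len_mul_of_len_eq_zero' hn, add_zero]
  | succ m ih =>
    obtain ⟨t, ht, h⟩ := exists_young_right_descent hb (by omega)
    have hts := youngGenerators_subset mu ht
    have hbt : b * t ∈ young mu := mul_mem hb (mem_young_of_mem ht)
    have h1 := ih hbt (by omega)
    obtain ⟨k, hk⟩ := mem_simpleReflections.1 hts
    have h2 : len (b * t) < len (b * t * t) := by rw [simple_mul_cancel_right hts]; omega
    rw [len_lt_mul_iff hk] at h2
    have hblk : SameBlock mu ((b * t).1 k) ((b * t).1 (k + 1)) :=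
      (sameBlock_apply hbt k).trans ((SameBlock.of_simple ht hk).trans
        (sameBlock_apply hbt (k + 1)).symm)
    have h3 := lt_of_sameBlock hx h2 hblk
    rw [← mul_apply, ← mul_apply] at h3
    have h4 := len_mul_of_lt hk h3
    rw [← mul_assoc, simple_mul_cancel_right hts, mul_assoc, h1] at h4
    omega

lemma IsRightMin.eq_of_mul_eq [NeZero r] {mu : Comp n r} {x y : W r} (hx : IsRightMin mu x)
    (hy : IsRightMin mu y) {b : W r} (hb : b ∈ young mu) (h : x = y * b) : x = y := by
  have h1 := hy.len_mul hb
  have h2 := hx.len_mul (inv_mem hb)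
  rw [← h] at h1
  rw [h, mul_inv_cancel_right, ← h, len_inv] at h2
  rw [h, eq_one_of_len_eq_zero hb (by omega), mul_one]

/-- The positions of `i` and `i + 1` in `x` can only be reversed by `b` within one block. There `x`
is increasing and takes consecutive values at them, so they are adjacent and exchanged by a
generator `t` of `W_μ`. -/
lemma IsRightMin.exists_simple_mul_eq [NeZero r] {mu : Comp n r} {x : W r}
    (hx : IsRightMin mu x) {s b : W r} (hs : s ∈ simpleReflections r) (hb : b ∈ young mu)
    (h1 : len x < len (s * x)) (h2 : len (s * (x * b)) < len (x * b)) :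
    ∃ t ∈ youngGenerators mu, s * x = x * t := by
  obtain ⟨i, hi⟩ := mem_simpleReflections.1 hs
  rw [len_lt_simple_mul_iff hi] at h1
  have h3 := not_lt.2 h2.le
  rw [len_lt_simple_mul_iff hi, mul_inv_rev, mul_apply, mul_apply] at h3
  have hblk : SameBlock mu ((x⁻¹).1 i) ((x⁻¹).1 (i + 1)) := by
    by_contra hc
    exact h3 (lt_of_not_sameBlock h1 hc (sameBlock_apply (inv_mem hb) _)
      (sameBlock_apply (inv_mem hb) _))
  have hq : (x⁻¹).1 (i + 1) = (x⁻¹).1 i + 1 := by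
    by_contra hc
    have hlt : (x⁻¹).1 i < (x⁻¹).1 i + 1 := by omega
    have h4 := lt_of_sameBlock hx (i := (x⁻¹).1 i) (j := (x⁻¹).1 i + 1) hlt
      (fun k hk1 hk2 => hblk k (by omega) (by omega))
    have h5 := lt_of_sameBlock hx (i := (x⁻¹).1 i + 1) (j := (x⁻¹).1 (i + 1)) (by omega)
      (fun k hk1 hk2 => hblk k (by omega) (by omega))
    rw [apply_inv_self] at h4 h5
    omega
  obtain ⟨t, ht, hk⟩ := hblk ((x⁻¹).1 i) (by omega) (by omega)
  refine ⟨t, ht, ?_⟩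
  have h6 := hk.conj x
  rw [← hq, apply_inv_self, apply_inv_self] at h6
  rw [hi.unique h6, inv_mul_cancel_right]

lemma exists_isRightMin [NeZero r] (mu : Comp n r) (y : W r) :
    ∃ x, IsRightMin mu x ∧ ∃ b ∈ young mu, y = x * b := by
  obtain ⟨b, hb, hmin⟩ := Set.exists_min_image _ (fun b => len (y * b)) (finite_young mu)
    ⟨1, one_mem _⟩
  refine ⟨y * b, fun t ht => ?_, b⁻¹, inv_mem hb, by rw [mul_inv_cancel_right]⟩
  have h1 := hmin (b * t) (mul_mem hb (mem_young_of_mem ht))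
  have h2 := len_mul_simple (youngGenerators_subset mu ht) (y * b)
  rw [← mul_assoc] at h1
  omega

/-- `x` is minimal in `W_λ x W_μ`. -/
def IsMin (lam mu : Comp n r) (x : W r) : Prop :=
  (∀ s ∈ youngGenerators lam, len x < len (s * x)) ∧ IsRightMin mu x

lemma IsMin.isRightMin_inv [NeZero r] {lam mu : Comp n r} {x : W r} (hx : IsMin lam mu x) :
    IsRightMin lam x⁻¹ := fun s hs => by
  rw [← len_simple_mul_eq (youngGenerators_subset lam hs), len_inv]
  exact hx.1 s hs

lemma IsMin.len_mul [NeZero r] {lam mu : Comp n r} {x : W r} (hx : IsMin lam mu x) {a : W r}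
    (ha : a ∈ young lam) : len (a * x) = len a + len x := by
  have := hx.isRightMin_inv.len_mul (inv_mem ha)
  rw [← mul_inv_rev, len_inv, len_inv, len_inv] at this
  omega

/-- A left descent of `a` is cancelled on one side and, on the other, passes through `y` to become a
generator of `W_μ`. The induction is on the length of `a`. -/
lemma IsMin.eq_of_mul_eq [NeZero r] {lam mu : Comp n r} {x y : W r} (hx : IsMin lam mu x)
    (hy : IsMin lam mu y) {a b : W r} (ha : a ∈ young lam) (hb : b ∈ young mu)
    (h : a * x = y * b) : x = y := by
  induction hn : len a using Nat.strong_induction_on generalizing a b with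
  | _ m ih =>
  by_cases h0 : len a = 0
  · rw [eq_one_of_len_eq_zero ha h0, one_mul] at h
    exact hx.2.eq_of_mul_eq hy.2 hb h
  · obtain ⟨s, hs, h1⟩ := exists_young_right_descent (inv_mem ha) (by rwa [len_inv])
    have hss := youngGenerators_subset lam hs
    rw [← len_simple_mul_eq hss, len_inv] at h1
    have hsa : s * a ∈ young lam := mul_mem (mem_young_of_mem hs) ha
    have h2 := hx.len_mul hsa
    have h3 := hx.len_mul ha
    rw [mul_assoc, h] at h2
    rw [h] at h3
    obtain ⟨t, ht, h4⟩ := hy.2.exists_simple_mul_eq hss hb (hy.1 s hs) (by omega)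
    refine ih _ (by omega) hsa (mul_mem (mem_young_of_mem ht) hb) ?_ rfl
    rw [mul_assoc, h, ← mul_assoc, h4, mul_assoc]

/-! ### Double cosets -/

lemma mem_dcoset_self (lam mu : Comp n r) (w : W r) : w ∈ dcoset lam mu w :=
  ⟨1, one_mem _, 1, one_mem _, by simp⟩

lemma dcoset_eq_of_mem {lam mu : Comp n r} {w y : W r} (h : y ∈ dcoset lam mu w) :
    dcoset lam mu y = dcoset lam mu w := by
  obtain ⟨a, ha, b, hb, rfl⟩ := h
  ext z
  constructor
  · rintro ⟨a', ha', b', hb', rfl⟩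
    exact ⟨a' * a, mul_mem ha' ha, b * b', mul_mem hb hb', by group⟩
  · rintro ⟨a', ha', b', hb', rfl⟩
    exact ⟨a' * a⁻¹, mul_mem ha' (inv_mem ha), b⁻¹ * b', mul_mem (inv_mem hb) hb', by group⟩

lemma finite_dcoset [NeZero r] (lam mu : Comp n r) (w : W r) : (dcoset lam mu w).Finite := by
  refine (((finite_young lam).prod (finite_young mu)).image
    fun p : W r × W r => p.1 * w * p.2).subset ?_
  rintro y ⟨a, ha, b, hb, rfl⟩
  exact ⟨(a, b), ⟨ha, hb⟩, rfl⟩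

lemma simple_mul_mem_dcoset {lam mu : Comp n r} {s w y : W r} (hs : s ∈ youngGenerators lam)
    (h : y ∈ dcoset lam mu w) : s * y ∈ dcoset lam mu w := by
  obtain ⟨a, ha, b, hb, rfl⟩ := h
  exact ⟨s * a, mul_mem (mem_young_of_mem hs) ha, b, hb, by group⟩

lemma mul_simple_mem_dcoset {lam mu : Comp n r} {s w y : W r} (hs : s ∈ youngGenerators mu)
    (h : y ∈ dcoset lam mu w) : y * s ∈ dcoset lam mu w := by
  obtain ⟨a, ha, b, hb, rfl⟩ := h
  exact ⟨a, ha, b * s, mul_mem hb (mem_young_of_mem hs), by group⟩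

lemma isMin_of_mem_minReps [NeZero r] {lam mu : Comp n r} {w : W r} (h : w ∈ minReps lam mu) :
    IsMin lam mu w := by
  constructor
  · intro s hs
    have h1 := h _ (simple_mul_mem_dcoset hs (mem_dcoset_self lam mu w))
    have h2 := len_simple_mul (youngGenerators_subset lam hs) w
    omega
  · intro s hs
    have h1 := h _ (mul_simple_mem_dcoset hs (mem_dcoset_self lam mu w))
    have h2 := len_mul_simple (youngGenerators_subset mu hs) w
    omega

/-- A double coset has only one element of minimal length. -/
lemma minReps_eq_of_mem_dcoset [NeZero r] {lam mu : Comp n r} {w w' : W r}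
    (h : w ∈ minReps lam mu) (h' : w' ∈ minReps lam mu) (hmem : w ∈ dcoset lam mu w') :
    w = w' := by
  obtain ⟨a, ha, b, hb, hw⟩ := hmem
  refine (isMin_of_mem_minReps h).eq_of_mul_eq (isMin_of_mem_minReps h') (inv_mem ha) hb ?_
  rw [hw]; group

lemma exists_minReps [NeZero r] (lam mu : Comp n r) (y : W r) :
    ∃ w ∈ minReps lam mu, dcoset lam mu w = dcoset lam mu y := by
  obtain ⟨w, hw, hmin⟩ := Set.exists_min_image _ len (finite_dcoset lam mu y)
    ⟨y, mem_dcoset_self lam mu y⟩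
  have h := dcoset_eq_of_mem hw
  exact ⟨w, fun z hz => hmin z (h ▸ hz), h⟩

/-! ### Elements of the Hecke algebra invariant under Young subgroups -/

open Classical in
lemma coeff_heckeSum [NeZero r] {D : Set (W r)} (hD : D.Finite) (y : W r) :
    coeff y (heckeSum D) = if y ∈ D then (1 : Laur) else 0 := by
  have h := coeff_finsum_mem hD (fun _ => (1 : Laur)) y
  simp only [one_smul] at h
  exact h

/-- The elements `h` with `T_s h = q h` for all simple reflections `s` in `W_λ`. -/
def IsLeftInv (lam : Comp n r) (h : Hecke r) : Prop :=
  ∀ s ∈ youngGenerators lam, heckeT s * h = (tpow 2 : Laur) • h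

/-- The elements `h` with `h T_s = q h` for all simple reflections `s` in `W_μ`. -/
def IsRightInv (mu : Comp n r) (h : Hecke r) : Prop :=
  ∀ s ∈ youngGenerators mu, h * heckeT s = (tpow 2 : Laur) • h

lemma IsLeftInv.mul {lam : Comp n r} {h : Hecke r} (hh : IsLeftInv lam h) (x : Hecke r) :
    IsLeftInv lam (h * x) := fun s hs => by rw [← mul_assoc, hh s hs, smul_mul_assoc]

lemma IsLeftInv.anti [NeZero r] {lam : Comp n r} {h : Hecke r} (hh : IsLeftInv lam h) :
    IsRightInv lam (anti h) := fun s hs => by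
  rw [mul_simple_eq_smul_iff_anti (youngGenerators_subset lam hs), anti_anti]
  exact hh s hs

lemma isLeftInv_iff [NeZero r] {lam : Comp n r} {h : Hecke r} : IsLeftInv lam h ↔
    ∀ a ∈ young lam, ∀ y, coeff (a * y) h = coeff y h := by
  constructor
  · intro H a ha
    induction ha using Subgroup.closure_induction with
    | mem s hs => exact (simple_mul_eq_smul_iff (youngGenerators_subset lam hs)).1 (H s hs)
    | one => intro y; rw [one_mul]
    | mul a b _ _ ha hb => intro y; rw [mul_assoc, ha, hb]
    | inv a _ ha => intro y; rw [← ha, mul_inv_cancel_left]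
  · intro H s hs
    exact (simple_mul_eq_smul_iff (youngGenerators_subset lam hs)).2 (H s (mem_young_of_mem hs))

lemma isRightInv_iff [NeZero r] {mu : Comp n r} {h : Hecke r} : IsRightInv mu h ↔
    ∀ b ∈ young mu, ∀ y, coeff (y * b) h = coeff y h := by
  constructor
  · intro H a ha
    induction ha using Subgroup.closure_induction with
    | mem s hs => exact (mul_simple_eq_smul_iff (youngGenerators_subset mu hs)).1 (H s hs)
    | one => intro y; rw [mul_one]
    | mul a b _ _ ha hb => intro y; rw [← mul_assoc, hb, ha]
    | inv a _ ha => intro y; rw [← ha, inv_mul_cancel_right]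
  · intro H s hs
    exact (mul_simple_eq_smul_iff (youngGenerators_subset mu hs)).2 (H s (mem_young_of_mem hs))

lemma coeff_eq_of_mem_dcoset [NeZero r] {lam mu : Comp n r} {h : Hecke r}
    (h1 : IsLeftInv lam h) (h2 : IsRightInv mu h) {y w : W r} (hy : y ∈ dcoset lam mu w) :
    coeff y h = coeff w h := by
  obtain ⟨a, ha, b, hb, rfl⟩ := hy
  rw [isRightInv_iff.1 h2 b hb, isLeftInv_iff.1 h1 a ha]

lemma isLeftInv_xElt [NeZero r] (lam : Comp n r) : IsLeftInv lam (xElt lam : Hecke r) := by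
  classical
  rw [isLeftInv_iff]
  intro a ha y
  rw [xElt, coeff_heckeSum (finite_young lam), coeff_heckeSum (finite_young lam)]
  simp only [SetLike.mem_coe, Subgroup.mul_mem_cancel_left _ ha]

lemma isRightInv_xElt [NeZero r] (mu : Comp n r) : IsRightInv mu (xElt mu : Hecke r) := by
  classical
  rw [isRightInv_iff]
  intro a ha y
  rw [xElt, coeff_heckeSum (finite_young mu), coeff_heckeSum (finite_young mu)]
  simp only [SetLike.mem_coe, Subgroup.mul_mem_cancel_right _ ha]

lemma anti_xElt [NeZero r] (lam : Comp n r) : anti (xElt lam : Hecke r) = xElt lam := by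
  classical
  refine hecke_ext fun w => ?_
  rw [coeff_anti, xElt, coeff_heckeSum (finite_young lam), coeff_heckeSum (finite_young lam)]
  simp only [SetLike.mem_coe, inv_mem_iff]

lemma xElt_eq_sum [NeZero r] (lam : Comp n r) :
    (xElt lam : Hecke r) = ∑ b ∈ (finite_young lam).toFinset, heckeT b := by
  rw [xElt, heckeSum, finsum_mem_eq_finite_toFinset_sum _ (finite_young lam)]

open Classical in
lemma coeff_heckeT_mul_xElt [NeZero r] {mu : Comp n r} {x : W r} (hx : IsRightMin mu x)
    (y : W r) : coeff y (heckeT x * xElt mu) = if x⁻¹ * y ∈ young mu then (1 : Laur) else 0 := by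
  have h1 : (heckeT x * xElt mu : Hecke r) =
      ∑ b ∈ (finite_young mu).toFinset, heckeT (x * b) := by
    rw [xElt_eq_sum, Finset.mul_sum]
    refine Finset.sum_congr rfl fun b hb => ?_
    exact heckeT_mul (hx.len_mul ((Set.Finite.mem_toFinset _).1 hb))
  have h2 : ∀ b, x * b = y ↔ x⁻¹ * y = b := fun b => by
    rw [inv_mul_eq_iff_eq_mul, eq_comm]
  rw [h1, map_sum]
  simp only [coeff_heckeT, h2, Finset.sum_ite_eq, Set.Finite.mem_toFinset, SetLike.mem_coe]

/-- Right `W_μ`-invariant elements are in `H x_μ`. -/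
lemma IsRightInv.exists_eq_mul_xElt [NeZero r] {mu : Comp n r} {h : Hecke r}
    (hh : IsRightInv mu h) : ∃ h' : Hecke r, h = h' * xElt mu := by
  classical
  have hfin : {x | coeff x h ≠ 0 ∧ IsRightMin mu x}.Finite :=
    (finite_coeff_ne_zero h).subset fun x hx => hx.1
  -- One term for each coset `x W_μ`, taken at its minimal element: since lengths add, `T_x x_μ` is
  -- the sum of `T` over that coset.
  refine ⟨∑ x ∈ hfin.toFinset, coeff x h • heckeT x, hecke_ext fun y => ?_⟩
  obtain ⟨x, hx, b, hb, hy⟩ := exists_isRightMin mu y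
  have hc : coeff y h = coeff x h := by rw [hy, isRightInv_iff.1 hh b hb]
  rw [Finset.sum_mul, map_sum, Finset.sum_eq_single x]
  · rw [smul_mul_assoc, map_smul, coeff_heckeT_mul_xElt hx, if_pos, hc, smul_eq_mul, mul_one]
    rwa [hy, inv_mul_cancel_left]
  · intro x' hx' hne
    have hx'2 := ((Set.Finite.mem_toFinset _).1 hx').2
    rw [smul_mul_assoc, map_smul, coeff_heckeT_mul_xElt hx'2, if_neg, smul_zero]
    intro hmem
    refine hne (hx'2.eq_of_mul_eq hx (b := b * (x'⁻¹ * y)⁻¹) (mul_mem hb (inv_mem hmem)) ?_)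
    rw [hy]; group
  · intro hx'
    have : coeff x h = 0 := by
      by_contra h0
      exact hx' ((Set.Finite.mem_toFinset _).2 ⟨h0, hx⟩)
    rw [this, zero_smul, zero_mul, map_zero]

/-- Left `W_λ`-invariant elements are in `x_λ H`. -/
lemma IsLeftInv.exists_eq_xElt_mul [NeZero r] {lam : Comp n r} {h : Hecke r}
    (hh : IsLeftInv lam h) : ∃ h' : Hecke r, h = xElt lam * h' := by
  obtain ⟨h', hh'⟩ := hh.anti.exists_eq_mul_xElt
  refine ⟨AffineHecke.anti h', ?_⟩
  rw [← anti_anti h, hh', anti_mul, anti_xElt]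

lemma heckeT_mul_of_isLeftInv [NeZero r] {lam : Comp n r} {h : Hecke r} (hh : IsLeftInv lam h)
    {a : W r} (ha : a ∈ young lam) :
    heckeT a * h = (tpow (2 * (len a : ℤ)) : Laur) • h := by
  induction hn : len a generalizing a with
  | zero =>
    rw [eq_one_of_len_eq_zero ha hn, heckeT_one, one_mul, Nat.cast_zero, mul_zero, tpow_zero,
      one_smul]
  | succ m ih =>
    obtain ⟨s, hs, h1⟩ := exists_young_right_descent (inv_mem ha) (by rw [len_inv]; omega)
    have hss := youngGenerators_subset lam hs
    rw [← len_simple_mul_eq hss, len_inv] at h1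
    have h2 := heckeT_simple_mul (w := s * a) hss (by rw [simple_mul_cancel_left hss]; omega)
    rw [simple_mul_cancel_left hss] at h2
    rw [← h2, mul_assoc, ih (mul_mem (mem_young_of_mem hs) ha) (by omega), mul_smul_comm,
      hh s hs, smul_smul, ← tpow_add]
    congr 2

lemma xElt_mul_of_isLeftInv [NeZero r] {lam : Comp n r} {h : Hecke r} (hh : IsLeftInv lam h) :
    xElt lam * h = (tpow (len (longest lam) : ℤ) * poincare lam) • h := by
  rw [poincare, ← mul_assoc, tpow_mul_neg, one_mul,
    finsum_mem_eq_finite_toFinset_sum _ (finite_young lam), Finset.sum_smul, xElt_eq_sum,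
    Finset.sum_mul]
  exact Finset.sum_congr rfl fun a ha =>
    heckeT_mul_of_isLeftInv hh ((Set.Finite.mem_toFinset _).1 ha)

lemma poincare_ne_zero [NeZero r] (lam : Comp n r) : poincare lam ≠ 0 := by
  refine mul_ne_zero (tpow_ne_zero _) fun h => ?_
  -- At `t = 1` the sum becomes the order of `W_λ`.
  have h1 := congrArg (LaurentPolynomial.eval₂ (RingHom.id ℤ) (1 : ℤˣ)) h
  rw [finsum_mem_eq_finite_toFinset_sum _ (finite_young lam), map_sum, map_zero] at h1
  simp only [tpow, LaurentPolynomial.eval₂_T, one_zpow, Units.val_one, Finset.sum_const,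
    nsmul_eq_mul, mul_one, Nat.cast_eq_zero, Finset.card_eq_zero] at h1
  have : (1 : W r) ∈ (finite_young lam).toFinset := by simp [one_mem]
  rw [h1] at this
  simp at this

lemma isLeftInv_heckeSum_dcoset [NeZero r] (lam mu : Comp n r) (w : W r) :
    IsLeftInv lam (heckeSum (dcoset lam mu w) : Hecke r) := by
  classical
  intro s hs
  have hss := youngGenerators_subset lam hs
  rw [simple_mul_eq_smul_iff hss]
  intro y
  rw [coeff_heckeSum (finite_dcoset lam mu w), coeff_heckeSum (finite_dcoset lam mu w)]
  have : s * y ∈ dcoset lam mu w ↔ y ∈ dcoset lam mu w :=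
    ⟨fun h => by simpa [simple_mul_cancel_left hss] using simple_mul_mem_dcoset hs h,
      simple_mul_mem_dcoset hs⟩
  simp only [this]

lemma isRightInv_heckeSum_dcoset [NeZero r] (lam mu : Comp n r) (w : W r) :
    IsRightInv mu (heckeSum (dcoset lam mu w) : Hecke r) := by
  classical
  intro s hs
  have hss := youngGenerators_subset mu hs
  rw [mul_simple_eq_smul_iff hss]
  intro y
  rw [coeff_heckeSum (finite_dcoset lam mu w), coeff_heckeSum (finite_dcoset lam mu w)]
  have : y * s ∈ dcoset lam mu w ↔ y ∈ dcoset lam mu w :=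
    ⟨fun h => by simpa [simple_mul_cancel_right hss] using mul_simple_mem_dcoset hs h,
      mul_simple_mem_dcoset hs⟩
  simp only [this]

/-! ### Maximal elements of double cosets -/

/-- The simple reflections of `W_λ` are left descents of `x`, and those of `W_μ` right
descents. -/
def IsMax (lam mu : Comp n r) (x : W r) : Prop :=
  (∀ s ∈ youngGenerators lam, len (s * x) < len x) ∧
    ∀ t ∈ youngGenerators mu, len (x * t) < len x

lemma IsMax.isLeftInv [NeZero r] {lam mu : Comp n r} {x : W r} (hx : IsMax lam mu x) :
    IsLeftInv lam (klC x) := fun s hs =>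
  simple_mul_klC (youngGenerators_subset lam hs) (hx.1 s hs)

lemma IsMax.isRightInv [NeZero r] {lam mu : Comp n r} {x : W r} (hx : IsMax lam mu x) :
    IsRightInv mu (klC x) := fun s hs =>
  klC_mul_simple (youngGenerators_subset mu hs) (hx.2 s hs)

/-- The coefficients of `C_x` are constant on the double coset and nonzero at `x`, so the whole
double coset lies below `x` in the Bruhat order. In particular its longest element is unique. -/
lemma IsMax.eq_or_len_lt [NeZero r] {lam mu : Comp n r} {x : W r} (hx : IsMax lam mu x)
    {y : W r} (hy : y ∈ dcoset lam mu x) : y = x ∨ len y < len x := by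
  have h1 := coeff_eq_of_mem_dcoset hx.isLeftInv hx.isRightInv hy
  have h2 : coeff y (klC x) ≠ 0 := by rw [h1, coeff_klC_self]; exact tpow_ne_zero _
  exact bruhatLE.eq_or_len_lt ((isKLElement_klC x).le_of_coeff_ne_zero h2)

lemma maxRep_spec [NeZero r] (lam mu : Comp n r) (w : W r) :
    maxRep lam mu w ∈ dcoset lam mu w ∧ ∀ y ∈ dcoset lam mu w, len y ≤ len (maxRep lam mu w) := by
  obtain ⟨x, hx, hmax⟩ := Set.exists_max_image _ len (finite_dcoset lam mu w)
    ⟨w, mem_dcoset_self lam mu w⟩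
  exact Classical.epsilon_spec (p := fun x => x ∈ dcoset lam mu w ∧
    ∀ y ∈ dcoset lam mu w, len y ≤ len x) ⟨x, hx, hmax⟩

lemma isMax_maxRep [NeZero r] (lam mu : Comp n r) (w : W r) : IsMax lam mu (maxRep lam mu w) := by
  obtain ⟨h1, h2⟩ := maxRep_spec lam mu w
  constructor
  · intro s hs
    have h3 := h2 _ (simple_mul_mem_dcoset hs h1)
    have h4 := len_simple_mul (youngGenerators_subset lam hs) (maxRep lam mu w)
    omega
  · intro s hs
    have h3 := h2 _ (mul_simple_mem_dcoset hs h1)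
    have h4 := len_mul_simple (youngGenerators_subset mu hs) (maxRep lam mu w)
    omega

lemma IsMax.maxRep_eq [NeZero r] {lam mu : Comp n r} {x w : W r} (hx : IsMax lam mu x)
    (h : x ∈ dcoset lam mu w) : maxRep lam mu w = x := by
  obtain ⟨h1, h2⟩ := maxRep_spec lam mu w
  have h3 := h2 x h
  rw [← dcoset_eq_of_mem h] at h1
  exact (hx.eq_or_len_lt h1).resolve_right (by omega)

lemma _root_.Triple.isMax_sigma [NeZero r] (A : Triple n r) : IsMax A.ro A.co A.sigma :=
  isMax_maxRep _ _ _

lemma _root_.Triple.ext_of_sigma_eq [NeZero r] {A B : Triple n r} (h1 : A.ro = B.ro)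
    (h2 : A.co = B.co) (h : A.sigma = B.sigma) : A = B := by
  obtain ⟨lam, w, mu, hw⟩ := A
  obtain ⟨lam', w', mu', hw'⟩ := B
  obtain rfl : lam = lam' := h1
  obtain rfl : mu = mu' := h2
  have e1 := dcoset_eq_of_mem (maxRep_spec lam mu w).1
  have e2 := dcoset_eq_of_mem (maxRep_spec lam mu w').1
  have h' : maxRep lam mu w = maxRep lam mu w' := h
  rw [h', e2] at e1
  have : w = w' := minReps_eq_of_mem_dcoset hw hw' (e1 ▸ mem_dcoset_self lam mu w)
  subst this
  rfl

lemma IsMax.exists_triple [NeZero r] {lam mu : Comp n r} {x : W r} (hx : IsMax lam mu x) :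
    ∃ A : Triple n r, A.ro = lam ∧ A.co = mu ∧ A.sigma = x := by
  obtain ⟨w, hw, h⟩ := exists_minReps lam mu x
  refine ⟨⟨lam, w, mu, hw⟩, rfl, rfl, hx.maxRep_eq ?_⟩
  rw [h]; exact mem_dcoset_self _ _ _

/-- Elements invariant on both sides are combinations of Kazhdan-Lusztig elements of maximal
elements of double cosets. -/
lemma mem_span_klC_of_isInv [NeZero r] {lam mu : Comp n r} {h : Hecke r}
    (h1 : IsLeftInv lam h) (h2 : IsRightInv mu h) :
    h ∈ Submodule.span Laur (klC '' {x : W r | IsMax lam mu x}) := by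
  classical
  obtain ⟨f, rfl⟩ := Finsupp.mem_span_range_iff_exists_finsupp.1
    (show h ∈ Submodule.span Laur (Set.range klC) by rw [span_klC]; trivial)
  change Finsupp.linearCombination Laur klC f ∈ _
  change IsLeftInv lam (Finsupp.linearCombination Laur klC f) at h1
  change IsRightInv mu (Finsupp.linearCombination Laur klC f) at h2
  -- The part supported on maximal elements is invariant, so the remainder `f₂` is invariant too and
  -- has to vanish.
  set f₁ := f.filter (IsMax lam mu)
  set f₂ := f.filter (fun x => ¬ IsMax lam mu x)
  have hf : f₁ + f₂ = f := f.filter_add_filter_not _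
  have hf₁ : ∀ x ∈ f₁.support, IsMax lam mu x := fun x hx =>
    (Finset.mem_filter.1 (Finsupp.support_filter (IsMax lam mu) f ▸ hx)).2
  have hsub : Finsupp.linearCombination Laur klC f₂ = Finsupp.linearCombination Laur klC f -
      Finsupp.linearCombination Laur klC f₁ := by rw [← hf, map_add, add_sub_cancel_left]
  have l2 : IsLeftInv lam (Finsupp.linearCombination Laur klC f₂) := by
    intro s hs
    rw [hsub, mul_sub, h1 s hs, smul_sub]
    congr 1
    rw [Finsupp.linearCombination_apply, Finsupp.sum, Finset.mul_sum, Finset.smul_sum]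
    exact Finset.sum_congr rfl fun x hx => by
      rw [mul_smul_comm, (hf₁ x hx).isLeftInv s hs, smul_comm]
  have r2 : IsRightInv mu (Finsupp.linearCombination Laur klC f₂) := by
    intro s hs
    rw [hsub, sub_mul, h2 s hs, smul_sub]
    congr 1
    rw [Finsupp.linearCombination_apply, Finsupp.sum, Finset.sum_mul, Finset.smul_sum]
    exact Finset.sum_congr rfl fun x hx => by
      rw [smul_mul_assoc, (hf₁ x hx).isRightInv s hs, smul_comm]
  have hf₂ : f₂ = 0 := by
    by_contra hne
    -- For the longest `w` in the remainder, the coefficient of `T_w` cannot cancel. Invariance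
    -- carries it to `s * w` and `w * s`, so none of these is longer and `w` would be maximal.
    obtain ⟨w, hw, hmax⟩ := exists_max_len_ne_zero hne
    have c1 : coeff w (Finsupp.linearCombination Laur klC f₂) ≠ 0 := by
      rw [coeff_linearCombination_klC f₂ w hmax]
      exact mul_ne_zero hw (tpow_ne_zero _)
    have c2 : ∀ y, len w < len y → coeff y (Finsupp.linearCombination Laur klC f₂) = 0 := by
      intro y hy
      rw [coeff_linearCombination_klC f₂ y fun z hz => hmax z (hy.trans hz), hmax y hy, zero_mul]
    have hwn : ¬ IsMax lam mu w := fun hm => hw (Finsupp.filter_apply_neg _ _ (not_not.2 hm))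
    refine hwn ⟨?_, ?_⟩
    · intro s hs
      by_contra hc
      have h3 := len_simple_mul (youngGenerators_subset lam hs) w
      rw [← isLeftInv_iff.1 l2 s (mem_young_of_mem hs), c2 _ (by omega)] at c1
      exact c1 rfl
    · intro s hs
      by_contra hc
      have h3 := len_mul_simple (youngGenerators_subset mu hs) w
      rw [← isRightInv_iff.1 r2 s (mem_young_of_mem hs), c2 _ (by omega)] at c1
      exact c1 rfl
  rw [← hf, hf₂, add_zero, Finsupp.linearCombination_apply, Finsupp.sum]
  exact Submodule.sum_mem _ fun x hx =>
    Submodule.smul_mem _ _ (Submodule.subset_span ⟨x, hf₁ x hx, rfl⟩)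

/-! ### Homomorphisms between the right ideals -/

/-- The generator `x_μ` of the right ideal `x_μ H`. -/
noncomputable def xGen (mu : Comp n r) : xIdeal (r := r) mu :=
  ⟨xElt mu, Submodule.mem_span_singleton_self _⟩

lemma mem_xIdeal_iff {mu : Comp n r} {v : Hecke r} :
    v ∈ xIdeal mu ↔ ∃ h : Hecke r, v = xElt mu * h := by
  rw [xIdeal, Submodule.mem_span_singleton]
  constructor
  · rintro ⟨a, rfl⟩
    exact ⟨a.unop, rfl⟩
  · rintro ⟨h, rfl⟩
    exact ⟨MulOpposite.op h, rfl⟩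

lemma isLeftInv_of_mem_xIdeal [NeZero r] {lam : Comp n r} {v : Hecke r} (hv : v ∈ xIdeal lam) :
    IsLeftInv lam v := by
  obtain ⟨h, rfl⟩ := mem_xIdeal_iff.1 hv
  exact (isLeftInv_xElt lam).mul h

lemma IsLeftInv.mem_xIdeal [NeZero r] {lam : Comp n r} {v : Hecke r} (hv : IsLeftInv lam v) :
    v ∈ xIdeal lam := mem_xIdeal_iff.2 hv.exists_eq_xElt_mul

/-- The component in `x_λ H` of the image of `x_μ` under an endomorphism. -/
noncomputable def evalX (lam mu : Comp n r) : Schur n r →ₗ[Laur] Hecke r where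
  toFun f := ((f (DirectSum.of (fun lam : Comp n r => xIdeal lam) mu (xGen mu))) lam : Hecke r)
  map_add' _ _ := rfl
  map_smul' _ _ := rfl

lemma evalX_apply (lam mu : Comp n r) (f : Schur n r) : evalX lam mu f =
    ((f (DirectSum.of (fun lam : Comp n r => xIdeal lam) mu (xGen mu))) lam : Hecke r) := rfl

lemma apply_of_eq (f : Schur n r) {nu : Comp n r} (v : xIdeal (r := r) nu) {h : Hecke r}
    (hv : (v : Hecke r) = xElt nu * h) (kap : Comp n r) :
    ((f (DirectSum.of (fun lam : Comp n r => xIdeal lam) nu v)) kap : Hecke r) =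
      evalX kap nu f * h := by
  have h1 : v = MulOpposite.op h • xGen nu := Subtype.ext hv
  have h2 : DirectSum.of (fun lam : Comp n r => xIdeal (r := r) lam) nu (MulOpposite.op h • xGen nu)
      = MulOpposite.op h • DirectSum.of (fun lam : Comp n r => xIdeal lam) nu (xGen nu) :=
    (DirectSum.lof (Hecke r)ᵐᵒᵖ (Comp n r) (fun lam => xIdeal (r := r) lam) nu).map_smul _ _
  rw [h1, h2, map_smul]
  rfl

lemma schur_ext {f g : Schur n r} (h : ∀ lam mu, evalX lam mu f = evalX lam mu g) : f = g := by
  refine DirectSum.linearMap_ext _ fun nu => LinearMap.ext fun v => ?_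
  obtain ⟨a, ha⟩ := mem_xIdeal_iff.1 v.2
  refine DFinsupp.ext fun kap => Subtype.ext ?_
  exact (apply_of_eq f v ha kap).trans ((h kap nu) ▸ (apply_of_eq g v ha kap).symm)

lemma isLeftInv_evalX [NeZero r] (lam mu : Comp n r) (f : Schur n r) :
    IsLeftInv lam (evalX lam mu f) := isLeftInv_of_mem_xIdeal (Subtype.property _)

/-- The element `x_μ T_s` is also `x_μ` times the scalar `q`, and right linearity applies to both
expressions. -/
lemma isRightInv_evalX [NeZero r] (lam mu : Comp n r) (f : Schur n r) :
    IsRightInv mu (evalX lam mu f) := by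
  intro s hs
  have h1 : (xElt mu * heckeT s : Hecke r) = xElt mu * algebraMap Laur _ (tpow 2) := by
    rw [isRightInv_xElt mu s hs, Algebra.algebraMap_eq_smul_one, mul_smul_comm, mul_one]
  have h2 : (xElt mu * heckeT s : Hecke r) ∈ xIdeal mu := mem_xIdeal_iff.2 ⟨_, rfl⟩
  have h3 := apply_of_eq f ⟨_, h2⟩ rfl lam
  have h4 := apply_of_eq f ⟨_, h2⟩ h1 lam
  rw [h3, Algebra.algebraMap_eq_smul_one, mul_smul_comm, mul_one] at h4
  exact h4

/-- Left multiplication by an element of the Hecke algebra. -/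
noncomputable def mulLeftOp (h : Hecke r) : Hecke r →ₗ[(Hecke r)ᵐᵒᵖ] Hecke r where
  toFun x := h * x
  map_add' := mul_add h
  map_smul' a x := (mul_assoc h x a.unop).symm

/-- Writing `D = d x_μ`, left multiplication by `d` is defined on all of `H` and sends `x_μ h` to `D
h`, so nothing has to be checked for well-definedness. Left invariance of `D` puts the image in `x_λ
H`. -/
lemma exists_schur_of_isInv [NeZero r] {lam mu : Comp n r} {D : Hecke r} (hl : IsLeftInv lam D)
    (hr : IsRightInv mu D) : ∃ f : Schur n r, ∀ (nu : Comp n r) (h : Hecke r) (v : xIdeal nu),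
      (v : Hecke r) = xElt nu * h → ∀ kap : Comp n r,
        ((f (DirectSum.of (fun lam : Comp n r => xIdeal lam) nu v)) kap : Hecke r) =
          if nu = mu ∧ kap = lam then D * h else 0 := by
  obtain ⟨d, rfl⟩ := hr.exists_eq_mul_xElt
  have hmaps : ∀ v ∈ xIdeal mu, mulLeftOp d v ∈ xIdeal lam := by
    intro v hv
    obtain ⟨h, rfl⟩ := mem_xIdeal_iff.1 hv
    have : mulLeftOp d (xElt mu * h) = d * xElt mu * h := (mul_assoc _ _ _).symm
    rw [this]
    exact (hl.mul h).mem_xIdeal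
  refine ⟨(DirectSum.lof (Hecke r)ᵐᵒᵖ (Comp n r) (fun lam => xIdeal (r := r) lam) lam).comp
    (((mulLeftOp d).restrict hmaps).comp
      (DirectSum.component (Hecke r)ᵐᵒᵖ (Comp n r) (fun lam => xIdeal (r := r) lam) mu)), ?_⟩
  intro nu h v hv kap
  rw [LinearMap.comp_apply, LinearMap.comp_apply]
  change ((DirectSum.of (fun lam : Comp n r => xIdeal (r := r) lam) lam ((mulLeftOp d).restrict hmaps
    ((DirectSum.of (fun lam : Comp n r => xIdeal (r := r) lam) nu v) mu))) kap : Hecke r) = _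
  by_cases h1 : nu = mu
  · subst h1
    rw [DirectSum.of_eq_same]
    by_cases h2 : kap = lam
    · subst h2
      rw [DirectSum.of_eq_same, if_pos ⟨rfl, rfl⟩, mul_assoc, ← hv]
      rfl
    · rw [DirectSum.of_eq_of_ne _ _ _ h2, if_neg fun h => h2 h.2]
      rfl
  · rw [DirectSum.of_eq_of_ne _ _ _ (Ne.symm h1), map_zero, map_zero, if_neg fun h => h1 h.1]
    rfl

lemma isStdElement_stdPhi [NeZero r] (lam mu : Comp n r) (w : W r) :
    IsStdElement lam mu w (stdPhi lam mu w) :=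
  Classical.epsilon_spec (exists_schur_of_isInv (isLeftInv_heckeSum_dcoset lam mu w)
    (isRightInv_heckeSum_dcoset lam mu w))

lemma evalX_stdPhi [NeZero r] (lam mu : Comp n r) (w : W r) (kap nu : Comp n r) :
    evalX kap nu (stdPhi lam mu w) =
      if nu = mu ∧ kap = lam then heckeSum (dcoset lam mu w) else 0 := by
  have := isStdElement_stdPhi lam mu w nu 1 (xGen nu) (mul_one _).symm kap
  rw [mul_one] at this
  exact this

/-! ### Expansions with respect to double cosets -/

lemma linearIndependent_heckeSum_dcoset [NeZero r] (lam mu : Comp n r) :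
    LinearIndependent Laur
      fun z : minReps (r := r) lam mu => (heckeSum (dcoset lam mu (z : W r)) : Hecke r) := by
  classical
  rw [linearIndependent_iff]
  intro f hf
  ext1 z
  have h := congrArg (coeff (z : W r)) hf
  rw [Finsupp.linearCombination_apply, Finsupp.sum, map_sum, map_zero,
    Finset.sum_eq_single z] at h
  · rw [map_smul, coeff_heckeSum (finite_dcoset _ _ _), if_pos (mem_dcoset_self _ _ _),
      smul_eq_mul, mul_one] at h
    exact h
  · intro y _ hy
    rw [map_smul, coeff_heckeSum (finite_dcoset _ _ _), if_neg, smul_zero]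
    intro hmem
    exact hy (Subtype.ext (minReps_eq_of_mem_dcoset z.2 y.2 hmem)).symm
  · intro hz
    rw [Finsupp.notMem_support_iff.1 hz, zero_smul, map_zero]

lemma mem_span_heckeSum_dcoset [NeZero r] {lam mu : Comp n r} {h : Hecke r}
    (hl : IsLeftInv lam h) (hr : IsRightInv mu h) :
    h ∈ Submodule.span Laur (Set.range
      fun z : minReps (r := r) lam mu => (heckeSum (dcoset lam mu (z : W r)) : Hecke r)) := by
  classical
  have hfin : {z : minReps (r := r) lam mu | coeff (z : W r) h ≠ 0}.Finite :=
    (finite_coeff_ne_zero h).preimage Subtype.val_injective.injOn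
  have key : h = ∑ z ∈ hfin.toFinset, coeff (z : W r) h • heckeSum (dcoset lam mu (z : W r)) := by
    refine hecke_ext fun y => ?_
    obtain ⟨z, hz, hzy⟩ := exists_minReps lam mu y
    have hmem : y ∈ dcoset lam mu z := hzy ▸ mem_dcoset_self lam mu y
    rw [map_sum, Finset.sum_eq_single ⟨z, hz⟩]
    · rw [map_smul, coeff_heckeSum (finite_dcoset _ _ _), if_pos hmem, smul_eq_mul, mul_one]
      exact coeff_eq_of_mem_dcoset hl hr hmem
    · intro z' _ hne
      rw [map_smul, coeff_heckeSum (finite_dcoset _ _ _), if_neg, smul_zero]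
      intro hmem'
      refine hne (Subtype.ext (minReps_eq_of_mem_dcoset z'.2 hz ?_))
      rw [hzy, dcoset_eq_of_mem hmem']
      exact mem_dcoset_self _ _ _
    · intro hz'
      have : coeff z h = 0 := by
        by_contra h0
        exact hz' ((Set.Finite.mem_toFinset _).2 h0)
      rw [this, zero_smul, map_zero]
  rw [key]
  exact Submodule.sum_mem _ fun z _ => Submodule.smul_mem _ _ (Submodule.subset_span ⟨z, rfl⟩)

lemma linearCombination_coords {ι M : Type*} [AddCommGroup M] [Module Laur M] {b : ι → M}
    (hb : LinearIndependent Laur b) {m : M} (hm : m ∈ Submodule.span Laur (Set.range b)) :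
    Finsupp.linearCombination Laur b (coords b m) = m := by
  rw [coords, dif_pos ⟨hb, hm⟩]
  exact hb.linearCombination_repr ⟨m, hm⟩

/-- The coefficients in the definition of `θ_A` are those of `C_{σ(A)}` along double coset sums,
which are the entries of the standard elements. From here on `θ_A` is used only through this
formula. -/
lemma evalX_theta [NeZero r] (A : Triple n r) (kap nu : Comp n r) : evalX kap nu (theta A) =
    if nu = A.co ∧ kap = A.ro then tpow (len (longest A.co) : ℤ) • klC A.sigma else 0 := by
  have h := linearCombination_coords (linearIndependent_heckeSum_dcoset A.ro A.co)
    (mem_span_heckeSum_dcoset A.isMax_sigma.isLeftInv A.isMax_sigma.isRightInv)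
  rw [Finsupp.linearCombination_apply] at h
  rw [theta, map_smul, Finsupp.sum, map_sum]
  simp only [map_smul, evalX_stdPhi]
  split_ifs with hc
  · congr 1
  · simp

/-! ### The basis of the affine Schur algebra -/

/-- The Kazhdan-Lusztig basis. -/
noncomputable def basisC (r : ℕ) [NeZero r] : Module.Basis (W r) Laur (Hecke r) :=
  Module.Basis.mk linearIndependent_klC span_klC.ge

lemma basisC_eq [NeZero r] : ⇑(basisC r) = klC := funext fun w => Module.Basis.mk_apply _ _ w

lemma klStruct_eq [NeZero r] (x y z : W r) :
    klStruct x y z = (basisC r).coord z (klC x * klC y) := by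
  rw [klStruct, ← basisC_eq, coords_eq_repr]; rfl

/-- The coordinate functionals of the family `θ`. -/
noncomputable def thetaCoord [NeZero r] (A : Triple n r) : Schur n r →ₗ[Laur] Laur :=
  tpow (-(len (longest A.co) : ℤ)) • (basisC r).coord A.sigma ∘ₗ evalX A.ro A.co

lemma thetaCoord_apply [NeZero r] (A : Triple n r) (f : Schur n r) : thetaCoord A f =
    tpow (-(len (longest A.co) : ℤ)) * (basisC r).coord A.sigma (evalX A.ro A.co f) := rfl

open Classical in
lemma thetaCoord_theta [NeZero r] (A B : Triple n r) :
    thetaCoord A (theta B) = if B = A then 1 else 0 := by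
  rw [thetaCoord_apply, evalX_theta]
  by_cases hAB : B = A
  · subst hAB
    rw [if_pos ⟨rfl, rfl⟩, if_pos rfl, map_smul, ← basisC_eq, Module.Basis.coord_apply,
      Module.Basis.repr_self, Finsupp.single_eq_same, smul_eq_mul, mul_one, mul_comm,
      tpow_mul_neg]
  · rw [if_neg hAB]
    split_ifs with h
    · have hne : B.sigma ≠ A.sigma := fun hs => hAB (Triple.ext_of_sigma_eq h.2.symm h.1.symm hs)
      rw [map_smul, ← basisC_eq, Module.Basis.coord_apply, Module.Basis.repr_self,
        Finsupp.single_eq_of_ne hne.symm, smul_zero, mul_zero]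
    · rw [map_zero, mul_zero]

lemma thetaCoord_linearCombination [NeZero r] (A : Triple n r) (f : Triple n r →₀ Laur) :
    thetaCoord A (Finsupp.linearCombination Laur theta f) = f A := by
  classical
  rw [Finsupp.linearCombination_apply, Finsupp.sum, map_sum]
  simp only [map_smul, thetaCoord_theta, smul_eq_mul, mul_ite, mul_one, mul_zero,
    Finset.sum_ite_eq']
  split_ifs with h
  · rfl
  · exact (Finsupp.notMem_support_iff.1 h).symm

lemma linearIndependent_theta [NeZero r] : LinearIndependent Laur (theta (n := n) (r := r)) := by
  rw [linearIndependent_iff]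
  intro f hf
  ext1 A
  rw [← thetaCoord_linearCombination, hf, map_zero]; rfl

instance finite_comp : Finite (Comp n r) := by
  refine Finite.of_injective (fun lam : Comp n r => fun i : Fin n =>
    (⟨lam.1 i, Nat.lt_succ_of_le ?_⟩ : Fin (r + 1))) fun lam mu h => ?_
  · exact (Finset.single_le_sum (fun _ _ => Nat.zero_le _) (Finset.mem_univ i)).trans_eq lam.2
  · refine Subtype.ext (funext fun i => ?_)
    exact congrArg Fin.val (congrFun h i)

lemma exists_mem_span_theta [NeZero r] {lam mu : Comp n r} {h : Hecke r}
    (hh : h ∈ Submodule.span Laur (klC '' {x : W r | IsMax lam mu x})) :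
    ∃ g ∈ Submodule.span Laur (Set.range (theta (n := n) (r := r))), ∀ kap nu,
      evalX kap nu g = if nu = mu ∧ kap = lam then h else 0 := by
  induction hh using Submodule.span_induction with
  | mem h hh =>
    obtain ⟨x, hx, rfl⟩ := hh
    obtain ⟨A, rfl, rfl, rfl⟩ := IsMax.exists_triple hx
    refine ⟨tpow (-(len (longest A.co) : ℤ)) • theta A,
      Submodule.smul_mem _ _ (Submodule.subset_span ⟨A, rfl⟩), fun kap nu => ?_⟩
    rw [map_smul, evalX_theta]
    split_ifs
    · rw [smul_smul, mul_comm, tpow_mul_neg, one_smul]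
    · rw [smul_zero]
  | zero => exact ⟨0, zero_mem _, fun kap nu => by simp⟩
  | add x y _ _ hx hy =>
    obtain ⟨g, hg, hgx⟩ := hx
    obtain ⟨g', hg', hgy⟩ := hy
    refine ⟨g + g', add_mem hg hg', fun kap nu => ?_⟩
    rw [map_add, hgx, hgy]
    split_ifs
    · rfl
    · rw [add_zero]
  | smul a x _ hx =>
    obtain ⟨g, hg, hgx⟩ := hx
    refine ⟨a • g, Submodule.smul_mem _ _ hg, fun kap nu => ?_⟩
    rw [map_smul, hgx]
    split_ifs
    · rfl
    · rw [smul_zero]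

/-- By finiteness of the set of compositions, an endomorphism is a finite sum of endomorphisms with
a single matrix entry. Each entry is invariant on both sides, hence a combination of the `C_x` with
`x` maximal. -/
lemma span_theta [NeZero r] :
    Submodule.span Laur (Set.range (theta (n := n) (r := r))) = ⊤ := by
  refine eq_top_iff.2 fun f _ => ?_
  cases nonempty_fintype (Comp n r)
  choose g hg hg' using fun p : Comp n r × Comp n r => exists_mem_span_theta
    (mem_span_klC_of_isInv (isLeftInv_evalX p.1 p.2 f) (isRightInv_evalX p.1 p.2 f))
  have key : f = ∑ p, g p := by
    refine schur_ext fun kap nu => ?_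
    rw [map_sum, Finset.sum_eq_single (kap, nu)]
    · rw [hg', if_pos ⟨rfl, rfl⟩]
    · intro p _ hp
      rw [hg', if_neg]
      rintro ⟨rfl, rfl⟩
      exact hp rfl
    · intro hp; exact absurd (Finset.mem_univ _) hp
  rw [key]
  exact Submodule.sum_mem _ fun p _ => hg p

lemma isBasisFamily_theta [NeZero r] : IsBasisFamily (theta (n := n) (r := r)) :=
  ⟨linearIndependent_theta, span_theta⟩

/-! ### Structure constants -/

lemma schurStruct_eq [NeZero r] (A B C : Triple n r) :
    schurStruct A B C = thetaCoord C (theta A * theta B) := by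
  have h := linearCombination_coords (linearIndependent_theta (n := n) (r := r))
    (m := theta A * theta B) (by rw [span_theta]; trivial)
  conv_rhs => rw [← h, thetaCoord_linearCombination]
  rfl

lemma theta_apply_of [NeZero r] (B : Triple n r) (nu : Comp n r) {v : xIdeal (r := r) B.ro}
    (hv : (v : Hecke r) = tpow (len (longest B.co) : ℤ) • klC B.sigma) :
    theta B (DirectSum.of (fun lam : Comp n r => xIdeal lam) nu (xGen nu)) =
      if nu = B.co then DirectSum.of (fun lam : Comp n r => xIdeal lam) B.ro v else 0 := by
  refine DFinsupp.ext fun kap => Subtype.ext ?_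
  refine (evalX_theta B kap nu).trans ?_
  by_cases h1 : nu = B.co
  · rw [if_pos h1]
    by_cases h2 : kap = B.ro
    · rw [if_pos ⟨h1, h2⟩, h2, ← hv]
      exact congrArg Subtype.val (DirectSum.of_eq_same (β := fun lam : Comp n r => xIdeal lam)
        B.ro v).symm
    · rw [if_neg fun h => h2 h.2]
      exact congrArg Subtype.val (DirectSum.of_eq_of_ne (β := fun lam : Comp n r => xIdeal lam)
        B.ro kap v h2).symm
  · rw [if_neg h1, if_neg fun h => h1 h.1]
    rfl

/-- The image of a generator under `θ_B` is written as `x_{ro(B)} h`, and right linearity of `θ_A`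
moves `h` outside. -/
lemma evalX_theta_mul_theta [NeZero r] (A B : Triple n r) {h : Hecke r}
    (hh : tpow (len (longest B.co) : ℤ) • klC B.sigma = xElt B.ro * h) (kap nu : Comp n r) :
    evalX kap nu (theta A * theta B) = if nu = B.co ∧ B.ro = A.co ∧ kap = A.ro then
      tpow (len (longest A.co) : ℤ) • (klC A.sigma * h) else 0 := by
  have hv : tpow (len (longest B.co) : ℤ) • klC B.sigma ∈ xIdeal B.ro :=
    mem_xIdeal_iff.2 ⟨h, hh⟩
  rw [evalX_apply, Module.End.mul_apply, theta_apply_of B nu (v := ⟨_, hv⟩) rfl]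
  by_cases h1 : nu = B.co
  · rw [if_pos h1, apply_of_eq (theta A) ⟨_, hv⟩ hh kap, evalX_theta]
    by_cases h2 : B.ro = A.co ∧ kap = A.ro
    · rw [if_pos h2, if_pos ⟨h1, h2⟩, smul_mul_assoc]
    · rw [if_neg h2, if_neg fun h => h2 h.2, zero_mul]
  · rw [if_neg h1, if_neg fun h => h1 h.1, map_zero]
    rfl

lemma eq_of_schurStruct_ne_zero [NeZero r] {A B C : Triple n r} (h : schurStruct A B C ≠ 0) :
    A.co = B.ro ∧ A.ro = C.ro ∧ B.co = C.co := by
  obtain ⟨d, hd⟩ := (B.isMax_sigma.isLeftInv).exists_eq_xElt_mul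
  have hh : tpow (len (longest B.co) : ℤ) • klC B.sigma =
      xElt B.ro * (tpow (len (longest B.co) : ℤ) • d) := by rw [mul_smul_comm, ← hd]
  rw [schurStruct_eq, thetaCoord_apply, evalX_theta_mul_theta A B hh] at h
  by_contra hc
  rw [if_neg fun h' => hc ⟨h'.2.1.symm, h'.2.2.symm, h'.1.symm⟩, map_zero, mul_zero] at h
  exact h rfl

lemma poincare_mul_schurStruct [NeZero r] {A B C : Triple n r} (h1 : A.co = B.ro)
    (h2 : A.ro = C.ro) (h3 : B.co = C.co) :
    poincare A.co * schurStruct A B C = klStruct A.sigma B.sigma C.sigma := by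
  obtain ⟨d, hd⟩ := (B.isMax_sigma.isLeftInv).exists_eq_xElt_mul
  obtain ⟨d', hd'⟩ := (A.isMax_sigma.isRightInv).exists_eq_mul_xElt
  have hh : tpow (len (longest B.co) : ℤ) • klC B.sigma =
      xElt B.ro * (tpow (len (longest B.co) : ℤ) • d) := by rw [mul_smul_comm, ← hd]
  -- Both factors contain `x_μ`, and `x_μ` acts on itself by its Poincaré polynomial.
  have hprod : klC A.sigma * klC B.sigma =
      (tpow (len (longest A.co) : ℤ) * poincare A.co) • (klC A.sigma * d) := by
    rw [hd', hd, ← h1, mul_assoc d', ← mul_assoc (xElt A.co),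
      xElt_mul_of_isLeftInv (isLeftInv_xElt A.co), smul_mul_assoc, mul_smul_comm, mul_assoc]
  rw [schurStruct_eq, thetaCoord_apply, evalX_theta_mul_theta A B hh,
    if_pos ⟨h3.symm, h1.symm, h2.symm⟩, klStruct_eq, hprod, mul_smul_comm, map_smul, map_smul,
    map_smul, smul_eq_mul, smul_eq_mul, smul_eq_mul, h3]
  -- The power of `t` in `θ_B` cancels the one in the coordinate of `θ_C`, because `co(B) = co(C)`.
  -- The power in `θ_A` is absorbed by the Poincaré polynomial.
  have e := tpow_mul_neg (len (longest C.co) : ℤ)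
  linear_combination (poincare A.co * tpow (len (longest A.co) : ℤ) *
    (basisC r).coord C.sigma (klC A.sigma * d)) * e

end AffineHecke

open AffineHecke in
/-- The families `T`, `C` and `θ` are bases, so that the structure constants are well defined;
the constant `g_{A,B,C}` vanishes unless the row and column sums match, and then
`h_{co(A)} g_{A,B,C} = h_{σ(A),σ(B),σ(C)}`, where `h_{co(A)} ≠ 0`. -/
theorem proposition3p2 (n r : ℕ) (hn : 1 ≤ n) (hr : 1 ≤ r) :
    IsBasisFamily (heckeT (r := r)) ∧
    (∀ w : W r, ∃! c : Hecke r, IsKLElement w c) ∧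
    IsBasisFamily (klC (r := r)) ∧
    IsBasisFamily (theta (n := n) (r := r)) ∧
    ∀ A B C : Triple n r,
      (schurStruct A B C ≠ 0 → A.co = B.ro ∧ A.ro = C.ro ∧ B.co = C.co) ∧
      (A.co = B.ro → A.ro = C.ro → B.co = C.co →
        poincare A.co ≠ 0 ∧
        poincare A.co * schurStruct A B C = klStruct A.sigma B.sigma C.sigma) := by
  have : NeZero r := ⟨by omega⟩
  exact ⟨isBasisFamily_heckeT, existsUnique_isKLElement, isBasisFamily_klC, isBasisFamily_theta,
    fun A B C => ⟨eq_of_schurStruct_ne_zero, fun h1 h2 h3 =>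
      ⟨poincare_ne_zero A.co, poincare_mul_schurStruct h1 h2 h3⟩⟩⟩
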